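/- **Setting.** Work on $\mathbb R^{1+3}$ with coordinates $(x^0,x)=(t,x)$ and Minkowski metric $g=\mathrm{diag}(-1,1,1,1)$; Greek indices run over $0,\dots,3$, are summed when repeated, and are moved with $g$. Fix $\gamma>1$ and an integer $k\ge 1$, and put $$\Gamma(s)=\frac{(\gamma-1)^{\frac{\gamma-1}{\gamma}}}{\gamma\, e^{\frac{\gamma-1}{\gamma}s}},\qquad \mathsf\Pi^{\alpha\mu}=g^{\alpha\mu}+u^\alpha u^\mu ,\qquad D_t=u^\mu\partial_\mu .$$ *Background.* Let $T>0$ and $\mathscr D=\bigcup_{0\le t\le T}\{t\}\times\Omega_t$, a relatively open subset of $[0,T]\times\mathbb R^3$. Let $s,r,u^\alpha\in C^\infty(\overline{\mathscr D})$ (that is, they are restrictions of smooth functions on $\mathbb R^{1+3}$) solve in $\mathscr D$ $$D_ts=0,\quad D_tr+(\gamma-1)r\,\partial_\mu u^\mu=0,\quad D_tu^\alpha+\tfrac1{\Gamma+r}\mathsf\Pi^{\alpha\mu}\partial_\mu r=0,\quad u_\alpha u^\alpha=-1,\ u^0>0 .$$ Assume $r>0$ in $\mathscr D$, $r=0$ on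 $\overline{\mathscr D}\setminus\mathscr D$, and, for each $t\in[0,T]$, that $r(t,x)$ is comparable to $\mathrm{dist}(x,\partial\Omega_t)$ for $x\in\Omega_t$ near $\partial\Omega_t$ (physical vacuum boundary condition). *Linearized system.* Let $\tilde s,\tilde r,\tilde u^\alpha\in C^\infty(\overline{\mathscr D})$ solve in $\mathscr D$ $$D_t\tilde s=f,\quad D_t\tilde r+\tilde u^\mu\partial_\mu r+(\gamma-1)r\,\partial_\mu\tilde u^\mu=G,\quad D_t\tilde u^\alpha+\tfrac1{\Gamma+r}\mathsf\Pi^{\alpha\mu}\partial_\mu\tilde r=H^\alpha,\quad \tilde u_\alpha u^\alpha=0,$$ where $f=-\tilde u^\mu\partial_\mu s$, $G=-(\gamma-1)\tilde r\,\partial_\mu u^\mu$ and $$H^\alpha=-\tilde u^\mu\partial_\mu u^\alpha-\tfrac{1}{\Gamma+r}(\tilde u^\alpha u^\mu+u^\alpha\tilde u^\mu)\partial_\mu r+\tfrac{\Gamma'}{(\Gamma+r)^2}\tilde s\,\mathsf\Pi^{\alpha\mu}\partial_\mu r+\tfrac{1}{(\Gamma+r)^2}\tilde r\,\mathsf\Pi^{\alpha\mu}\partial_\mu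 r .$$ *Vorticities.* With $h=\frac{\Gamma+r}{\Gamma}$ and its linearization $\tilde h=\frac{\tilde r}{\Gamma}-\frac{\Gamma'}{\Gamma^2}\,r\,\tilde s$, the reduced and the full linearized vorticity are $$\hat\omega_{\alpha\beta}=\partial_\alpha(h\tilde u_\beta)-\partial_\beta(h\tilde u_\alpha),\qquad \tilde\omega_{\alpha\beta}=\hat\omega_{\alpha\beta}+\partial_\alpha(\tilde h u_\beta)-\partial_\beta(\tilde h u_\alpha),$$ and $\tilde\omega_0$ is $\tilde\omega$ at $t=0$. *Norms* (values in $[0,\infty]$; $\alpha$ is a spatial multi-index, and for vectors and tensors one sums the squares over all space-time components): $$\|f\|^2_{H^{j,\sigma}(\Omega_t)}=\sum_{|\alpha|\le j}\|r^\sigma\partial^\alpha f\|^2_{L^2(\Omega_t)},$$ $$\|(\tilde s,\tilde r,\tilde u)\|^2_{\mathcal H^{2k}(\Omega_t)}=\sum_{|\alpha|\le 2k}\ \sum_{\substack{0\le a\le k\\ |\alpha|-a\le k}}\Big(\|r^{\frac{2-\gamma}{2(\gamma-1)}+\frac12+a}\partial^\alpha\tilde s\|^2_{L^2(\Omega_t)}+\|r^{\frac{2-\gamma}{2(\gamma-1)}+a}\partial^\alpha\tilde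 r\|^2_{L^2(\Omega_t)}+\|r^{\frac{2-\gamma}{2(\gamma-1)}+\frac12+a}\partial^\alpha\tilde u\|^2_{L^2(\Omega_t)}\Big).$$ Let $N(t)$ be the supremum over $\Omega_t$, and over all space-time multi-indices $a$ with $|a|\le 2k+1$, of $|\partial^a s|+|\partial^a r|+\sum_\mu|\partial^a u^\mu|$. **Theorem (Linearized vorticity, transport energy estimates).** There is a nondecreasing function $\mathcal C:[0,\infty)\to[0,\infty)$, depending only on $\gamma$ and $k$, and for every $M\ge 0$ there are constants $C,\mathcal D\ge 0$, depending only on $\gamma,k,M$, such that the following holds for every $T>0$ and every background as above with $N(t)\le M$ for all $t\in[0,T]$. Let $\hat\varepsilon>0$ satisfy $C\hat\varepsilon<\frac12$ and $\|r\|_{L^\infty(\Omega_t)}\le\hat\varepsilon$ for all $t\in[0,T]$, and let $\hat\varepsilon\le\varepsilon<\frac12$. Then for every solution $(\tilde s,\tilde r,\tilde u)$ of the linearized system as above and every $t\in[0,T]$, $$\|\hat\omega\|^2_{H^{2k-1,\,k+\frac1{2(\gamma-1)}}(\Omega_t)}\le\mathcal D\Big(\|\tilde\omega_0\|^2_{H^{2k-1,\,k+\frac1{2(\gamma-1)}}(\Omega_0)}+\varepsilon\,\|(\tilde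 s,\tilde r,\tilde u)\|^2_{\mathcal H^{2k}(\Omega_t)}+\int_0^t\mathcal C(N(\tau))\,\|(\tilde s,\tilde r,\tilde u)\|^2_{\mathcal H^{2k}(\Omega_\tau)}\,d\tau\Big).$$ In particular $\mathcal D$ and $C$ do not depend on $\varepsilon$, $\hat\varepsilon$, $T$ or the linearized solution. -/

import Mathlib

open scoped ENNReal NNReal

namespace RelEuler

noncomputable section

/-- Physical space `ℝ³` with its Euclidean distance and Lebesgue measure. -/
abbrev Space : Type := EuclideanSpace ℝ (Fin 3)

/-- Points `(t, x)` of `ℝ^{1+3}`. -/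
abbrev Spacetime : Type := ℝ × Space

/-- The coordinate vectors of `ℝ^{1+3}`: index `0` is time, indices `1, 2, 3` are space. -/
def basisVec (μ : Fin 4) : Spacetime :=
  Fin.cases (1, 0) (fun i : Fin 3 => (0, EuclideanSpace.single i 1)) μ

/-- The partial derivative `∂_μ f`. -/
def pd (μ : Fin 4) (f : Spacetime → ℝ) (p : Spacetime) : ℝ :=
  fderiv ℝ f p (basisVec μ)

/-- The derivative `∂^a = ∂_0^{a 0} ∂_1^{a 1} ∂_2^{a 2} ∂_3^{a 3}` for a spacetime multi-index. -/
def multiD (a : Fin 4 → ℕ) (f : Spacetime → ℝ) : Spacetime → ℝ :=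
  (pd 0)^[a 0] ((pd 1)^[a 1] ((pd 2)^[a 2] ((pd 3)^[a 3] f)))

/-- The purely spatial derivative `∂^α`, for a spatial multi-index. -/
def spatialD (α : Fin 3 → ℕ) (f : Spacetime → ℝ) : Spacetime → ℝ :=
  multiD (Fin.cons 0 α) f

/-- The Minkowski metric `diag(-1, 1, 1, 1)` (its inverse has the same components). -/
def mink (α β : Fin 4) : ℝ :=
  if α = β then (if α = 0 then -1 else 1) else 0

/-- Lowering an index: `w_α = g_{αβ} w^β`. -/
def lower (w : Fin 4 → Spacetime → ℝ) (α : Fin 4) (p : Spacetime) : ℝ :=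
  ∑ β, mink α β * w β p

/-- The projection `Π^{αμ} = g^{αμ} + u^α u^μ`. -/
def proj (u : Fin 4 → Spacetime → ℝ) (α μ : Fin 4) (p : Spacetime) : ℝ :=
  mink α μ + u α p * u μ p

/-- The directional derivative `w^μ ∂_μ f`; for `w = u` it is the convective derivative `D_t f`. -/
def along (w : Fin 4 → Spacetime → ℝ) (f : Spacetime → ℝ) (p : Spacetime) : ℝ :=
  ∑ μ, w μ p * pd μ f p

/-- The divergence `∂_μ w^μ`. -/
def divg (w : Fin 4 → Spacetime → ℝ) (p : Spacetime) : ℝ :=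
  ∑ μ, pd μ (w μ) p

/-- `Γ(s) = (γ-1)^{(γ-1)/γ} / (γ e^{((γ-1)/γ) s})`. -/
def Gam (γ : ℝ) (s : ℝ) : ℝ :=
  (γ - 1) ^ ((γ - 1) / γ) / (γ * Real.exp ((γ - 1) / γ * s))

/-- The moving domain `𝒟 = ⋃_{0 ≤ t ≤ T} {t} × Ω_t`. -/
def movingDomain (T : ℝ) (Ω : ℝ → Set Space) : Set Spacetime :=
  {p | p.1 ∈ Set.Icc 0 T ∧ p.2 ∈ Ω p.1}

/-- `(s, r, u)` solves the relativistic Euler equations of an ideal gas in the moving domain.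
Functions smooth up to the boundary of the moving domain are represented by smooth functions on
`ℝ^{1+3}`; only their values on the moving domain matter. -/
structure IsEulerSolution (γ T : ℝ) (Ω : ℝ → Set Space)
    (s r : Spacetime → ℝ) (u : Fin 4 → Spacetime → ℝ) : Prop where
  smooth_s : ContDiff ℝ (⊤ : ℕ∞) s
  smooth_r : ContDiff ℝ (⊤ : ℕ∞) r
  smooth_u : ∀ α, ContDiff ℝ (⊤ : ℕ∞) (u α)
  eq_s : ∀ p ∈ movingDomain T Ω, along u s p = 0
  eq_r : ∀ p ∈ movingDomain T Ω, along u r p + (γ - 1) * r p * divg u p = 0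
  eq_u : ∀ p ∈ movingDomain T Ω, ∀ α,
    along u (u α) p + 1 / (Gam γ (s p) + r p) * ∑ μ, proj u α μ p * pd μ r p = 0
  normalized : ∀ p ∈ movingDomain T Ω, ∑ α, lower u α p * u α p = -1
  forward : ∀ p ∈ movingDomain T Ω, 0 < u 0 p

/-- The gas occupies `Ω_t = {r(t, ·) > 0}`, `r` vanishes on the free boundary, and the physical
vacuum boundary condition holds: near `∂Ω_t`, `r` is comparable to the distance to `∂Ω_t`. -/
structure IsPhysicalVacuum (T : ℝ) (Ω : ℝ → Set Space) (r : Spacetime → ℝ) : Prop where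
  relOpen : ∃ U : Set Spacetime, IsOpen U ∧
    movingDomain T Ω = U ∩ (Set.Icc 0 T ×ˢ Set.univ)
  pos : ∀ p ∈ movingDomain T Ω, 0 < r p
  vanish : ∀ p ∈ closure (movingDomain T Ω) \ movingDomain T Ω, r p = 0
  comparable : ∀ t ∈ Set.Icc 0 T, ∃ c₁ c₂ δ : ℝ, 0 < c₁ ∧ 0 < c₂ ∧ 0 < δ ∧
    ∀ x ∈ Ω t, Metric.infDist x (frontier (Ω t)) < δ →
      c₁ * Metric.infDist x (frontier (Ω t)) ≤ r (t, x) ∧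
        r (t, x) ≤ c₂ * Metric.infDist x (frontier (Ω t))

/-- The right-hand side `f = - ũ^μ ∂_μ s`. -/
def srcF (s : Spacetime → ℝ) (u' : Fin 4 → Spacetime → ℝ) (p : Spacetime) : ℝ :=
  - along u' s p

/-- The right-hand side `g = - (γ-1) r̃ ∂_μ u^μ`. -/
def srcG (γ : ℝ) (u : Fin 4 → Spacetime → ℝ) (r' : Spacetime → ℝ) (p : Spacetime) : ℝ :=
  - ((γ - 1) * r' p * divg u p)

/-- The right-hand side `h^α`. -/
def srcH (γ : ℝ) (s r : Spacetime → ℝ) (u : Fin 4 → Spacetime → ℝ)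
    (s' r' : Spacetime → ℝ) (u' : Fin 4 → Spacetime → ℝ) (α : Fin 4) (p : Spacetime) : ℝ :=
  - along u' (u α) p
    - 1 / (Gam γ (s p) + r p) * ∑ μ, (u' α p * u μ p + u α p * u' μ p) * pd μ r p
    + deriv (Gam γ) (s p) / (Gam γ (s p) + r p) ^ 2 * s' p * ∑ μ, proj u α μ p * pd μ r p
    + 1 / (Gam γ (s p) + r p) ^ 2 * r' p * ∑ μ, proj u α μ p * pd μ r p

/-- `(s', r', u') = (s̃, r̃, ũ)` solves the linearization about `(s, r, u)`. -/
structure IsLinearizedSolution (γ T : ℝ) (Ω : ℝ → Set Space)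
    (s r : Spacetime → ℝ) (u : Fin 4 → Spacetime → ℝ)
    (s' r' : Spacetime → ℝ) (u' : Fin 4 → Spacetime → ℝ) : Prop where
  smooth_s : ContDiff ℝ (⊤ : ℕ∞) s'
  smooth_r : ContDiff ℝ (⊤ : ℕ∞) r'
  smooth_u : ∀ α, ContDiff ℝ (⊤ : ℕ∞) (u' α)
  eq_s : ∀ p ∈ movingDomain T Ω, along u s' p = srcF s u' p
  eq_r : ∀ p ∈ movingDomain T Ω,
    along u r' p + along u' r p + (γ - 1) * r p * divg u' p = srcG γ u r' p
  eq_u : ∀ p ∈ movingDomain T Ω, ∀ α,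
    along u (u' α) p + 1 / (Gam γ (s p) + r p) * ∑ μ, proj u α μ p * pd μ r' p
      = srcH γ s r u s' r' u' α p
  orthogonal : ∀ p ∈ movingDomain T Ω, ∑ α, lower u' α p * u α p = 0

/-- The enthalpy `h = (Γ(s) + r) / Γ(s)`. -/
def enthalpy (γ : ℝ) (s r : Spacetime → ℝ) (p : Spacetime) : ℝ :=
  (Gam γ (s p) + r p) / Gam γ (s p)

/-- The linearized enthalpy `h̃ = δ(1 + r / Γ(s)) = r̃ / Γ - (Γ' / Γ²) r s̃`. -/
def linEnthalpy (γ : ℝ) (s r s' r' : Spacetime → ℝ) (p : Spacetime) : ℝ :=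
  r' p / Gam γ (s p) - deriv (Gam γ) (s p) / Gam γ (s p) ^ 2 * r p * s' p

/-- The reduced linearized vorticity `ω̂_{αβ} = ∂_α (h ũ_β) - ∂_β (h ũ_α)`. -/
def redVorticity (γ : ℝ) (s r : Spacetime → ℝ) (u' : Fin 4 → Spacetime → ℝ)
    (α β : Fin 4) (p : Spacetime) : ℝ :=
  pd α (fun q => enthalpy γ s r q * lower u' β q) p
    - pd β (fun q => enthalpy γ s r q * lower u' α q) p

/-- The full linearized vorticity
`ω̃_{αβ} = ∂_α (h ũ_β) - ∂_β (h ũ_α) + ∂_α (h̃ u_β) - ∂_β (h̃ u_α)`. -/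
def linVorticity (γ : ℝ) (s r : Spacetime → ℝ) (u : Fin 4 → Spacetime → ℝ)
    (s' r' : Spacetime → ℝ) (u' : Fin 4 → Spacetime → ℝ)
    (α β : Fin 4) (p : Spacetime) : ℝ :=
  redVorticity γ s r u' α β p
    + (pd α (fun q => linEnthalpy γ s r s' r' q * lower u β q) p
      - pd β (fun q => linEnthalpy γ s r s' r' q * lower u α q) p)

/-- `‖r^σ f‖²_{L²(Ω_t)}`, possibly infinite. -/
def wL2Sq (Ω : ℝ → Set Space) (r : Spacetime → ℝ) (σ t : ℝ) (f : Spacetime → ℝ) : ℝ≥0∞ :=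
  ∫⁻ x in Ω t, ‖r (t, x) ^ σ * f (t, x)‖ₑ ^ 2

/-- The spatial multi-indices of order exactly `n`. -/
def multiIdx (n : ℕ) : Finset (Fin 3 → ℕ) := Finset.piAntidiag Finset.univ n

/-- `‖f‖²_{H^{j,σ}(Ω_t)} = ∑_{|α| ≤ j} ‖r^σ ∂^α f‖²_{L²(Ω_t)}`. -/
def sobSq (Ω : ℝ → Set Space) (r : Spacetime → ℝ) (j : ℕ) (σ t : ℝ)
    (f : Spacetime → ℝ) : ℝ≥0∞ :=
  ∑ n ∈ Finset.range (j + 1), ∑ α ∈ multiIdx n, wL2Sq Ω r σ t (spatialD α f)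

/-- The squared `H^{j,σ}(Ω_t)` norm of a two-tensor, summed over its components. -/
def sobSqForm (Ω : ℝ → Set Space) (r : Spacetime → ℝ) (j : ℕ) (σ t : ℝ)
    (w : Fin 4 → Fin 4 → Spacetime → ℝ) : ℝ≥0∞ :=
  ∑ α, ∑ β, sobSq Ω r j σ t (w α β)

/-- The squared `𝓗^{2k}(Ω_t)` norm of `(s̃, r̃, ũ)`: the sum over all spatial multi-indices `α`
with `|α| ≤ 2k` and all integers `0 ≤ a ≤ k` with `|α| - a ≤ k`. -/
def calHSq (γ : ℝ) (Ω : ℝ → Set Space) (r : Spacetime → ℝ) (k : ℕ)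
    (s' r' : Spacetime → ℝ) (u' : Fin 4 → Spacetime → ℝ) (t : ℝ) : ℝ≥0∞ :=
  ∑ n ∈ Finset.range (2 * k + 1), ∑ α ∈ multiIdx n,
    ∑ a ∈ (Finset.range (k + 1)).filter (fun a => n ≤ k + a),
      (wL2Sq Ω r ((2 - γ) / (2 * (γ - 1)) + 1 / 2 + a) t (spatialD α s')
        + wL2Sq Ω r ((2 - γ) / (2 * (γ - 1)) + a) t (spatialD α r')
        + ∑ μ, wL2Sq Ω r ((2 - γ) / (2 * (γ - 1)) + 1 / 2 + a) t (spatialD α (u' μ)))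

/-- The `L^∞(Ω_t)` size of `(s, r, u)` and of their partial derivatives of order at most `m`. -/
def supNorm (m : ℕ) (Ω : ℝ → Set Space) (s r : Spacetime → ℝ) (u : Fin 4 → Spacetime → ℝ)
    (t : ℝ) : ℝ≥0∞ :=
  ⨆ (a : Fin 4 → ℕ) (_ : ∑ μ, a μ ≤ m) (x : Space) (_ : x ∈ Ω t),
    (‖multiD a s (t, x)‖ₑ + ‖multiD a r (t, x)‖ₑ + ∑ μ, ‖multiD a (u μ) (t, x)‖ₑ)

end

end RelEuler

/-!
The estimate compares three quantities: the reduced vorticity `ω̂ = d(h ũ)`, the full linearized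
vorticity `ω̃ = d(h ũ) + d(h̃ u)`, and the energy density, that is, the integrand of the squared
`𝓗^{2k}` norm. All comparisons are pointwise on the moving domain, so no Hardy or interpolation
inequality is needed; the only integration by parts is the one in the energy estimate.

*Pointwise bounds.* Let `A` be the square root of the energy density and `σ = k + 1 / (2 (γ - 1))`.
Up to `2k` spatial derivatives of `s̃, ũ` are bounded by `A r^{-σ}`, those of `r̃` by
`A r^{-σ + 1/2}`; with one derivative less, a full power of `r` is gained (`wBound_s'_u'_r'`). The
class `TwoTier` records both bounds, is stable under multiplication by background coefficients, and
gains half a power of `r` under multiplication by `r` (`TwoTier.r_mul`). The equations are solved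
for the time derivatives. Since `∂_t ũ⁰` enters the equation of `r̃` with a factor `r` and the gas is
thin, the system is invertible, and `∂_t r̃` is as good as a spatial derivative of `r̃`
(`twoTier_time_r'`). Consequently `ω̂` and `ω̃` are bounded by `A r^{-σ}` with `2k - 1` derivatives,
and `ω̃ - ω̂ = d(h̃ u)` is half a power of `r` better (`twoTier_vorticity_correction`). As `r ≤ ε`,
the square of the difference costs `ε` times the energy at time `t`.

*Transport.* Linearizing `u^α ω_{αβ} = θ ∂_β s`, `θ = ((γ - 1) / γ) r / Γ(s)`, gives a formula for
`u^α ω̃_{αβ}` (`LinFlow.sum_u_linVort`). Because `ω̃` is closed, its derivative along `u` is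
determined by the exterior derivative of that formula, in which the second derivatives of `s̃` cancel
(`LinFlow.along_linVort`). The result is again bounded by `A r^{-σ}` with `2k - 1` derivatives
(`twoTier_vortSource`). Commuting spatial derivatives with `∂_t + (u^i / u⁰) ∂_i` produces no time
derivatives (`TransportBound.pd`).

*Energy.* The weight `r^{2σ}`, extended by zero, is continuously differentiable up to the free
boundary since `2σ > 1`, and `D_t r^{2σ}` is a bounded multiple of `r^{2σ}`. The divergence theorem
for the current `r^{2σ} |∂^δ ω̃|² u^μ` bounds the weighted norm at time `t` by the initial one and
the time integral of the energy (`wL2Sq_transport_le`). Integrability at spatial infinity is not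
assumed: the current is cut off by a function that decreases along `u`, as in a backward light cone
(`lintegral_energy_le`). Grönwall's inequality is not used, because `ω̃` itself is bounded by the
energy; hence the constants do not depend on the length of the time interval.
-/

open scoped ENNReal NNReal

namespace RelEuler

/-! ### Partial derivatives -/

theorem contDiffAt_pd {f : Spacetime → ℝ} {p : Spacetime} (hf : ContDiffAt ℝ (⊤ : ℕ∞) f p)
    (μ : Fin 4) : ContDiffAt ℝ (⊤ : ℕ∞) (pd μ f) p :=
  (hf.fderiv_right (m := (⊤ : ℕ∞)) (by simp)).clm_apply contDiffAt_const

theorem contDiff_pd {f : Spacetime → ℝ} (hf : ContDiff ℝ (⊤ : ℕ∞) f) (μ : Fin 4) :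
    ContDiff ℝ (⊤ : ℕ∞) (pd μ f) :=
  contDiff_iff_contDiffAt.2 fun _ => contDiffAt_pd hf.contDiffAt μ

theorem pd_add {f g : Spacetime → ℝ} {p : Spacetime} (hf : DifferentiableAt ℝ f p)
    (hg : DifferentiableAt ℝ g p) (μ : Fin 4) :
    pd μ (fun q => f q + g q) p = pd μ f p + pd μ g p := by
  simp [pd, fderiv_fun_add hf hg]

theorem pd_sub {f g : Spacetime → ℝ} {p : Spacetime} (hf : DifferentiableAt ℝ f p)
    (hg : DifferentiableAt ℝ g p) (μ : Fin 4) :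
    pd μ (fun q => f q - g q) p = pd μ f p - pd μ g p := by
  simp [pd, fderiv_fun_sub hf hg]

theorem pd_mul {f g : Spacetime → ℝ} {p : Spacetime} (hf : DifferentiableAt ℝ f p)
    (hg : DifferentiableAt ℝ g p) (μ : Fin 4) :
    pd μ (fun q => f q * g q) p = pd μ f p * g p + f p * pd μ g p := by
  simp [pd, fderiv_fun_mul hf hg]; ring

theorem pd_const (c : ℝ) (μ : Fin 4) (p : Spacetime) : pd μ (fun _ => c) p = 0 := by
  simp [pd]

theorem pd_const_mul {f : Spacetime → ℝ} {p : Spacetime} (hf : DifferentiableAt ℝ f p) (c : ℝ)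
    (μ : Fin 4) : pd μ (fun q => c * f q) p = c * pd μ f p := by
  rw [pd_mul (differentiableAt_const c) hf, pd_const, zero_mul, zero_add]

theorem pd_sum {κ : Type*} (t : Finset κ) {f : κ → Spacetime → ℝ} {p : Spacetime}
    (hf : ∀ i ∈ t, DifferentiableAt ℝ (f i) p) (μ : Fin 4) :
    pd μ (fun q => ∑ i ∈ t, f i q) p = ∑ i ∈ t, pd μ (f i) p := by
  simp [pd, fderiv_fun_sum hf]

theorem pd_inv {f : Spacetime → ℝ} {p : Spacetime} (hf : DifferentiableAt ℝ f p) (h0 : f p ≠ 0)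
    (μ : Fin 4) : pd μ (fun q => (f q)⁻¹) p = - (pd μ f p * ((f p)⁻¹ * (f p)⁻¹)) := by
  have := ((hasDerivAt_inv h0).comp_hasFDerivAt p hf.hasFDerivAt).fderiv
  simp only [Function.comp_def] at this
  simp [pd, this]
  field_simp

theorem pd_exp {f : Spacetime → ℝ} {p : Spacetime} (hf : DifferentiableAt ℝ f p) (μ : Fin 4) :
    pd μ (fun q => Real.exp (f q)) p = pd μ f p * Real.exp (f p) := by
  have := (hf.hasFDerivAt.exp).fderiv
  simp [pd, this]; ring

theorem pd_comm {f : Spacetime → ℝ} {p : Spacetime} (hf : ContDiffAt ℝ (⊤ : ℕ∞) f p)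
    (μ ν : Fin 4) : pd μ (pd ν f) p = pd ν (pd μ f) p := by
  have hsymm : IsSymmSndFDerivAt ℝ f p := by
    apply hf.isSymmSndFDerivAt
    simpa using WithTop.coe_le_coe.2 (le_top : (2 : ℕ∞) ≤ ⊤)
  have hd : DifferentiableAt ℝ (fderiv ℝ f) p :=
    (hf.fderiv_right (m := (⊤ : ℕ∞)) (by simp)).differentiableAt (by simp)
  have key : ∀ v w : Spacetime,
      fderiv ℝ (fun q => fderiv ℝ f q w) p v = fderiv ℝ (fderiv ℝ f) p v w := by
    intro v w
    rw [(hd.hasFDerivAt.clm_apply (hasFDerivAt_const w p)).fderiv]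
    simp
  change fderiv ℝ (fun q => fderiv ℝ f q (basisVec ν)) p (basisVec μ)
    = fderiv ℝ (fun q => fderiv ℝ f q (basisVec μ)) p (basisVec ν)
  rw [key, key]
  exact hsymm _ _

/-- Functions that agree on a set of unique differentiability have the same partial derivatives
there, those in time at the initial and final instants included. -/
theorem pd_congr {s : Set Spacetime} (hs : UniqueDiffOn ℝ s) {f g : Spacetime → ℝ}
    {p : Spacetime} (hp : p ∈ s) (hf : DifferentiableAt ℝ f p) (hg : DifferentiableAt ℝ g p)
    (h : Set.EqOn f g s) (μ : Fin 4) : pd μ f p = pd μ g p := by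
  have h1 := (hs p hp).eq (hf.hasFDerivAt.hasFDerivWithinAt (s := s))
    ((hg.hasFDerivAt.hasFDerivWithinAt (s := s)).congr h (h hp))
  simp [pd, h1]

theorem iterate_pd_smooth {f : Spacetime → ℝ} (hf : ContDiff ℝ (⊤ : ℕ∞) f) (μ : Fin 4) (n : ℕ) :
    ContDiff ℝ (⊤ : ℕ∞) ((pd μ)^[n] f) := by
  induction n generalizing f with
  | zero => exact hf
  | succ n ih => exact ih (contDiff_pd hf μ)

theorem contDiff_multiD {f : Spacetime → ℝ} (hf : ContDiff ℝ (⊤ : ℕ∞) f) (a : Fin 4 → ℕ) :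
    ContDiff ℝ (⊤ : ℕ∞) (multiD a f) := by
  unfold multiD
  exact iterate_pd_smooth (iterate_pd_smooth (iterate_pd_smooth (iterate_pd_smooth hf _ _) _ _)
    _ _) _ _

theorem contDiff_spatialD {f : Spacetime → ℝ} (hf : ContDiff ℝ (⊤ : ℕ∞) f) (α : Fin 3 → ℕ) :
    ContDiff ℝ (⊤ : ℕ∞) (spatialD α f) := contDiff_multiD hf _

theorem iterate_pd_comm {f : Spacetime → ℝ} (hf : ContDiff ℝ (⊤ : ℕ∞) f) (μ ν : Fin 4) (n : ℕ) :
    (pd ν)^[n] (pd μ f) = pd μ ((pd ν)^[n] f) := by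
  induction n generalizing f with
  | zero => rfl
  | succ n ih =>
    have : pd ν (pd μ f) = pd μ (pd ν f) := funext fun p => pd_comm hf.contDiffAt ν μ
    rw [Function.iterate_succ_apply, this, ih (contDiff_pd hf ν), Function.iterate_succ_apply]

theorem multiD_pd {f : Spacetime → ℝ} (hf : ContDiff ℝ (⊤ : ℕ∞) f) (a : Fin 4 → ℕ) (μ : Fin 4) :
    multiD a (pd μ f) = multiD (a + Pi.single μ 1) f := by
  have s3 := iterate_pd_smooth hf 3 (a 3)
  have s2 := iterate_pd_smooth s3 2 (a 2)
  have s1 := iterate_pd_smooth s2 1 (a 1)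
  unfold multiD
  fin_cases μ <;> simp [iterate_pd_comm hf, iterate_pd_comm s3,
    iterate_pd_comm s2, iterate_pd_comm s1, Function.iterate_succ_apply']

theorem spatialD_pd {f : Spacetime → ℝ} (hf : ContDiff ℝ (⊤ : ℕ∞) f) (α : Fin 3 → ℕ)
    (j : Fin 3) : spatialD α (pd j.succ f) = spatialD (α + Pi.single j 1) f := by
  unfold spatialD
  rw [multiD_pd hf]
  congr 1
  funext μ
  refine Fin.cases ?_ (fun i => ?_) μ
  · simp [(Fin.succ_ne_zero j).symm]
  · simp [Pi.single_apply]

theorem multiD_zero (f : Spacetime → ℝ) : multiD 0 f = f := rfl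

theorem spatialD_zero (f : Spacetime → ℝ) : spatialD 0 f = f := by
  funext p; simp [spatialD, multiD, Fin.cons]; rfl

/-! ### Families of functions with bounded jets -/

section JetBound

/-- A family of subsets of spacetime on which derivatives are determined by values. -/
structure DomainFamily (ι : Type*) where
  /-- The sets of the family. -/
  carrier : ι → Set Spacetime
  uniqueDiffOn : ∀ S, UniqueDiffOn ℝ (carrier S)

variable {ι : Type*} (D : DomainFamily ι)

/-- The family `f` is smooth at the points of the domains. -/
def SmoothFamily (f : ι → Spacetime → ℝ) : Prop :=
  ∀ S, ∀ p ∈ D.carrier S, ContDiffAt ℝ (⊤ : ℕ∞) (f S) p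

/-- The family `f` is smooth on the domains and is dominated there by a multiple of the weight `ρ`,
with the same constant for all members of the family. -/
def Dominated (ρ f : ι → Spacetime → ℝ) : Prop :=
  SmoothFamily D f ∧ ∃ C : ℝ, ∀ S, ∀ p ∈ D.carrier S, |f S p| ≤ C * ρ S p

/-- The family `f` and its derivatives of order at most `m` in the coordinate directions `v` are
dominated by `ρ`; `v = Fin.succ` gives the spatial derivatives and `v = id` all of them. Since the
constants are uniform in the index, a bound that depends only on the parameters defining the index
type is a statement about one family. -/
def JetBound {d : ℕ} (v : Fin d → Fin 4) (ρ : ι → Spacetime → ℝ) : ℕ → (ι → Spacetime → ℝ) → Prop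
  | 0, f => Dominated D ρ f
  | m + 1, f => Dominated D ρ f ∧ ∀ j : Fin d, JetBound v ρ m (fun S => pd (v j) (f S))

variable {d : ℕ} {v : Fin d → Fin 4} {D} {ρ ρ₁ ρ₂ f g : ι → Spacetime → ℝ} {m : ℕ}

theorem SmoothFamily.differentiableAt (hf : SmoothFamily D f) {S : ι} {p : Spacetime}
    (hp : p ∈ D.carrier S) : DifferentiableAt ℝ (f S) p :=
  (hf S p hp).differentiableAt (by simp)

theorem SmoothFamily.pd (hf : SmoothFamily D f) (μ : Fin 4) :
    SmoothFamily D (fun S => pd μ (f S)) := fun S p hp => contDiffAt_pd (hf S p hp) μ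

theorem SmoothFamily.add (hf : SmoothFamily D f) (hg : SmoothFamily D g) :
    SmoothFamily D (fun S p => f S p + g S p) := fun S p hp => (hf S p hp).add (hg S p hp)

theorem SmoothFamily.mul (hf : SmoothFamily D f) (hg : SmoothFamily D g) :
    SmoothFamily D (fun S p => f S p * g S p) := fun S p hp => (hf S p hp).mul (hg S p hp)

theorem SmoothFamily.const (c : ℝ) : SmoothFamily D (fun _ _ => c) :=
  fun _ _ _ => contDiffAt_const

theorem SmoothFamily.inv (hf : SmoothFamily D f) (h0 : ∀ S, ∀ p ∈ D.carrier S, f S p ≠ 0) :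
    SmoothFamily D (fun S p => (f S p)⁻¹) := fun S p hp => (hf S p hp).inv (h0 S p hp)

theorem SmoothFamily.pd_congr (hf : SmoothFamily D f) (hg : SmoothFamily D g)
    (h : ∀ S, ∀ p ∈ D.carrier S, f S p = g S p) (μ : Fin 4) :
    ∀ S, ∀ p ∈ D.carrier S, RelEuler.pd μ (f S) p = RelEuler.pd μ (g S) p := fun S _ hp =>
  RelEuler.pd_congr (D.uniqueDiffOn S) hp (hf.differentiableAt hp) (hg.differentiableAt hp)
    (fun q hq => h S q hq) μ

theorem JetBound.dominated (hf : JetBound D v ρ m f) : Dominated D ρ f := by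
  cases m with
  | zero => exact hf
  | succ m => exact hf.1

theorem JetBound.smooth (hf : JetBound D v ρ m f) : SmoothFamily D f := hf.dominated.1

theorem JetBound.pd (hf : JetBound D v ρ (m + 1) f) (j : Fin d) :
    JetBound D v ρ m (fun S => pd (v j) (f S)) := hf.2 j

theorem JetBound.of_succ (hf : JetBound D v ρ (m + 1) f) : JetBound D v ρ m f := by
  induction m generalizing f with
  | zero => exact hf.1
  | succ m ih => exact ⟨hf.1, fun j => ih (hf.2 j)⟩

theorem JetBound.mono {n : ℕ} (hf : JetBound D v ρ n f) (h : m ≤ n) : JetBound D v ρ m f := by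
  induction n, h using Nat.le_induction with
  | base => exact hf
  | succ n _ ih => exact ih hf.of_succ

theorem JetBound.of_id (hf : JetBound D id ρ m f) : JetBound D v ρ m f := by
  induction m generalizing f with
  | zero => exact hf
  | succ m ih => exact ⟨hf.1, fun j => ih (hf.2 (v j))⟩

theorem JetBound.congr (hf : JetBound D v ρ m f) (hg : SmoothFamily D g)
    (h : ∀ S, ∀ p ∈ D.carrier S, f S p = g S p) : JetBound D v ρ m g := by
  have hdom : Dominated D ρ g := by
    obtain ⟨C, hC⟩ := hf.dominated.2
    exact ⟨hg, C, fun S p hp => by rw [← h S p hp]; exact hC S p hp⟩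
  induction m generalizing f g with
  | zero => exact hdom
  | succ m ih =>
    refine ⟨hdom, fun j => ?_⟩
    have h' := hf.smooth.pd_congr hg h (v j)
    refine ih (hf.2 j) (hg.pd _) h' ?_
    obtain ⟨C, hC⟩ := (hf.2 j).dominated.2
    exact ⟨hg.pd _, C, fun S p hp => by simpa only [h' S p hp] using hC S p hp⟩

theorem JetBound.mono_weight (hf : JetBound D v ρ₁ m f)
    (h : ∃ C : ℝ, ∀ S, ∀ p ∈ D.carrier S, 0 ≤ ρ₁ S p ∧ ρ₁ S p ≤ C * ρ₂ S p) :
    JetBound D v ρ₂ m f := by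
  have key : ∀ {f : ι → Spacetime → ℝ}, Dominated D ρ₁ f → Dominated D ρ₂ f := by
    rintro f ⟨hs, C, hC⟩
    obtain ⟨C', hC'⟩ := h
    refine ⟨hs, |C| * C', fun S p hp => ?_⟩
    have h1 := hC S p hp
    obtain ⟨h2, h3⟩ := hC' S p hp
    calc |f S p| ≤ C * ρ₁ S p := h1
      _ ≤ |C| * ρ₁ S p := by gcongr; exact le_abs_self C
      _ ≤ |C| * (C' * ρ₂ S p) := by gcongr
      _ = _ := by ring
  induction m generalizing f with
  | zero => exact key hf
  | succ m ih => exact ⟨key hf.1, fun j => ih (hf.2 j)⟩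

theorem Dominated.add (hf : Dominated D ρ f) (hg : Dominated D ρ g) :
    Dominated D ρ (fun S p => f S p + g S p) := by
  obtain ⟨hf, C, hC⟩ := hf
  obtain ⟨hg, C', hC'⟩ := hg
  refine ⟨hf.add hg, C + C', fun S p hp => ?_⟩
  calc |f S p + g S p| ≤ |f S p| + |g S p| := abs_add_le _ _
    _ ≤ C * ρ S p + C' * ρ S p := add_le_add (hC S p hp) (hC' S p hp)
    _ = _ := by ring

theorem JetBound.add (hf : JetBound D v ρ m f) (hg : JetBound D v ρ m g) :
    JetBound D v ρ m (fun S p => f S p + g S p) := by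
  induction m generalizing f g with
  | zero => exact Dominated.add hf hg
  | succ m ih =>
    refine ⟨Dominated.add hf.1 hg.1, fun j => ?_⟩
    refine (ih (hf.2 j) (hg.2 j)).congr ((hf.smooth.add hg.smooth).pd _) fun S p hp => ?_
    rw [pd_add (hf.smooth.differentiableAt hp) (hg.smooth.differentiableAt hp)]

/-- The Leibniz rule: jets multiply, and so do their weights. -/
theorem JetBound.mul_weights (hf : JetBound D v ρ₁ m f) (hg : JetBound D v ρ₂ m g)
    (hρ : ∀ S, ∀ p ∈ D.carrier S, ρ₁ S p * ρ₂ S p = ρ S p) :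
    JetBound D v ρ m (fun S p => f S p * g S p) := by
  have key : ∀ {f g : ι → Spacetime → ℝ}, Dominated D ρ₁ f → Dominated D ρ₂ g →
      Dominated D ρ (fun S p => f S p * g S p) := by
    rintro f g ⟨hf, C, hC⟩ ⟨hg, C', hC'⟩
    refine ⟨hf.mul hg, C * C', fun S p hp => ?_⟩
    rw [abs_mul]
    calc |f S p| * |g S p| ≤ (C * ρ₁ S p) * (C' * ρ₂ S p) :=
          mul_le_mul (hC S p hp) (hC' S p hp) (abs_nonneg _) ((abs_nonneg _).trans (hC S p hp))
      _ = _ := by rw [← hρ S p hp]; ring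
  induction m generalizing f g with
  | zero => exact key hf hg
  | succ m ih =>
    refine ⟨key hf.1 hg.1, fun j => ?_⟩
    refine ((ih (hf.2 j) hg.of_succ).add (ih hf.of_succ (hg.2 j))).congr
      ((hf.smooth.mul hg.smooth).pd _) fun S p hp => ?_
    rw [pd_mul (hf.smooth.differentiableAt hp) (hg.smooth.differentiableAt hp)]

theorem JetBound.zero (m : ℕ) : JetBound D v ρ m (fun _ _ => 0) := by
  have key : Dominated D ρ (fun _ _ => 0) := ⟨.const 0, 0, fun S p _ => by simp⟩
  induction m with
  | zero => exact key
  | succ m ih =>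
    refine ⟨key, fun j => ?_⟩
    refine ih.congr ((SmoothFamily.const 0).pd _) fun S p hp => ?_
    rw [pd_const]

theorem JetBound.sum {κ : Type*} (t : Finset κ) {f : κ → ι → Spacetime → ℝ}
    (hf : ∀ i ∈ t, JetBound D v ρ m (f i)) : JetBound D v ρ m (fun S p => ∑ i ∈ t, f i S p) := by
  classical
  induction t using Finset.induction_on with
  | empty => simpa using JetBound.zero m
  | insert a t ha ih =>
    simp only [Finset.sum_insert ha]
    exact (hf a (by simp)).add (ih fun i hi => hf i (by simp [hi]))

variable (D v) in
/-- Uniformly bounded jets: the coefficients of linear combinations. -/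
abbrev BddJet (m : ℕ) (f : ι → Spacetime → ℝ) : Prop := JetBound D v (fun _ _ => 1) m f

theorem BddJet.mul (hf : BddJet D v m f) (hg : JetBound D v ρ m g) :
    JetBound D v ρ m (fun S p => f S p * g S p) :=
  JetBound.mul_weights hf hg fun _ _ _ => one_mul _

theorem BddJet.const (c : ℝ) (m : ℕ) : BddJet D v m (fun _ _ => c) := by
  have key : Dominated D (fun _ _ => 1) (fun (_ : ι) _ => c) :=
    ⟨.const c, |c|, fun _ _ _ => by simp⟩
  cases m with
  | zero => exact key
  | succ m =>
    refine ⟨key, fun j => ?_⟩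
    refine (JetBound.zero m).congr ((SmoothFamily.const c).pd _) fun S p hp => ?_
    rw [pd_const]

theorem JetBound.const_mul (c : ℝ) (hf : JetBound D v ρ m f) :
    JetBound D v ρ m (fun S p => c * f S p) := (BddJet.const c m).mul hf

theorem JetBound.neg (hf : JetBound D v ρ m f) : JetBound D v ρ m (fun S p => - f S p) := by
  simpa using hf.const_mul (-1)

theorem JetBound.sub (hf : JetBound D v ρ m f) (hg : JetBound D v ρ m g) :
    JetBound D v ρ m (fun S p => f S p - g S p) := by
  simpa [sub_eq_add_neg] using hf.add hg.neg

theorem BddJet.inv (hf : BddJet D v m f)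
    (h0 : ∃ δ : ℝ, 0 < δ ∧ ∀ S, ∀ p ∈ D.carrier S, δ ≤ f S p) :
    BddJet D v m (fun S p => (f S p)⁻¹) := by
  obtain ⟨δ, hδ, h0⟩ := h0
  have hpos : ∀ S, ∀ p ∈ D.carrier S, 0 < f S p := fun S p hp => hδ.trans_le (h0 S p hp)
  have hs : SmoothFamily D (fun S p => (f S p)⁻¹) :=
    hf.smooth.inv fun S p hp => (hpos S p hp).ne'
  have key : Dominated D (fun _ _ => 1) (fun S p => (f S p)⁻¹) := by
    refine ⟨hs, δ⁻¹, fun S p hp => ?_⟩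
    rw [abs_of_pos (inv_pos.2 (hpos S p hp)), mul_one]
    exact inv_anti₀ hδ (h0 S p hp)
  induction m with
  | zero => exact key
  | succ m ih =>
    refine ⟨key, fun j => ?_⟩
    have hi := ih hf.of_succ
    refine (BddJet.mul (hf.2 j) (hi.mul hi)).neg.congr (hs.pd _) fun S p hp => ?_
    rw [pd_inv (hf.smooth.differentiableAt hp) (hpos S p hp).ne']

theorem BddJet.exp (hf : BddJet D v m f) : BddJet D v m (fun S p => Real.exp (f S p)) := by
  have hs : SmoothFamily D (fun S p => Real.exp (f S p)) :=
    fun S p hp => (hf.smooth S p hp).exp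
  have key : Dominated D (fun _ _ => 1) (fun S p => Real.exp (f S p)) := by
    obtain ⟨C, hC⟩ := hf.dominated.2
    refine ⟨hs, Real.exp C, fun S p hp => ?_⟩
    rw [abs_of_pos (Real.exp_pos _), mul_one, Real.exp_le_exp]
    simpa using (le_abs_self _).trans (hC S p hp)
  induction m with
  | zero => exact key
  | succ m ih =>
    refine ⟨key, fun j => ?_⟩
    refine (BddJet.mul (hf.2 j) (ih hf.of_succ)).congr (hs.pd _) fun S p hp => ?_
    rw [pd_exp (hf.smooth.differentiableAt hp)]

/-- A property of families indexed by the number of available derivatives passes to spatial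
derivatives. -/
theorem spatialD_induction {P : ℕ → (ι → Spacetime → ℝ) → Prop}
    (hP : ∀ m f (j : Fin 3), P (m + 1) f → P m (fun S => pd j.succ (f S)))
    (α : Fin 3 → ℕ) {m : ℕ} {f : ι → Spacetime → ℝ} (hf : P (m + ∑ i, α i) f) :
    P m (fun S => spatialD α (f S)) := by
  have key : ∀ (j : Fin 3) (n m : ℕ) (f : ι → Spacetime → ℝ), P (m + n) f →
      P m (fun S => (pd j.succ)^[n] (f S)) := by
    intro j n
    induction n with
    | zero => exact fun m f hf => hf
    | succ n ih => exact fun m f hf => ih m _ (hP _ _ j hf)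
  rw [Fin.sum_univ_three, ← add_assoc, ← add_assoc] at hf
  exact key 0 _ _ _ (key 1 _ _ _ (key 2 _ _ _ hf))

theorem JetBound.spatialD (α : Fin 3 → ℕ) (hf : JetBound D Fin.succ ρ m f) (hα : ∑ i, α i ≤ m) :
    Dominated D ρ (fun S => spatialD α (f S)) :=
  spatialD_induction (P := fun m f => JetBound D Fin.succ ρ m f) (m := 0) (fun _ _ j h => h.pd j) α
    (hf.mono (by simpa using hα))

theorem JetBound.of_spatialD (hf : ∀ S, ContDiff ℝ (⊤ : ℕ∞) (f S))
    (h : ∀ α : Fin 3 → ℕ, ∑ i, α i ≤ m →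
      ∃ C : ℝ, ∀ S, ∀ p ∈ D.carrier S, |RelEuler.spatialD α (f S) p| ≤ C * ρ S p) :
    JetBound D Fin.succ ρ m f := by
  have key : Dominated D ρ f :=
    ⟨fun S p _ => (hf S).contDiffAt, by simpa [spatialD_zero] using h 0 (by simp)⟩
  induction m generalizing f with
  | zero => exact key
  | succ m ih =>
    refine ⟨key, fun j => ?_⟩
    have h' : ∀ α : Fin 3 → ℕ, ∑ i, α i ≤ m → ∃ C : ℝ, ∀ S, ∀ p ∈ D.carrier S,
        |RelEuler.spatialD α (RelEuler.pd j.succ (f S)) p| ≤ C * ρ S p := by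
      intro α hα
      simp only [spatialD_pd (hf _)]
      apply h
      simp [Finset.sum_add_distrib]
      omega
    exact ih (fun S => contDiff_pd (hf S) _) h' ⟨fun S p _ => (contDiff_pd (hf S) _).contDiffAt,
      by simpa [spatialD_zero] using h' 0 (by simp)⟩

variable (D) in
/-- The spacetime derivatives of order at most `m` of a globally smooth family are uniformly bounded
on the domains. -/
def BddDeriv (m : ℕ) (f : ι → Spacetime → ℝ) : Prop :=
  (∀ S, ContDiff ℝ (⊤ : ℕ∞) (f S)) ∧ ∀ a : Fin 4 → ℕ, ∑ μ, a μ ≤ m →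
    ∃ C : ℝ, ∀ S, ∀ p ∈ D.carrier S, |multiD a (f S) p| ≤ C

theorem BddDeriv.pd (hf : BddDeriv D (m + 1) f) (μ : Fin 4) :
    BddDeriv D m (fun S => pd μ (f S)) := by
  refine ⟨fun S => contDiff_pd (hf.1 S) μ, fun a ha => ?_⟩
  simp only [multiD_pd (hf.1 _)]
  apply hf.2
  simp [Finset.sum_add_distrib]
  omega

theorem BddDeriv.bddJet (hf : BddDeriv D m f) : BddJet D id m f := by
  have key : Dominated D (fun _ _ => 1) f :=
    ⟨fun S p _ => (hf.1 S).contDiffAt, by simpa [multiD_zero] using hf.2 0 (by simp)⟩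
  induction m generalizing f with
  | zero => exact key
  | succ m ih =>
    refine ⟨key, fun μ => ih (hf.pd μ) ⟨fun S p _ => (contDiff_pd (hf.1 S) μ).contDiffAt, ?_⟩⟩
    simpa [multiD_zero] using (hf.pd μ).2 0 (by simp)

end JetBound

open MeasureTheory Set Filter Topology

/-! ### The divergence theorem on slabs of spacetime -/

/-- Spacetime in the coordinates `(x⁰, x¹, x², x³)`. -/
noncomputable def ofCoord : (Fin 4 → ℝ) →L[ℝ] Spacetime :=
  (ContinuousLinearMap.proj 0).prod
    (((EuclideanSpace.equiv (Fin 3) ℝ).symm : (Fin 3 → ℝ) →L[ℝ] Space).comp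
      (ContinuousLinearMap.pi fun i : Fin 3 => ContinuousLinearMap.proj i.succ))

@[simp] theorem ofCoord_fst (y : Fin 4 → ℝ) : (ofCoord y).1 = y 0 := rfl

@[simp] theorem ofCoord_snd_apply (y : Fin 4 → ℝ) (i : Fin 3) : (ofCoord y).2 i = y i.succ := rfl

theorem ofCoord_insertNth_zero (t : ℝ) (x : Fin 3 → ℝ) :
    ofCoord ((0 : Fin 4).insertNth t x) = (t, WithLp.toLp 2 x) := by
  refine Prod.ext rfl ?_
  ext i
  simp

theorem ofCoord_single (μ : Fin 4) : ofCoord (Pi.single μ 1) = basisVec μ := by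
  refine Fin.cases ?_ (fun j => ?_) μ
  · refine Prod.ext (by simp [basisVec]) ?_
    ext i
    simp [basisVec]
  · refine Prod.ext (by simp [basisVec]) ?_
    ext i
    simp [basisVec, Pi.single_apply]

theorem measurePreserving_ofCoord : MeasurePreserving ofCoord volume volume :=
  ((MeasurePreserving.id (volume : Measure ℝ)).prod (PiLp.volume_preserving_toLp (Fin 3))).comp
    (volume_preserving_piFinSuccAbove (fun _ : Fin 4 => ℝ) 0)

theorem measurableEmbedding_ofCoord : MeasurableEmbedding ofCoord :=
  ((MeasurableEquiv.refl ℝ).prodCongr (MeasurableEquiv.toLp 2 (Fin 3 → ℝ))).measurableEmbedding.comp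
    (MeasurableEquiv.piFinSuccAbove (fun _ : Fin 4 => ℝ) 0).measurableEmbedding

/-- The slab `[0, t] × [-R, R]³` in coordinates. -/
def coordSlab (t R : ℝ) : Set (Fin 4 → ℝ) :=
  Icc ((0 : Fin 4).insertNth 0 fun _ => -R) ((0 : Fin 4).insertNth t fun _ => R)

theorem mem_coordSlab {t R : ℝ} {y : Fin 4 → ℝ} (hy : y ∈ coordSlab t R) :
    ofCoord y ∈ Icc 0 t ×ˢ (univ : Set Space) :=
  ⟨⟨by simpa using hy.1 0, by simpa using hy.2 0⟩, mem_univ _⟩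

/-- The divergence theorem for a field that vanishes near the lateral boundary of a slab. -/
theorem integral_divergence_slab {t R : ℝ} (ht : 0 ≤ t) (hR : 0 ≤ R)
    {F : Fin 4 → Spacetime → ℝ} {F' : Fin 4 → Spacetime → Spacetime →L[ℝ] ℝ}
    (hc : ∀ μ, ContinuousOn (F μ) (Icc 0 t ×ˢ univ))
    (hd : ∀ μ p, p.1 ∈ Ioo 0 t → HasFDerivAt (F μ) (F' μ p) p)
    (hi : ContinuousOn (fun p => ∑ μ, F' μ p (basisVec μ)) (Icc 0 t ×ˢ univ))
    (hs : ∀ μ p, 0 ≤ p.1 → (∃ i, R ≤ |p.2 i|) → F μ p = 0) :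
    ∫ y in coordSlab t R, ∑ μ, F' μ (ofCoord y) (basisVec μ)
      = (∫ x in Icc (fun _ : Fin 3 => -R) fun _ => R, F 0 (t, WithLp.toLp 2 x))
        - ∫ x in Icc (fun _ : Fin 3 => -R) fun _ => R, F 0 (0, WithLp.toLp 2 x) := by
  have hmaps : MapsTo ofCoord (coordSlab t R) (Icc 0 t ×ˢ univ) := fun y hy => mem_coordSlab hy
  simp only [← ofCoord_single] at hi ⊢
  have hle : ((0 : Fin 4).insertNth 0 fun _ => -R : Fin 4 → ℝ)
      ≤ (0 : Fin 4).insertNth t fun _ => R := by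
    intro μ
    refine Fin.cases ?_ (fun i => ?_) μ
    · simpa using ht
    · simp; linarith
  have key := integral_divergence_of_hasFDerivAt_off_countable' _ _ hle
    (fun μ y => F μ (ofCoord y)) (fun μ y => (F' μ (ofCoord y)).comp ofCoord) ∅ countable_empty
    (fun μ => (hc μ).comp ofCoord.continuous.continuousOn hmaps)
    (fun y hy μ => by
      have h0 := (hy.1 0 (mem_univ _))
      have := hd μ (ofCoord y) (by simpa using h0)
      exact this.comp y ofCoord.hasFDerivAt)
    ((hi.comp ofCoord.continuous.continuousOn hmaps).integrableOn_compact isCompact_Icc)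
  refine key.trans ?_
  rw [Fin.sum_univ_succ, Finset.sum_eq_zero, add_zero]
  · simp only [ofCoord_insertNth_zero, Fin.insertNth_apply_same]
    congr 2
  · intro i _
    have hz : ∀ c : ℝ, |c| = R → ∫ x in Icc (((0 : Fin 4).insertNth 0 fun _ => -R : Fin 4 → ℝ)
        ∘ i.succ.succAbove) (((0 : Fin 4).insertNth t fun _ => R : Fin 4 → ℝ) ∘ i.succ.succAbove),
        F i.succ (ofCoord (i.succ.insertNth c x)) = 0 := by
      intro c hcR
      refine setIntegral_eq_zero_of_forall_eq_zero fun x hx => hs _ _ ?_ ⟨i, by simp [hcR]⟩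
      have h0 := hx.1 0
      have e : (i.succ.succAbove 0 : Fin 4) = 0 := Fin.succAbove_ne_zero_zero (Fin.succ_ne_zero i)
      have e' : (i.succ.insertNth c x : Fin 4 → ℝ) 0 = x 0 := by
        rw [← e, Fin.insertNth_apply_succAbove]
      simp only [Function.comp_apply, e, Fin.insertNth_apply_same] at h0
      simpa [e'] using h0
    simp only [Fin.insertNth_zero', Fin.cons_succ] at hz ⊢
    rw [hz _ (abs_of_nonneg hR), hz (-R) (by simp [abs_of_nonneg hR]), sub_zero]

theorem ofReal_integral_le {X : Type*} [MeasurableSpace X] {μ : Measure X} {f : X → ℝ}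
    (hf : Integrable f μ) : ENNReal.ofReal (∫ x, f x ∂μ) ≤ ∫⁻ x, ENNReal.ofReal (f x) ∂μ := by
  rw [integral_eq_lintegral_pos_part_sub_lintegral_neg_part hf]
  exact (ENNReal.ofReal_le_ofReal (sub_le_self _ ENNReal.toReal_nonneg)).trans
    ENNReal.ofReal_toReal_le

theorem lintegral_slice_eq {R : ℝ} {F : Spacetime → ℝ} {t : ℝ} (ht : 0 ≤ t)
    (hs : ∀ p : Spacetime, 0 ≤ p.1 → (∃ i, R ≤ |p.2 i|) → F p = 0) :
    ∫⁻ x in Icc (fun _ : Fin 3 => -R) fun _ => R, ENNReal.ofReal (F (t, WithLp.toLp 2 x))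
      = ∫⁻ x, ENNReal.ofReal (F (t, x)) := by
  rw [← (PiLp.volume_preserving_toLp (Fin 3)).lintegral_comp_emb
    (MeasurableEquiv.toLp 2 (Fin 3 → ℝ)).measurableEmbedding,
    ← lintegral_indicator measurableSet_Icc]
  congr 1
  ext x
  by_cases hx : x ∈ Icc (fun _ : Fin 3 => -R) fun _ => R
  · rw [indicator_of_mem hx]
  · rw [indicator_of_notMem hx, hs _ ht, ENNReal.ofReal_zero]
    by_contra! h
    exact hx ⟨fun i => (abs_lt.1 (h i)).1.le, fun i => (abs_lt.1 (h i)).2.le⟩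

theorem lintegral_flux_le {t R : ℝ} (ht : 0 ≤ t) (hR : 0 ≤ R)
    {F : Fin 4 → Spacetime → ℝ} {F' : Fin 4 → Spacetime → Spacetime →L[ℝ] ℝ} {G : Spacetime → ℝ}
    (hc : ∀ μ, ContinuousOn (F μ) (Icc 0 t ×ˢ univ))
    (hd : ∀ μ p, p.1 ∈ Ioo 0 t → HasFDerivAt (F μ) (F' μ p) p)
    (hi : ContinuousOn (fun p => ∑ μ, F' μ p (basisVec μ)) (Icc 0 t ×ˢ univ))
    (hs : ∀ μ p, 0 ≤ p.1 → (∃ i, R ≤ |p.2 i|) → F μ p = 0)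
    (h0 : ∀ p ∈ Icc 0 t ×ˢ (univ : Set Space), 0 ≤ F 0 p)
    (hG : ∀ p ∈ Icc 0 t ×ˢ (univ : Set Space), ∑ μ, F' μ p (basisVec μ) ≤ max 0 (G p))
    (hGm : ContinuousOn G (Icc 0 t ×ˢ univ)) :
    ∫⁻ x, ENNReal.ofReal (F 0 (t, x)) ≤ (∫⁻ x, ENNReal.ofReal (F 0 (0, x)))
      + ∫⁻ τ in Icc 0 t, ∫⁻ x, ENNReal.ofReal (G (τ, x)) := by
  have hslice : ∀ τ ∈ Icc 0 t, ∫⁻ x, ENNReal.ofReal (F 0 (τ, x))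
      = ENNReal.ofReal (∫ x in Icc (fun _ : Fin 3 => -R) fun _ => R,
          F 0 (τ, WithLp.toLp 2 x)) := by
    intro τ hτ
    have hcont : Continuous fun x : Fin 3 → ℝ => F 0 (τ, WithLp.toLp 2 x) :=
      (hc 0).comp_continuous (by fun_prop) fun x => ⟨hτ, mem_univ _⟩
    rw [ofReal_integral_eq_lintegral_ofReal (hcont.continuousOn.integrableOn_compact isCompact_Icc)
      (Eventually.of_forall fun x => h0 _ ⟨hτ, mem_univ _⟩), lintegral_slice_eq hτ.1 (hs 0)]
  have hdiv := integral_divergence_slab ht hR hc hd hi hs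
  have hmaps : MapsTo ofCoord (coordSlab t R) (Icc 0 t ×ˢ univ) := fun y hy => mem_coordSlab hy
  have hint : IntegrableOn (fun y => ∑ μ, F' μ (ofCoord y) (basisVec μ)) (coordSlab t R) :=
    (hi.comp ofCoord.continuous.continuousOn hmaps).integrableOn_compact isCompact_Icc
  have hsrc : ENNReal.ofReal (∫ y in coordSlab t R, ∑ μ, F' μ (ofCoord y) (basisVec μ))
      ≤ ∫⁻ τ in Icc 0 t, ∫⁻ x, ENNReal.ofReal (G (τ, x)) := by
    calc ENNReal.ofReal (∫ y in coordSlab t R, ∑ μ, F' μ (ofCoord y) (basisVec μ))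
        ≤ ∫⁻ y in coordSlab t R, ENNReal.ofReal (∑ μ, F' μ (ofCoord y) (basisVec μ)) :=
          ofReal_integral_le hint
      _ ≤ ∫⁻ y in coordSlab t R, ENNReal.ofReal (G (ofCoord y)) := by
          refine setLIntegral_mono' measurableSet_Icc fun y hy => ?_
          refine (ENNReal.ofReal_le_ofReal (hG _ (hmaps hy))).trans ?_
          rcases le_total 0 (G (ofCoord y)) with h | h <;> simp [h]
      _ ≤ ∫⁻ y in ofCoord ⁻¹' (Icc 0 t ×ˢ univ), ENNReal.ofReal (G (ofCoord y)) :=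
          lintegral_mono_set hmaps
      _ = ∫⁻ p in Icc 0 t ×ˢ univ, ENNReal.ofReal (G p) :=
          measurePreserving_ofCoord.setLIntegral_comp_preimage_emb measurableEmbedding_ofCoord
            (fun p => ENNReal.ofReal (G p)) _
      _ = ∫⁻ τ in Icc 0 t, ∫⁻ x, ENNReal.ofReal (G (τ, x)) := by
          have hm : AEMeasurable (fun p => ENNReal.ofReal (G p))
              ((volume : Measure Spacetime).restrict (Icc 0 t ×ˢ univ)) :=
            (hGm.aemeasurable (measurableSet_Icc.prod MeasurableSet.univ)).ennreal_ofReal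
          rw [Measure.volume_eq_prod, ← Measure.prod_restrict] at hm ⊢
          rw [lintegral_prod _ hm, Measure.restrict_univ]
  rw [hslice t ⟨ht, le_rfl⟩, hslice 0 ⟨le_rfl, ht⟩]
  have : (∫ x in Icc (fun _ : Fin 3 => -R) fun _ => R, F 0 (t, WithLp.toLp 2 x))
      = (∫ x in Icc (fun _ : Fin 3 => -R) fun _ => R, F 0 (0, WithLp.toLp 2 x))
        + ∫ y in coordSlab t R, ∑ μ, F' μ (ofCoord y) (basisVec μ) := by
    rw [hdiv]; ring
  rw [this]
  exact ENNReal.ofReal_add_le.trans (by gcongr)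

/-! ### A cutoff adapted to timelike fields -/

theorem hasDerivAt_max_sq (z : ℝ) : HasDerivAt (fun z : ℝ => max 0 z ^ 2) (2 * max 0 z) z := by
  rcases lt_trichotomy z 0 with h | rfl | h
  · have : (fun z : ℝ => max 0 z ^ 2) =ᶠ[𝓝 z] fun _ => 0 := by
      filter_upwards [Iio_mem_nhds h] with y hy
      simp [max_eq_left (mem_Iio.1 hy).le]
    rw [max_eq_left h.le, mul_zero]
    exact (hasDerivAt_const z (0 : ℝ)).congr_of_eventuallyEq this
  · rw [max_self, mul_zero, hasDerivAt_iff_isLittleO]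
    have h1 : (fun y : ℝ => y ^ 2) =o[𝓝 0] fun y => y := by
      simpa using Asymptotics.isLittleO_pow_pow (𝕜 := ℝ) (m := 1) (n := 2) (by norm_num)
    refine (Asymptotics.IsBigO.trans_isLittleO
      (.of_bound 1 (Eventually.of_forall fun y => ?_)) h1).congr_right fun y => by simp
    rcases le_total 0 y with h | h <;> simp [h, sq_nonneg]
  · have : (fun z : ℝ => max 0 z ^ 2) =ᶠ[𝓝 z] fun y => y ^ 2 := by
      filter_upwards [Ioi_mem_nhds h] with y hy
      simp [max_eq_right (mem_Ioi.1 hy).le]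
    rw [max_eq_right h.le]
    simpa using (hasDerivAt_pow 2 z).congr_of_eventuallyEq this

/-- The defining function of the cutoff: it decreases along every future-directed causal field. -/
noncomputable def coneFun (R : ℝ) (p : Spacetime) : ℝ := 1 - Real.exp p.1 * (1 + ‖p.2‖ ^ 2) / R

/-- A cutoff in space whose support shrinks at least as fast as a backward light cone. -/
noncomputable def coneCutoff (R : ℝ) (p : Spacetime) : ℝ := max 0 (coneFun R p) ^ 2

theorem contDiff_coneFun (R : ℝ) : ContDiff ℝ (⊤ : ℕ∞) (coneFun R) := by
  unfold coneFun
  exact contDiff_const.sub (((Real.contDiff_exp.comp contDiff_fst).mul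
    (contDiff_const.add (contDiff_snd.norm_sq ℝ))).div_const R)

theorem hasFDerivAt_coneCutoff (R : ℝ) (p : Spacetime) :
    HasFDerivAt (coneCutoff R) ((2 * max 0 (coneFun R p)) • fderiv ℝ (coneFun R) p) p :=
  (hasDerivAt_max_sq _).comp_hasFDerivAt p
    ((contDiff_coneFun R).contDiffAt.differentiableAt (by simp)).hasFDerivAt

theorem continuous_coneCutoff (R : ℝ) : Continuous (coneCutoff R) :=
  continuous_iff_continuousAt.2 fun p => (hasFDerivAt_coneCutoff R p).continuousAt

theorem fderiv_coneFun (R : ℝ) (p v : Spacetime) :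
    fderiv ℝ (coneFun R) p v
      = - (Real.exp p.1 / R * (v.1 * (1 + ‖p.2‖ ^ 2) + 2 * inner ℝ p.2 v.2)) := by
  have h1 : HasFDerivAt (fun q : Spacetime => Real.exp q.1)
      (Real.exp p.1 • ContinuousLinearMap.fst ℝ ℝ Space) p :=
    (hasFDerivAt_fst (p := p)).exp
  have h2 := (hasFDerivAt_snd (𝕜 := ℝ) (p := p)).norm_sq
  have h3 := (((h1.mul (h2.const_add 1)).mul_const R⁻¹).const_sub 1).fderiv
  change fderiv ℝ (fun q : Spacetime => 1 - Real.exp q.1 * (1 + ‖q.2‖ ^ 2) * R⁻¹) p v = _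
  refine (congrArg (fun L => L v) h3).trans ?_
  simp [div_eq_mul_inv]
  ring

theorem coneCutoff_nonneg (R : ℝ) (p : Spacetime) : 0 ≤ coneCutoff R p := sq_nonneg _

theorem coneCutoff_le_one {R : ℝ} (hR : 0 < R) (p : Spacetime) : coneCutoff R p ≤ 1 := by
  have h1 : coneFun R p ≤ 1 := by
    unfold coneFun
    have : 0 ≤ Real.exp p.1 * (1 + ‖p.2‖ ^ 2) / R := by positivity
    linarith
  unfold coneCutoff
  exact pow_le_one₀ (le_max_left _ _) (max_le zero_le_one h1)

theorem coneCutoff_eq_zero {R : ℝ} (hR : 1 ≤ R) {p : Spacetime} (hp : 0 ≤ p.1)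
    (h : ∃ i, R ≤ |p.2 i|) : coneCutoff R p = 0 := by
  obtain ⟨i, hi⟩ := h
  have h1 : |p.2 i| ≤ ‖p.2‖ := by simpa using PiLp.norm_apply_le p.2 i
  have h2 : R ≤ Real.exp p.1 * (1 + ‖p.2‖ ^ 2) := by
    have h3 : 1 ≤ Real.exp p.1 := Real.one_le_exp hp
    nlinarith [norm_nonneg p.2]
  have h3 : coneFun R p ≤ 0 := by
    unfold coneFun
    rw [sub_nonpos, le_div_iff₀ (by linarith)]
    linarith
  simp [coneCutoff, max_eq_left h3]

theorem tendsto_coneCutoff (p : Spacetime) :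
    Tendsto (fun n : ℕ => coneCutoff ((n : ℝ) + 1) p) atTop (𝓝 1) := by
  have h1 : Tendsto (fun n : ℕ => coneFun ((n : ℝ) + 1) p) atTop (𝓝 (1 - 0)) :=
    tendsto_const_nhds.sub (tendsto_const_nhds.div_atTop
      (tendsto_atTop_add_const_right _ _ tendsto_natCast_atTop_atTop))
  have h2 := ((tendsto_const_nhds (x := (0 : ℝ))).max h1).pow 2
  simpa [coneCutoff] using h2

/-- The cutoff is nonincreasing along a future-directed causal vector. -/
theorem along_coneFun_nonpos {R : ℝ} (hR : 0 < R) {v : Fin 4 → ℝ} (h0 : 0 ≤ v 0)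
    (hv : ∑ i : Fin 3, v i.succ ^ 2 ≤ v 0 ^ 2) (p : Spacetime) :
    ∑ μ, v μ * fderiv ℝ (coneFun R) p (basisVec μ) ≤ 0 := by
  have hn : ‖p.2‖ ^ 2 = p.2 0 ^ 2 + p.2 1 ^ 2 + p.2 2 ^ 2 := by
    simp [EuclideanSpace.norm_sq_eq, Fin.sum_univ_three]
  have hsum : ∑ μ, v μ * fderiv ℝ (coneFun R) p (basisVec μ)
      = - (Real.exp p.1 / R * (v 0 * (1 + ‖p.2‖ ^ 2)
          + 2 * (v 1 * p.2 0 + v 2 * p.2 1 + v 3 * p.2 2))) := by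
    have e0 : basisVec 0 = (1, 0) := rfl
    have e (i : Fin 3) : basisVec i.succ = (0, EuclideanSpace.single i 1) := rfl
    rw [Fin.sum_univ_succ, Fin.sum_univ_three, e, e, e, e0]
    simp only [fderiv_coneFun, EuclideanSpace.inner_single_right, inner_zero_right]
    simp
    ring
  rw [hsum, neg_nonpos]
  refine mul_nonneg (by positivity) ?_
  rw [hn]
  rw [Fin.sum_univ_three] at hv
  have hv' : v 1 ^ 2 + v 2 ^ 2 + v 3 ^ 2 ≤ v 0 ^ 2 := hv
  rcases h0.eq_or_lt with h | h
  · have h1 : v 1 = 0 := by nlinarith [sq_nonneg (v 1), sq_nonneg (v 2), sq_nonneg (v 3)]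
    have h2 : v 2 = 0 := by nlinarith [sq_nonneg (v 1), sq_nonneg (v 2), sq_nonneg (v 3)]
    have h3 : v 3 = 0 := by nlinarith [sq_nonneg (v 1), sq_nonneg (v 2), sq_nonneg (v 3)]
    simp [← h, h1, h2, h3]
  · have : 0 ≤ v 0 * (v 0 * (1 + (p.2 0 ^ 2 + p.2 1 ^ 2 + p.2 2 ^ 2))
        + 2 * (v 1 * p.2 0 + v 2 * p.2 1 + v 3 * p.2 2)) := by
      nlinarith [sq_nonneg (v 0 * p.2 0 + v 1), sq_nonneg (v 0 * p.2 1 + v 2),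
        sq_nonneg (v 0 * p.2 2 + v 3)]
    exact nonneg_of_mul_nonneg_right this h

/-! ### The energy inequality with finite speed of propagation -/

/-- If the current `P u^μ` has divergence `B` and `u` is causal on the support of the density `P`,
then the energy at time `t` is bounded by the initial energy and the spacetime integral of the
positive part of `B`. No decay at spatial infinity is assumed: the cutoffs `coneCutoff R` decrease
along `u`. -/
theorem lintegral_energy_le {T t : ℝ} {P B : Spacetime → ℝ} {P' : Spacetime → Spacetime →L[ℝ] ℝ}
    {u : Fin 4 → Spacetime → ℝ} (hu : ∀ μ, ContDiff ℝ (⊤ : ℕ∞) (u μ)) (hP : ∀ p, 0 ≤ P p)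
    (hPc : ContinuousOn P (Icc 0 T ×ˢ univ)) (hBc : ContinuousOn B (Icc 0 T ×ˢ univ))
    (hPd : ∀ p : Spacetime, p.1 ∈ Ioo 0 T → HasFDerivAt P (P' p) p)
    (hB : ∀ p : Spacetime, p.1 ∈ Icc 0 T →
      ∑ μ, u μ p * P' p (basisVec μ) + P p * divg u p = B p)
    (hcone : ∀ p : Spacetime, p.1 ∈ Icc 0 T → P p ≠ 0 →
      0 ≤ u 0 p ∧ ∑ i : Fin 3, u i.succ p ^ 2 ≤ u 0 p ^ 2)
    (ht : t ∈ Icc 0 T) :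
    ∫⁻ x, ENNReal.ofReal (P (t, x) * u 0 (t, x)) ≤
      (∫⁻ x, ENNReal.ofReal (P (0, x) * u 0 (0, x)))
        + ∫⁻ τ in Icc 0 t, ∫⁻ x, ENNReal.ofReal (B (τ, x)) := by
  have hsub : Icc 0 t ×ˢ (univ : Set Space) ⊆ Icc 0 T ×ˢ univ :=
    prod_mono (Icc_subset_Icc_right ht.2) le_rfl
  have hPu : ∀ p : Spacetime, p.1 ∈ Icc 0 T → 0 ≤ P p * u 0 p := fun p hp => by
    by_cases h : P p = 0
    · simp [h]
    · exact mul_nonneg (hP p) (hcone p hp h).1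
  have hcut : ∀ R : ℝ, 1 ≤ R → ∫⁻ x, ENNReal.ofReal (coneCutoff R (t, x) * P (t, x) * u 0 (t, x)) ≤
      (∫⁻ x, ENNReal.ofReal (P (0, x) * u 0 (0, x)))
        + ∫⁻ τ in Icc 0 t, ∫⁻ x, ENNReal.ofReal (B (τ, x)) := by
    intro R hR
    have hR0 : 0 < R := by linarith
    set φ : Spacetime → ℝ := fun p => coneCutoff R p with hφ
    have hdiv : ∀ p : Spacetime, p.1 ∈ Icc 0 T →
        ∑ μ, ((φ p * P p) • fderiv ℝ (u μ) p + u μ p • (φ p • P' p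
          + P p • ((2 * max 0 (coneFun R p)) • fderiv ℝ (coneFun R) p))) (basisVec μ)
        = φ p * B p + P p * (2 * max 0 (coneFun R p))
          * ∑ μ, u μ p * fderiv ℝ (coneFun R) p (basisVec μ) := by
      intro p hp
      rw [← hB p hp]
      simp only [divg, pd, Fin.sum_univ_four, add_apply,
        smul_apply, smul_eq_mul]
      ring
    have hzero : ∀ p : Spacetime, 0 ≤ p.1 → (∃ i, R ≤ |p.2 i|) → φ p = 0 :=
      fun p hp h => coneCutoff_eq_zero hR hp h
    have main := lintegral_flux_le (t := t) (R := R) (G := fun p => B p) ht.1 hR0.le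
      (F := fun μ p => φ p * P p * u μ p)
      (F' := fun μ p => (φ p * P p) • fderiv ℝ (u μ) p + u μ p • (φ p • P' p
          + P p • ((2 * max 0 (coneFun R p)) • fderiv ℝ (coneFun R) p)))
      (fun μ => (((continuous_coneCutoff R).continuousOn.mul (hPc.mono hsub)).mul
        (hu μ).continuous.continuousOn))
      (fun μ p hp => ((hasFDerivAt_coneCutoff R p).mul
        (hPd p ⟨hp.1, hp.2.trans_le ht.2⟩)).mul
          ((hu μ).contDiffAt.differentiableAt (by simp)).hasFDerivAt)
      (by
        refine ContinuousOn.congr (f := fun p => φ p * B p + P p * (2 * max 0 (coneFun R p))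
          * ∑ μ, u μ p * fderiv ℝ (coneFun R) p (basisVec μ)) ?_
          fun p hp => hdiv p (hsub hp).1
        have c1 := (contDiff_coneFun R).continuous
        have c2 := (contDiff_coneFun R).continuous_fderiv (by simp)
        have c3 := fun μ => (hu μ).continuous
        refine ((continuous_coneCutoff R).continuousOn.mul (hBc.mono hsub)).add
          (((hPc.mono hsub).mul ?_).mul ?_)
        · exact (continuous_const.mul (continuous_const.max c1)).continuousOn
        · exact (continuous_finsetSum _ fun μ _ =>
            (c3 μ).mul (c2.clm_apply continuous_const)).continuousOn)
      (fun μ p hp h => by simp [hzero p hp h])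
      (fun p hp => by
        have := mul_nonneg (coneCutoff_nonneg R p) (hPu p (hsub hp).1)
        simpa [hφ, mul_assoc] using this)
      (fun p hp => by
        rw [hdiv p (hsub hp).1]
        have h1 : P p * (2 * max 0 (coneFun R p))
            * ∑ μ, u μ p * fderiv ℝ (coneFun R) p (basisVec μ) ≤ 0 := by
          by_cases h : P p = 0
          · simp [h]
          · obtain ⟨h2, h3⟩ := hcone p (hsub hp).1 h
            have := along_coneFun_nonpos hR0 (v := fun μ => u μ p) h2 h3 p
            exact mul_nonpos_of_nonneg_of_nonpos (mul_nonneg (hP p) (by positivity)) this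
        have h2 : φ p * B p ≤ max 0 (B p) := by
          have h3 := coneCutoff_nonneg R p
          have h4 := coneCutoff_le_one hR0 p
          rcases le_total 0 (B p) with h | h
          · rw [max_eq_right h]; exact mul_le_of_le_one_left h h4
          · rw [max_eq_left h]; exact mul_nonpos_of_nonneg_of_nonpos h3 h
        linarith)
      (hBc.mono hsub)
    refine main.trans (add_le_add ?_ le_rfl)
    refine lintegral_mono fun x => ENNReal.ofReal_le_ofReal ?_
    have h0 := hPu (0, x) ⟨le_rfl, ht.1.trans ht.2⟩
    have h4 := coneCutoff_le_one hR0 (0, x)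
    simp only [hφ]
    rw [mul_assoc]
    exact mul_le_of_le_one_left h0 h4
  have hslice : Continuous fun x : Space => P (t, x) :=
    hPc.comp_continuous (by fun_prop) fun x => ⟨ht, mem_univ _⟩
  have hlim : ∀ x, Tendsto (fun n : ℕ => ENNReal.ofReal
      (coneCutoff ((n : ℝ) + 1) (t, x) * P (t, x) * u 0 (t, x))) atTop
      (𝓝 (ENNReal.ofReal (P (t, x) * u 0 (t, x)))) := by
    intro x
    have := ((tendsto_coneCutoff (t, x)).mul_const (P (t, x))).mul_const (u 0 (t, x))
    rw [one_mul] at this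
    exact ENNReal.tendsto_ofReal this
  calc ∫⁻ x, ENNReal.ofReal (P (t, x) * u 0 (t, x))
      = ∫⁻ x, liminf (fun n : ℕ => ENNReal.ofReal
          (coneCutoff ((n : ℝ) + 1) (t, x) * P (t, x) * u 0 (t, x))) atTop :=
        lintegral_congr fun x => (hlim x).liminf_eq.symm
    _ ≤ liminf (fun n : ℕ => ∫⁻ x, ENNReal.ofReal
          (coneCutoff ((n : ℝ) + 1) (t, x) * P (t, x) * u 0 (t, x))) atTop := by
        refine lintegral_liminf_le' fun n => ?_
        have c1 := continuous_coneCutoff ((n : ℝ) + 1)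
        have c2 := (hu 0).continuous
        have c3 : Continuous fun x : Space =>
            coneCutoff ((n : ℝ) + 1) (t, x) * P (t, x) * u 0 (t, x) :=
          ((c1.comp (by fun_prop)).mul hslice).mul (c2.comp (by fun_prop))
        exact c3.measurable.ennreal_ofReal.aemeasurable
    _ ≤ _ := by
        refine (liminf_le_liminf (Eventually.of_forall fun n : ℕ =>
          hcut ((n : ℝ) + 1) (by simp))).trans ?_
        simp

/-! ### Powers of the density as weights on the moving domain -/

section Weight

variable {γ T : ℝ} {Ω : ℝ → Set Space} {s r : Spacetime → ℝ} {u : Fin 4 → Spacetime → ℝ}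

theorem IsPhysicalVacuum.mem_nhdsWithin (hv : IsPhysicalVacuum T Ω r) {p : Spacetime}
    (hp : p ∈ movingDomain T Ω) : movingDomain T Ω ∈ 𝓝[Icc 0 T ×ˢ univ] p := by
  obtain ⟨U, hU, h⟩ := hv.relOpen
  have hp' := hp
  rw [h] at hp'
  rw [h, inter_comm]
  exact inter_mem self_mem_nhdsWithin (mem_nhdsWithin_of_mem_nhds (hU.mem_nhds hp'.1))

theorem IsPhysicalVacuum.isOpen_slice (hv : IsPhysicalVacuum T Ω r) {t : ℝ} (ht : t ∈ Icc 0 T) :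
    IsOpen (Ω t) := by
  obtain ⟨U, hU, h⟩ := hv.relOpen
  have : Ω t = (fun x => (t, x)) ⁻¹' U := by
    ext x
    have := Set.ext_iff.1 h (t, x)
    simpa [movingDomain, ht.1, ht.2] using this
  rw [this]
  exact hU.preimage (by fun_prop)

theorem IsPhysicalVacuum.uniqueDiffOn (hv : IsPhysicalVacuum T Ω r) (hT : 0 < T) :
    UniqueDiffOn ℝ (movingDomain T Ω) := by
  obtain ⟨U, hU, h⟩ := hv.relOpen
  rw [h, inter_comm]
  exact ((uniqueDiffOn_Icc hT).prod uniqueDiffOn_univ).inter hU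

variable (T Ω r) in
/-- The weight `r ^ e`, extended by zero outside the moving domain. -/
noncomputable def vacuumWeight (e : ℝ) : Spacetime → ℝ :=
  (movingDomain T Ω).indicator fun p => r p ^ e

variable (T Ω r) in
/-- The differential of the weight `r ^ e`. -/
noncomputable def vacuumWeightDeriv (e : ℝ) : Spacetime → Spacetime →L[ℝ] ℝ :=
  (movingDomain T Ω).indicator fun p => (e * r p ^ (e - 1)) • fderiv ℝ r p

theorem vacuumWeight_of_mem {e : ℝ} {p : Spacetime} (hp : p ∈ movingDomain T Ω) :
    vacuumWeight T Ω r e p = r p ^ e := indicator_of_mem hp _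

theorem vacuumWeight_of_notMem {e : ℝ} {p : Spacetime} (hp : p ∉ movingDomain T Ω) :
    vacuumWeight T Ω r e p = 0 := indicator_of_notMem hp _

theorem vacuumWeight_nonneg (hv : IsPhysicalVacuum T Ω r) (e : ℝ) (p : Spacetime) :
    0 ≤ vacuumWeight T Ω r e p := by
  by_cases hp : p ∈ movingDomain T Ω
  · rw [vacuumWeight_of_mem hp]; exact Real.rpow_nonneg (hv.pos p hp).le _
  · rw [vacuumWeight_of_notMem hp]

theorem abs_vacuumWeight_le (hv : IsPhysicalVacuum T Ω r) (e : ℝ) (p : Spacetime) :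
    |vacuumWeight T Ω r e p| ≤ |r p| ^ e := by
  by_cases hp : p ∈ movingDomain T Ω
  · rw [vacuumWeight_of_mem hp, abs_of_pos (hv.pos p hp),
      abs_of_nonneg (Real.rpow_nonneg (hv.pos p hp).le _)]
  · rw [vacuumWeight_of_notMem hp, abs_zero]
    exact Real.rpow_nonneg (abs_nonneg _) _

theorem vacuumWeight_eventuallyEq_zero {e : ℝ} {p : Spacetime}
    (hp : p ∉ closure (movingDomain T Ω)) : vacuumWeight T Ω r e =ᶠ[𝓝 p] fun _ => 0 := by
  filter_upwards [isClosed_closure.isOpen_compl.mem_nhds hp] with q hq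
  exact vacuumWeight_of_notMem fun h => hq (subset_closure h)

theorem continuousOn_vacuumWeight (hv : IsPhysicalVacuum T Ω r) (hr : Continuous r) {e : ℝ}
    (he : 0 < e) : ContinuousOn (vacuumWeight T Ω r e) (Icc 0 T ×ˢ univ) := by
  intro p _
  by_cases h : p ∈ movingDomain T Ω
  · have h1 : ContinuousWithinAt (fun q => r q ^ e) (Icc 0 T ×ˢ univ) p :=
      (hr.continuousAt.rpow_const (Or.inr he.le)).continuousWithinAt
    refine h1.congr_of_eventuallyEq ?_ (vacuumWeight_of_mem h)
    filter_upwards [hv.mem_nhdsWithin h] with q hq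
    exact vacuumWeight_of_mem hq
  · by_cases h' : p ∈ closure (movingDomain T Ω)
    · have hr0 : r p = 0 := hv.vanish p ⟨h', h⟩
      refine ContinuousAt.continuousWithinAt ?_
      rw [ContinuousAt, vacuumWeight_of_notMem h]
      refine squeeze_zero_norm (fun q => abs_vacuumWeight_le hv e q) ?_
      have : ContinuousAt (fun q => |r q| ^ e) p :=
        hr.abs.continuousAt.rpow_const (Or.inr he.le)
      simpa [ContinuousAt, hr0, Real.zero_rpow he.ne'] using this
    · exact (continuousAt_const.congr
        (vacuumWeight_eventuallyEq_zero h').symm).continuousWithinAt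

/-- The extended weight is differentiable across the free boundary when the exponent exceeds one. -/
theorem hasFDerivAt_vacuumWeight (hv : IsPhysicalVacuum T Ω r) (hr : Differentiable ℝ r) {e : ℝ}
    (he : 1 < e) {p : Spacetime} (hp : p.1 ∈ Ioo 0 T) :
    HasFDerivAt (vacuumWeight T Ω r e) (vacuumWeightDeriv T Ω r e p) p := by
  by_cases h : p ∈ movingDomain T Ω
  · have h1 : HasFDerivAt (fun q => r q ^ e) ((e * r p ^ (e - 1)) • fderiv ℝ r p) p :=
      (hr p).hasFDerivAt.rpow_const (Or.inr he.le)
    rw [vacuumWeightDeriv, indicator_of_mem h]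
    refine h1.congr_of_eventuallyEq ?_
    have hn : (Icc 0 T ×ˢ univ : Set Spacetime) ∈ 𝓝 p :=
      prod_mem_nhds (Icc_mem_nhds hp.1 hp.2) univ_mem
    have := hv.mem_nhdsWithin h
    rw [nhdsWithin_eq_nhds.2 hn] at this
    filter_upwards [this] with q hq
    exact vacuumWeight_of_mem hq
  · rw [vacuumWeightDeriv, indicator_of_notMem h]
    by_cases h' : p ∈ closure (movingDomain T Ω)
    · have hr0 : r p = 0 := hv.vanish p ⟨h', h⟩
      rw [hasFDerivAt_iff_isLittleO, vacuumWeight_of_notMem h]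
      have h1 : (fun q => |r q| ^ (e - 1)) =o[𝓝 p] fun _ => (1 : ℝ) := by
        rw [Asymptotics.isLittleO_one_iff]
        have : ContinuousAt (fun q => |r q| ^ (e - 1)) p :=
          hr.continuous.abs.continuousAt.rpow_const (Or.inr (by linarith))
        simpa [ContinuousAt, hr0, Real.zero_rpow (by linarith : e - 1 ≠ 0)] using this
      have h2 : r =O[𝓝 p] fun q => q - p := by
        simpa [hr0] using (hr p).hasFDerivAt.isBigO_sub
      have h3 := h1.mul_isBigO h2.norm_right
      simp only [one_mul] at h3
      refine Asymptotics.IsLittleO.of_norm_right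
        (Asymptotics.IsBigO.trans_isLittleO (.of_bound 1 (Eventually.of_forall fun q => ?_)) h3)
      rw [one_mul, sub_zero, zero_apply, sub_zero, norm_mul, Real.norm_eq_abs, Real.norm_eq_abs,
        Real.norm_eq_abs, abs_of_nonneg (Real.rpow_nonneg (abs_nonneg (r q)) _)]
      refine (abs_vacuumWeight_le hv e q).trans_eq ?_
      rw [← Real.rpow_add_one' (abs_nonneg _) (by linarith), sub_add_cancel]
    · exact (hasFDerivAt_const 0 p).congr_of_eventuallyEq (vacuumWeight_eventuallyEq_zero h')

theorem wL2Sq_eq_lintegral_vacuumWeight (hv : IsPhysicalVacuum T Ω r) {t : ℝ} (ht : t ∈ Icc 0 T)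
    (σ : ℝ) (w : Spacetime → ℝ) :
    wL2Sq Ω r σ t w
      = ∫⁻ x, ENNReal.ofReal (vacuumWeight T Ω r (2 * σ) (t, x) * w (t, x) ^ 2) := by
  unfold wL2Sq
  rw [← lintegral_indicator (hv.isOpen_slice ht).measurableSet]
  congr 1
  ext x
  by_cases hx : x ∈ Ω t
  · have hp : (t, x) ∈ movingDomain T Ω := ⟨ht, hx⟩
    rw [indicator_of_mem hx, vacuumWeight_of_mem hp, ← Real.enorm_eq_ofReal (by
      exact mul_nonneg (Real.rpow_nonneg (hv.pos _ hp).le _) (sq_nonneg _)), ← enorm_pow, mul_pow,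
      ← Real.rpow_mul_natCast (hv.pos _ hp).le]
    norm_num [mul_comm]
  · rw [indicator_of_notMem hx, vacuumWeight_of_notMem fun h => hx h.2]
    simp

theorem IsEulerSolution.sq_zero (hE : IsEulerSolution γ T Ω s r u) {p : Spacetime}
    (hp : p ∈ movingDomain T Ω) : u 0 p ^ 2 = 1 + ∑ i : Fin 3, u i.succ p ^ 2 := by
  have := hE.normalized p hp
  simp only [lower, mink, Fin.sum_univ_four] at this
  rw [Fin.sum_univ_three]
  change u 0 p ^ 2 = 1 + (u 1 p ^ 2 + u 2 p ^ 2 + u 3 p ^ 2)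
  norm_num [Fin.ext_iff] at this
  linarith

theorem IsEulerSolution.one_le_zero (hE : IsEulerSolution γ T Ω s r u) {p : Spacetime}
    (hp : p ∈ movingDomain T Ω) : 1 ≤ u 0 p := by
  have h1 := hE.sq_zero hp
  have h2 := hE.forward p hp
  have h3 : 0 ≤ ∑ i : Fin 3, u i.succ p ^ 2 := Finset.sum_nonneg fun i _ => sq_nonneg _
  nlinarith

/-- The weighted energy estimate for a function transported by the flow. Because the weight is a
power of `r` and `D_t r` is proportional to `r`, the transport of the weight costs no power
of `r`. -/
theorem wL2Sq_transport_le (hE : IsEulerSolution γ T Ω s r u) (hv : IsPhysicalVacuum T Ω r)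
    {σ : ℝ} (hσ : 1 / 2 < σ) {w Q : Spacetime → ℝ} (hw : ContDiff ℝ (⊤ : ℕ∞) w) {M : ℝ≥0}
    (hM : ∀ p ∈ movingDomain T Ω, u 0 p ≤ M)
    (hQ : ∀ p ∈ movingDomain T Ω, r p ^ (2 * σ) * (w p ^ 2 * ((1 - 2 * σ * (γ - 1)) * divg u p)
      + 2 * (w p * along u w p)) ≤ Q p) {t : ℝ} (ht : t ∈ Icc 0 T) :
    wL2Sq Ω r σ t w ≤ M * wL2Sq Ω r σ 0 w
      + ∫⁻ τ in Icc 0 t, ∫⁻ x in Ω τ, ENNReal.ofReal (Q (τ, x)) := by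
  set W := vacuumWeight T Ω r (2 * σ) with hW
  set W' := vacuumWeightDeriv T Ω r (2 * σ) with hW'
  have hrs : Differentiable ℝ r := hE.smooth_r.differentiable (by simp)
  have hws : Differentiable ℝ w := hw.differentiable (by simp)
  have hWc := continuousOn_vacuumWeight hv hrs.continuous (e := 2 * σ) (by linarith)
  have hW0 := vacuumWeight_nonneg hv (2 * σ)
  set B : Spacetime → ℝ := fun p => W p * (w p ^ 2 * ((1 - 2 * σ * (γ - 1)) * divg u p)
      + 2 * (w p * along u w p)) with hBdef
  have hcu := fun μ => (hE.smooth_u μ).continuous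
  have hcd := fun μ ν => (contDiff_pd (hE.smooth_u μ) ν).continuous
  have hcw := fun ν => (contDiff_pd hw ν).continuous
  have key := lintegral_energy_le (T := T) (t := t) (P := fun p => W p * w p ^ 2) (B := B)
    (P' := fun p => w p ^ 2 • W' p + W p • ((2 * w p) • fderiv ℝ w p)) hE.smooth_u
    (fun p => mul_nonneg (hW0 p) (sq_nonneg _))
    (hWc.mul (hw.continuous.pow 2).continuousOn)
    (hWc.mul (Continuous.continuousOn (by
      have := hw.continuous
      unfold divg along
      fun_prop)))
    (fun p hp => by
      have h1 := hasFDerivAt_vacuumWeight hv hrs (e := 2 * σ) (by linarith) hp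
      have h2 := ((hws p).hasFDerivAt.pow 2)
      refine (h1.mul h2).congr_fderiv ?_
      ext v <;> simp <;> ring)
    (fun p hp => by
      by_cases hpD : p ∈ movingDomain T Ω
      · have h1 : along u r p = - ((γ - 1) * r p * divg u p) := by linarith [hE.eq_r p hpD]
        have h2 : r p ^ (2 * σ) = r p ^ (2 * σ - 1) * r p := by
          rw [← Real.rpow_add_one (hv.pos p hpD).ne', sub_add_cancel]
        have h3 : ∑ μ, u μ p * (w p ^ 2 • W' p + W p • ((2 * w p) • fderiv ℝ w p)) (basisVec μ)
            = w p ^ 2 * (2 * σ * r p ^ (2 * σ - 1)) * along u r p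
              + 2 * w p * W p * along u w p := by
          simp only [hW', vacuumWeightDeriv, indicator_of_mem hpD, along, pd, Fin.sum_univ_four,
            add_apply, smul_apply, smul_eq_mul]
          ring
        rw [h3, h1]
        simp only [hBdef, hW, vacuumWeight_of_mem hpD]
        rw [h2]
        ring
      · simp [hBdef, hW, hW', vacuumWeight_of_notMem hpD, vacuumWeightDeriv,
          indicator_of_notMem hpD])
    (fun p _ hp => by
      by_cases hpD : p ∈ movingDomain T Ω
      · refine ⟨by linarith [hE.one_le_zero hpD], ?_⟩
        rw [hE.sq_zero hpD]
        linarith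
      · exact absurd (by simp [hW, vacuumWeight_of_notMem hpD]) hp)
    ht
  have h0 : (0 : ℝ) ∈ Icc 0 T := ⟨le_rfl, ht.1.trans ht.2⟩
  rw [wL2Sq_eq_lintegral_vacuumWeight hv ht, wL2Sq_eq_lintegral_vacuumWeight hv h0]
  refine le_trans (lintegral_mono fun x => ENNReal.ofReal_le_ofReal ?_)
    (key.trans (add_le_add ?_ ?_))
  · by_cases hpD : (t, x) ∈ movingDomain T Ω
    · exact le_mul_of_one_le_right (mul_nonneg (hW0 _) (sq_nonneg _)) (hE.one_le_zero hpD)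
    · simp [hW, vacuumWeight_of_notMem hpD]
  · rw [← lintegral_const_mul' _ _ (by simp)]
    refine lintegral_mono fun x => ?_
    rw [← ENNReal.ofReal_coe_nnreal, ← ENNReal.ofReal_mul M.coe_nonneg]
    refine ENNReal.ofReal_le_ofReal ?_
    by_cases hpD : (0, x) ∈ movingDomain T Ω
    · rw [mul_comm]
      exact mul_le_mul_of_nonneg_right (hM _ hpD) (mul_nonneg (hW0 _) (sq_nonneg _))
    · simp [hW, vacuumWeight_of_notMem hpD]
  · refine setLIntegral_mono' measurableSet_Icc fun τ hτ => ?_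
    have hτ' : τ ∈ Icc 0 T := ⟨hτ.1, hτ.2.trans ht.2⟩
    rw [← lintegral_indicator (hv.isOpen_slice hτ').measurableSet]
    refine lintegral_mono fun x => ?_
    by_cases hx : x ∈ Ω τ
    · have hpD : (τ, x) ∈ movingDomain T Ω := ⟨hτ', hx⟩
      rw [indicator_of_mem hx]
      refine ENNReal.ofReal_le_ofReal ?_
      simpa [hBdef, hW, vacuumWeight_of_mem hpD] using hQ _ hpD
    · have hpD : (τ, x) ∉ movingDomain T Ω := fun h => hx h.2
      simp [hBdef, hW, vacuumWeight_of_notMem hpD, hx]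

end Weight

/-! ### The sound speed and the enthalpy -/

theorem Gam_pos {γ : ℝ} (hγ : 1 < γ) (x : ℝ) : 0 < Gam γ x := by
  have : 0 < γ - 1 := by linarith
  unfold Gam
  positivity

theorem inv_Gam {γ : ℝ} (hγ : 1 < γ) (x : ℝ) :
    (Gam γ x)⁻¹ = γ / (γ - 1) ^ ((γ - 1) / γ) * Real.exp ((γ - 1) / γ * x) := by
  have : 0 < γ - 1 := by linarith
  have h1 : (γ - 1) ^ ((γ - 1) / γ) ≠ 0 := (Real.rpow_pos_of_pos this _).ne'
  unfold Gam
  field_simp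

theorem deriv_Gam {γ : ℝ} (hγ : 1 < γ) (x : ℝ) : deriv (Gam γ) x = - ((γ - 1) / γ) * Gam γ x := by
  have hG : Gam γ = fun x => (γ - 1) ^ ((γ - 1) / γ) / γ * Real.exp (- ((γ - 1) / γ * x)) := by
    ext y
    rw [Gam, Real.exp_neg]
    field_simp
  have h1 : HasDerivAt (fun y : ℝ => - ((γ - 1) / γ * y)) (- ((γ - 1) / γ)) x := by
    simpa using ((hasDerivAt_id x).const_mul ((γ - 1) / γ)).fun_neg
  rw [hG, (h1.exp.const_mul _).deriv]
  ring

/-! ### Flows together with a linearized solution -/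

/-- A background flow with a solution of the linearized system, with the bounds on the background
that the estimates may use: derivatives of order at most `2 k + 1 = 2 j + 3` are bounded by `M`
(here `k = j + 1`), and the gas is thin: the square of the sound speed is at most one half, which
makes the linear system for the time derivatives uniformly invertible. -/
structure LinFlow (γ : ℝ) (j : ℕ) (M : ℝ≥0) where
  /-- The length of the time interval. -/
  T : ℝ
  /-- The region occupied by the gas at a given time. -/
  Ω : ℝ → Set Space
  /-- The entropy. -/
  s : Spacetime → ℝ
  /-- The sound-speed variable. -/
  r : Spacetime → ℝ
  /-- The four-velocity. -/
  u : Fin 4 → Spacetime → ℝ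
  /-- The linearized entropy. -/
  s' : Spacetime → ℝ
  /-- The linearized sound-speed variable. -/
  r' : Spacetime → ℝ
  /-- The linearized four-velocity. -/
  u' : Fin 4 → Spacetime → ℝ
  one_lt : 1 < γ
  T_pos : 0 < T
  euler : IsEulerSolution γ T Ω s r u
  vacuum : IsPhysicalVacuum T Ω r
  linear : IsLinearizedSolution γ T Ω s r u s' r' u'
  supNorm_le : ∀ t ∈ Icc 0 T, supNorm (2 * (j + 1) + 1) Ω s r u t ≤ M
  r_le_one : ∀ p ∈ movingDomain T Ω, r p ≤ 1
  thin : ∀ p ∈ movingDomain T Ω, (γ - 1) * (Gam γ (s p))⁻¹ * r p ≤ 1 / 2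

variable {γ : ℝ} {j : ℕ} {M : ℝ≥0}

variable (γ j M) in
/-- The moving domains of all flows. -/
def flowDomain : DomainFamily (LinFlow γ j M) where
  carrier S := movingDomain S.T S.Ω
  uniqueDiffOn S := S.vacuum.uniqueDiffOn S.T_pos

theorem LinFlow.sum_le_supNorm (S : LinFlow γ j M) {p : Spacetime}
    (hp : p ∈ (flowDomain γ j M).carrier S) {a : Fin 4 → ℕ} (ha : ∑ μ, a μ ≤ 2 * j + 3) :
    ‖multiD a S.s p‖ₑ + ‖multiD a S.r p‖ₑ + ∑ μ, ‖multiD a (S.u μ) p‖ₑ ≤ M := by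
  refine le_trans ?_ (S.supNorm_le p.1 hp.1)
  unfold supNorm
  exact le_iSup₂_of_le a (by omega) (le_iSup₂_of_le p.2 hp.2 le_rfl)

theorem abs_le_of_enorm_le {x : ℝ} (h : ‖x‖ₑ ≤ (M : ℝ≥0∞)) : |x| ≤ M := by
  have : ‖x‖₊ ≤ M := by exact_mod_cast h
  simpa using (NNReal.coe_le_coe.2 this)

theorem LinFlow.abs_multiD_s_le (S : LinFlow γ j M) {p : Spacetime}
    (hp : p ∈ (flowDomain γ j M).carrier S) {a : Fin 4 → ℕ} (ha : ∑ μ, a μ ≤ 2 * j + 3) :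
    |multiD a S.s p| ≤ M :=
  abs_le_of_enorm_le ((le_add_right le_self_add).trans (S.sum_le_supNorm hp ha))

theorem LinFlow.abs_multiD_r_le (S : LinFlow γ j M) {p : Spacetime}
    (hp : p ∈ (flowDomain γ j M).carrier S) {a : Fin 4 → ℕ} (ha : ∑ μ, a μ ≤ 2 * j + 3) :
    |multiD a S.r p| ≤ M :=
  abs_le_of_enorm_le ((le_add_right le_add_self).trans (S.sum_le_supNorm hp ha))

theorem LinFlow.abs_multiD_u_le (S : LinFlow γ j M) {p : Spacetime}
    (hp : p ∈ (flowDomain γ j M).carrier S) {a : Fin 4 → ℕ} (ha : ∑ μ, a μ ≤ 2 * j + 3)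
    (μ : Fin 4) : |multiD a (S.u μ) p| ≤ M := by
  refine abs_le_of_enorm_le (le_trans ?_ (le_add_self.trans (S.sum_le_supNorm hp ha)))
  exact Finset.single_le_sum (f := fun μ => ‖multiD a (S.u μ) p‖ₑ) (fun _ _ => zero_le)
    (Finset.mem_univ μ)

/-- Background quantities with bounded derivatives of order at most `m`. -/
abbrev Background (m : ℕ) (f : LinFlow γ j M → Spacetime → ℝ) : Prop :=
  BddJet (flowDomain γ j M) id m f

theorem background_s : Background (2 * j + 3) (LinFlow.s : LinFlow γ j M → _) :=
  BddDeriv.bddJet ⟨fun S => S.euler.smooth_s, fun _ ha => ⟨M, fun S _ hp =>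
    S.abs_multiD_s_le hp ha⟩⟩

theorem background_r : Background (2 * j + 3) (LinFlow.r : LinFlow γ j M → _) :=
  BddDeriv.bddJet ⟨fun S => S.euler.smooth_r, fun _ ha => ⟨M, fun S _ hp =>
    S.abs_multiD_r_le hp ha⟩⟩

theorem background_u (μ : Fin 4) :
    Background (2 * j + 3) (fun (S : LinFlow γ j M) p => S.u μ p) :=
  BddDeriv.bddJet ⟨fun S => S.euler.smooth_u μ, fun _ ha => ⟨M, fun S _ hp =>
    S.abs_multiD_u_le hp ha μ⟩⟩

/-- The reciprocal `1 / Γ(s)`. -/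
noncomputable def LinFlow.g (S : LinFlow γ j M) (p : Spacetime) : ℝ := (Gam γ (S.s p))⁻¹

/-- The enthalpy `h = 1 + r / Γ(s)`. -/
noncomputable def LinFlow.h (S : LinFlow γ j M) (p : Spacetime) : ℝ := 1 + S.g p * S.r p

theorem LinFlow.g_eq (S : LinFlow γ j M) : S.g = fun p =>
    γ / (γ - 1) ^ ((γ - 1) / γ) * Real.exp ((γ - 1) / γ * S.s p) :=
  funext fun _ => inv_Gam S.one_lt _

theorem LinFlow.g_pos (S : LinFlow γ j M) (p : Spacetime) : 0 < S.g p :=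
  inv_pos.2 (Gam_pos S.one_lt _)

theorem LinFlow.contDiff_g (S : LinFlow γ j M) : ContDiff ℝ (⊤ : ℕ∞) S.g := by
  rw [S.g_eq]
  exact contDiff_const.mul (contDiff_const.mul S.euler.smooth_s).exp

theorem LinFlow.contDiff_h (S : LinFlow γ j M) : ContDiff ℝ (⊤ : ℕ∞) S.h :=
  contDiff_const.add (S.contDiff_g.mul S.euler.smooth_r)

theorem LinFlow.pd_g (S : LinFlow γ j M) (μ : Fin 4) (p : Spacetime) :
    pd μ S.g p = (γ - 1) / γ * S.g p * pd μ S.s p := by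
  have hs : DifferentiableAt ℝ S.s p := S.euler.smooth_s.contDiffAt.differentiableAt (by simp)
  rw [S.g_eq, pd_const_mul (hs.const_mul _).exp, pd_exp (hs.const_mul _), pd_const_mul hs]
  ring

theorem LinFlow.pd_h (S : LinFlow γ j M) (μ : Fin 4) (p : Spacetime) :
    pd μ S.h p = (γ - 1) / γ * S.g p * pd μ S.s p * S.r p + S.g p * pd μ S.r p := by
  have hr : DifferentiableAt ℝ S.r p := S.euler.smooth_r.contDiffAt.differentiableAt (by simp)
  have hg : DifferentiableAt ℝ S.g p := S.contDiff_g.contDiffAt.differentiableAt (by simp)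
  unfold LinFlow.h
  rw [pd_add (differentiableAt_const _) (hg.fun_mul hr), pd_const, pd_mul hg hr, S.pd_g]
  ring

theorem LinFlow.one_le_h (S : LinFlow γ j M) {p : Spacetime}
    (hp : p ∈ (flowDomain γ j M).carrier S) : 1 ≤ S.h p := by
  have := mul_nonneg (S.g_pos p).le (S.vacuum.pos p hp).le
  unfold LinFlow.h
  linarith

theorem LinFlow.one_div_Gam_add (S : LinFlow γ j M) {p : Spacetime}
    (hp : p ∈ (flowDomain γ j M).carrier S) :
    1 / (Gam γ (S.s p) + S.r p) = S.g p * (S.h p)⁻¹ := by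
  have h1 := Gam_pos S.one_lt (S.s p)
  have h2 := S.vacuum.pos p hp
  unfold LinFlow.h LinFlow.g
  field_simp

theorem background_g : Background (2 * j + 3) (LinFlow.g : LinFlow γ j M → _) := by
  rw [show (LinFlow.g : LinFlow γ j M → _) = fun S => S.g from rfl]
  simp only [LinFlow.g_eq]
  exact (BddJet.exp (background_s.const_mul _)).const_mul _

theorem background_h : Background (2 * j + 3) (LinFlow.h : LinFlow γ j M → _) :=
  (BddJet.const 1 _).add (BddJet.mul background_g background_r)

theorem background_inv_h : Background (2 * j + 3) (fun (S : LinFlow γ j M) p => (S.h p)⁻¹) :=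
  BddJet.inv background_h ⟨1, one_pos, fun S _ hp => S.one_le_h hp⟩

theorem background_inv_u0 :
    Background (2 * j + 3) (fun (S : LinFlow γ j M) p => (S.u 0 p)⁻¹) :=
  BddJet.inv (background_u 0) ⟨1, one_pos, fun S _ hp => S.euler.one_le_zero hp⟩

theorem background_proj (α β : Fin 4) :
    Background (2 * j + 3) (fun (S : LinFlow γ j M) p => proj S.u α β p) :=
  (BddJet.const (mink α β) _).add (BddJet.mul (background_u α) (background_u β))

/-- The determinant of the linear system that expresses `∂_t r̃` and `∂_t ũ⁰` by spatial
derivatives. -/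
noncomputable def LinFlow.det (S : LinFlow γ j M) (p : Spacetime) : ℝ :=
  S.u 0 p * S.u 0 p - (γ - 1) * (S.r p * (S.g p * (S.h p)⁻¹ * proj S.u 0 0 p))

theorem LinFlow.half_le_det (S : LinFlow γ j M) {p : Spacetime}
    (hp : p ∈ (flowDomain γ j M).carrier S) : 1 / 2 ≤ S.det p := by
  have h1 := S.one_le_h hp
  have h2 := S.euler.one_le_zero hp
  have h3 := S.vacuum.pos p hp
  have h4 := S.g_pos p
  have h5 := S.one_lt
  have h6 : (S.h p)⁻¹ ≤ 1 := inv_le_one_of_one_le₀ h1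
  have h7 : 0 < (S.h p)⁻¹ := by positivity
  have h8 : (γ - 1) * S.g p * S.r p ≤ 1 / 2 := S.thin p hp
  have h9 : 0 ≤ (γ - 1) * S.g p * S.r p := by
    have : 0 ≤ γ - 1 := by linarith
    positivity
  set κ := (γ - 1) * S.g p * S.r p with hκ
  have h10 : κ * (S.h p)⁻¹ ≤ 1 / 2 := by nlinarith
  have h11 : 0 ≤ κ * (S.h p)⁻¹ := by positivity
  have h12 : S.det p = S.u 0 p ^ 2 * (1 - κ * (S.h p)⁻¹) + κ * (S.h p)⁻¹ := by
    simp only [LinFlow.det, proj, mink, hκ, if_true]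
    ring
  rw [h12]
  nlinarith

theorem background_inv_det :
    Background (2 * j + 3) (fun (S : LinFlow γ j M) p => (S.det p)⁻¹) := by
  refine BddJet.inv ?_ ⟨1 / 2, by norm_num, fun S _ hp => S.half_le_det hp⟩
  exact (BddJet.mul (background_u 0) (background_u 0)).sub
    ((BddJet.mul background_r (BddJet.mul (BddJet.mul background_g background_inv_h)
      (background_proj 0 0))).const_mul _)

theorem background_lower (β : Fin 4) :
    Background (2 * j + 3) (fun (S : LinFlow γ j M) p => lower S.u β p) :=
  .sum _ fun μ _ => (background_u μ).const_mul _

/-! ### The density of the energy norm -/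

/-- The integrand of the squared `𝓗^{2k}` norm, `k = j + 1`. -/
noncomputable def LinFlow.density (S : LinFlow γ j M) (p : Spacetime) : ℝ :=
  ∑ n ∈ Finset.range (2 * (j + 1) + 1), ∑ α ∈ multiIdx n,
    ∑ a ∈ (Finset.range (j + 1 + 1)).filter (fun a => n ≤ j + 1 + a),
      ((S.r p ^ ((2 - γ) / (2 * (γ - 1)) + 1 / 2 + (a : ℝ)) * spatialD α S.s' p) ^ 2
        + (S.r p ^ ((2 - γ) / (2 * (γ - 1)) + (a : ℝ)) * spatialD α S.r' p) ^ 2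
        + ∑ μ, (S.r p ^ ((2 - γ) / (2 * (γ - 1)) + 1 / 2 + (a : ℝ)) * spatialD α (S.u' μ) p) ^ 2)

theorem LinFlow.density_nonneg (S : LinFlow γ j M) (p : Spacetime) : 0 ≤ S.density p := by
  unfold LinFlow.density
  positivity

theorem lintegral_density (S : LinFlow γ j M) (t : ℝ) :
    ∫⁻ x in S.Ω t, ENNReal.ofReal (S.density (t, x))
      = calHSq γ S.Ω S.r (j + 1) S.s' S.r' S.u' t := by
  have hm : ∀ (e : ℝ) {f : Spacetime → ℝ} (α : Fin 3 → ℕ), ContDiff ℝ (⊤ : ℕ∞) f →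
      Measurable fun x : Space => ENNReal.ofReal ((S.r (t, x) ^ e * spatialD α f (t, x)) ^ 2) := by
    intro e f α hf
    have h1 : Measurable fun x : Space => S.r (t, x) :=
      (S.euler.smooth_r.continuous.comp (by fun_prop)).measurable
    have h2 : Measurable fun x : Space => spatialD α f (t, x) :=
      ((contDiff_spatialD hf α).continuous.comp (by fun_prop)).measurable
    fun_prop
  have hs := fun e α => hm e α S.linear.smooth_s
  have hr := fun e α => hm e α S.linear.smooth_r
  have hu := fun μ e α => hm e α (S.linear.smooth_u μ)
  have hterm : ∀ (α : Fin 3 → ℕ) (a : ℕ), Measurable fun x : Space =>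
      ENNReal.ofReal ((S.r (t, x) ^ ((2 - γ) / (2 * (γ - 1)) + 1 / 2 + (a : ℝ))
          * spatialD α S.s' (t, x)) ^ 2)
        + ENNReal.ofReal ((S.r (t, x) ^ ((2 - γ) / (2 * (γ - 1)) + (a : ℝ))
          * spatialD α S.r' (t, x)) ^ 2)
        + ∑ μ, ENNReal.ofReal ((S.r (t, x) ^ ((2 - γ) / (2 * (γ - 1)) + 1 / 2 + (a : ℝ))
          * spatialD α (S.u' μ) (t, x)) ^ 2) := fun α a =>
    ((hs _ α).add (hr _ α)).add (Finset.measurable_sum _ fun μ _ => hu μ _ α)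
  have hw : ∀ (e : ℝ) (f : Spacetime → ℝ), wL2Sq S.Ω S.r e t f
      = ∫⁻ x in S.Ω t, ENNReal.ofReal ((S.r (t, x) ^ e * f (t, x)) ^ 2) := by
    intro e f
    unfold wL2Sq
    congr 1
    ext x
    rw [← enorm_pow, Real.enorm_eq_ofReal (sq_nonneg _)]
  unfold calHSq LinFlow.density
  simp only [hw]
  have e1 : ∀ x : Space, ENNReal.ofReal (S.density (t, x)) =
      ∑ n ∈ Finset.range (2 * (j + 1) + 1), ∑ α ∈ multiIdx n,
      ∑ a ∈ (Finset.range (j + 1 + 1)).filter (fun a => n ≤ j + 1 + a),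
      (ENNReal.ofReal ((S.r (t, x) ^ ((2 - γ) / (2 * (γ - 1)) + 1 / 2 + (a : ℝ))
          * spatialD α S.s' (t, x)) ^ 2)
        + ENNReal.ofReal ((S.r (t, x) ^ ((2 - γ) / (2 * (γ - 1)) + (a : ℝ))
          * spatialD α S.r' (t, x)) ^ 2)
        + ∑ μ, ENNReal.ofReal ((S.r (t, x) ^ ((2 - γ) / (2 * (γ - 1)) + 1 / 2 + (a : ℝ))
          * spatialD α (S.u' μ) (t, x)) ^ 2)) := by
    intro x
    unfold LinFlow.density
    rw [ENNReal.ofReal_sum_of_nonneg fun _ _ => by positivity]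
    refine Finset.sum_congr rfl fun n _ => ?_
    rw [ENNReal.ofReal_sum_of_nonneg fun _ _ => by positivity]
    refine Finset.sum_congr rfl fun α _ => ?_
    rw [ENNReal.ofReal_sum_of_nonneg fun _ _ => by positivity]
    refine Finset.sum_congr rfl fun a _ => ?_
    rw [ENNReal.ofReal_add (by positivity) (by positivity), ENNReal.ofReal_add (by positivity)
      (by positivity), ENNReal.ofReal_sum_of_nonneg fun _ _ => by positivity]
  unfold LinFlow.density at e1
  simp only [e1]
  rw [lintegral_finsetSum _ fun n _ => Finset.measurable_sum _ fun α _ =>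
    Finset.measurable_sum _ fun a _ => hterm α a]
  refine Finset.sum_congr rfl fun n _ => ?_
  rw [lintegral_finsetSum _ fun α _ => Finset.measurable_sum _ fun a _ => hterm α a]
  refine Finset.sum_congr rfl fun α _ => ?_
  rw [lintegral_finsetSum _ fun a _ => hterm α a]
  refine Finset.sum_congr rfl fun a _ => ?_
  rw [lintegral_add_left (by exact (hs _ α).add (hr _ α)), lintegral_add_left (hs _ α),
    lintegral_finsetSum _ fun μ _ => hu μ _ α]

/-- The pointwise size of the linearized solution. -/
noncomputable def LinFlow.ampl (S : LinFlow γ j M) (p : Spacetime) : ℝ := √(S.density p)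

theorem LinFlow.ampl_sq (S : LinFlow γ j M) (p : Spacetime) : S.ampl p ^ 2 = S.density p :=
  Real.sq_sqrt (S.density_nonneg p)

theorem LinFlow.term_le_density (S : LinFlow γ j M) (p : Spacetime) {α : Fin 3 → ℕ} {a : ℕ}
    (ha : a ≤ j + 1) (hα : ∑ i, α i ≤ j + 1 + a) :
    (S.r p ^ ((2 - γ) / (2 * (γ - 1)) + 1 / 2 + (a : ℝ)) * spatialD α S.s' p) ^ 2
        + (S.r p ^ ((2 - γ) / (2 * (γ - 1)) + (a : ℝ)) * spatialD α S.r' p) ^ 2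
        + ∑ μ, (S.r p ^ ((2 - γ) / (2 * (γ - 1)) + 1 / 2 + (a : ℝ)) * spatialD α (S.u' μ) p) ^ 2
      ≤ S.density p := by
  unfold LinFlow.density
  refine le_trans ?_ (Finset.single_le_sum (fun _ _ => by positivity)
    (Finset.mem_range.2 (by omega : ∑ i, α i < 2 * (j + 1) + 1)))
  refine le_trans ?_ (Finset.single_le_sum (fun _ _ => by positivity)
    (by simp [multiIdx] : α ∈ multiIdx (∑ i, α i)))
  refine le_trans ?_ (Finset.single_le_sum (fun _ _ => by positivity)
    (Finset.mem_filter.2 ⟨Finset.mem_range.2 (by omega : a < j + 1 + 1), hα⟩))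
  exact le_rfl

/-! ### Weighted classes of linear quantities -/

/-- The weight `r^{-e}` times the size of the linearized solution. -/
noncomputable def flowWeight (e : ℝ) (S : LinFlow γ j M) (p : Spacetime) : ℝ :=
  S.ampl p * S.r p ^ (-e)

/-- The family `f` and its spatial derivatives of order at most `m`, multiplied by `r ^ e`, are
bounded pointwise by the size of the linearized solution. -/
abbrev WBound (e : ℝ) (m : ℕ) (f : LinFlow γ j M → Spacetime → ℝ) : Prop :=
  JetBound (flowDomain γ j M) Fin.succ (flowWeight e) m f

theorem abs_le_flowWeight (S : LinFlow γ j M) {p : Spacetime}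
    (hp : p ∈ (flowDomain γ j M).carrier S) {e x : ℝ}
    (h : (S.r p ^ e * x) ^ 2 ≤ S.density p) : |x| ≤ 1 * flowWeight e S p := by
  have hr := S.vacuum.pos p hp
  have h1 : |S.r p ^ e * x| ≤ S.ampl p := Real.abs_le_sqrt h
  rw [abs_mul, abs_of_pos (Real.rpow_pos_of_pos hr e)] at h1
  rw [one_mul, flowWeight, Real.rpow_neg hr.le, ← div_eq_mul_inv,
    le_div_iff₀ (Real.rpow_pos_of_pos hr e), mul_comm]
  exact h1

theorem WBound.mono_exp {e e' : ℝ} {m : ℕ} {f : LinFlow γ j M → Spacetime → ℝ}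
    (hf : WBound e m f) (h : e ≤ e') : WBound e' m f := by
  refine JetBound.mono_weight hf ⟨1, fun S p hp => ?_⟩
  have hr := S.vacuum.pos p hp
  have h0 : 0 ≤ S.ampl p := Real.sqrt_nonneg _
  refine ⟨mul_nonneg h0 (Real.rpow_nonneg hr.le _), ?_⟩
  rw [one_mul]
  exact mul_le_mul_of_nonneg_left (Real.rpow_le_rpow_of_exponent_ge hr (S.r_le_one p hp)
    (by linarith)) h0

theorem Background.mul {e : ℝ} {m : ℕ} {c f : LinFlow γ j M → Spacetime → ℝ}
    (hc : Background m c) (hf : WBound e m f) : WBound e m (fun S p => c S p * f S p) :=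
  BddJet.mul hc.of_id hf

/-- Multiplication by `r` gains one power of `r`. The terms in which a derivative falls on `r` are
of lower order, and for those the gain has to be assumed. -/
theorem WBound.r_mul {e : ℝ} {m : ℕ} {f : LinFlow γ j M → Spacetime → ℝ} (hm : m ≤ 2 * j + 3)
    (hf : WBound e m f) (hf' : ∀ m', m = m' + 1 → WBound (e - 1) m' f) :
    WBound (e - 1) m (fun S p => S.r p * f S p) := by
  have key : ∀ {f : LinFlow γ j M → Spacetime → ℝ}, Dominated (flowDomain γ j M) (flowWeight e) f →
      Dominated (flowDomain γ j M) (flowWeight (e - 1)) (fun S p => S.r p * f S p) := by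
    rintro f ⟨hs, C, hC⟩
    refine ⟨background_r.smooth.mul hs, C, fun S p hp => ?_⟩
    have hr := S.vacuum.pos p hp
    rw [abs_mul, abs_of_pos hr]
    refine (mul_le_mul_of_nonneg_left (hC S p hp) hr.le).trans_eq ?_
    simp only [flowWeight]
    rw [show -(e - 1) = -e + 1 by ring, Real.rpow_add_one hr.ne']
    ring
  induction m generalizing f with
  | zero => exact key hf
  | succ m ih =>
    refine ⟨key hf.1, fun i => ?_⟩
    have h1 : WBound (e - 1) m (fun S p => pd i.succ S.r p * f S p) :=
      Background.mul ((background_r.mono (by omega : m + 1 ≤ 2 * j + 3)).pd i.succ) (hf' m rfl)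
    have h2 := ih (by omega) (hf.pd i) fun m' hm' => by
      subst hm'
      exact (hf' _ rfl).pd i
    refine (h1.add h2).congr ((background_r.smooth.mul hf.smooth).pd _) fun S p hp => ?_
    rw [pd_mul (background_r.smooth.differentiableAt hp) (hf.smooth.differentiableAt hp)]

variable (γ j) in
/-- The exponent `σ = k + 1 / (2 (γ - 1))` of the weight of the vorticity, `k = j + 1`. -/
noncomputable def vortExp : ℝ := ((j + 1 : ℕ) : ℝ) + 1 / (2 * (γ - 1))

/-- Quantities whose `2k - 1` spatial derivatives are controlled with the weight `r ^ e`, and for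
which one derivative less can be traded for a weight with one power of `r` less than that of the
vorticity. The two exponents of interest are `e = σ` and `e = σ - 1/2`, the latter being half a
power of `r` better than needed. -/
def TwoTier (e : ℝ) (f : LinFlow γ j M → Spacetime → ℝ) : Prop :=
  WBound e (2 * j + 1) f ∧ WBound (vortExp γ j - 1) (2 * j) f

section TwoTier

variable {e e' : ℝ} {c f f₁ f₂ : LinFlow γ j M → Spacetime → ℝ}

theorem TwoTier.smooth (hf : TwoTier e f) : SmoothFamily (flowDomain γ j M) f := hf.1.smooth

theorem TwoTier.mono (hf : TwoTier e f) (h : e ≤ e') : TwoTier e' f := ⟨hf.1.mono_exp h, hf.2⟩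

theorem TwoTier.add (h₁ : TwoTier e f₁) (h₂ : TwoTier e f₂) :
    TwoTier e (fun S p => f₁ S p + f₂ S p) := ⟨h₁.1.add h₂.1, h₁.2.add h₂.2⟩

theorem TwoTier.sub (h₁ : TwoTier e f₁) (h₂ : TwoTier e f₂) :
    TwoTier e (fun S p => f₁ S p - f₂ S p) := ⟨h₁.1.sub h₂.1, h₁.2.sub h₂.2⟩

theorem TwoTier.neg (hf : TwoTier e f) : TwoTier e (fun S p => - f S p) := ⟨hf.1.neg, hf.2.neg⟩

theorem TwoTier.sum {κ : Type*} (t : Finset κ) {f : κ → LinFlow γ j M → Spacetime → ℝ}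
    (hf : ∀ i ∈ t, TwoTier e (f i)) : TwoTier e (fun S p => ∑ i ∈ t, f i S p) :=
  ⟨.sum t fun i hi => (hf i hi).1, .sum t fun i hi => (hf i hi).2⟩

theorem TwoTier.const_mul (c : ℝ) (hf : TwoTier e f) : TwoTier e (fun S p => c * f S p) :=
  ⟨hf.1.const_mul c, hf.2.const_mul c⟩

theorem TwoTier.coef_mul {m : ℕ} (hc : Background (2 * j + 1 + m) c) (hf : TwoTier e f) :
    TwoTier e (fun S p => c S p * f S p) :=
  ⟨Background.mul (hc.mono (by omega)) hf.1, Background.mul (hc.mono (by omega)) hf.2⟩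

theorem TwoTier.congr (hf : TwoTier e f₁) (hs : SmoothFamily (flowDomain γ j M) f₂)
    (h : ∀ S, ∀ p ∈ (flowDomain γ j M).carrier S, f₁ S p = f₂ S p) : TwoTier e f₂ :=
  ⟨hf.1.congr hs h, hf.2.congr hs h⟩

/-- Multiplication by `r` improves the weight by half a power of `r` at least. -/
theorem TwoTier.r_mul (hf : TwoTier (vortExp γ j) f) :
    TwoTier (vortExp γ j - 1 / 2) (fun S p => S.r p * f S p) :=
  ⟨(WBound.r_mul (by omega) hf.1 fun m' hm' => by
      obtain rfl : m' = 2 * j := by omega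
      exact hf.2).mono_exp (by linarith),
    Background.mul (background_r.mono (by omega)) hf.2⟩

theorem TwoTier.of_wBound (hf : WBound (vortExp γ j - 1) (2 * j + 1) f) :
    TwoTier (vortExp γ j - 1 / 2) f := ⟨hf.mono_exp (by linarith), hf.of_succ⟩

end TwoTier

theorem LinFlow.exponent_eq (S : LinFlow γ j M) (a : ℕ) (b : ℕ) (h : a + b = j + 1) :
    (2 - γ) / (2 * (γ - 1)) + 1 / 2 + (a : ℝ) = vortExp γ j - b := by
  have : γ - 1 ≠ 0 := by linarith [S.one_lt]
  have hab : ((j + 1 : ℕ) : ℝ) = a + b := by rw [← h]; push_cast; ring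
  unfold vortExp
  rw [hab]
  field_simp
  ring

/-- The bounds contained in the energy norm, for the admissible number `a` of powers of `r`. They are
used for `a = k` and for `a = k - 1`. -/
theorem wBound_s'_u'_r' {a b : ℕ} (h : a + b = j + 1) :
    WBound (vortExp γ j - b) (j + 1 + a) (LinFlow.s' : LinFlow γ j M → _) ∧
    (∀ μ, WBound (vortExp γ j - b) (j + 1 + a) (fun (S : LinFlow γ j M) p => S.u' μ p)) ∧
    WBound (vortExp γ j - b - 1 / 2) (j + 1 + a) (LinFlow.r' : LinFlow γ j M → _) := by
  refine ⟨.of_spatialD (fun S => S.linear.smooth_s) fun α hα => ⟨1, fun S p hp => ?_⟩,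
    fun μ => .of_spatialD (fun S => S.linear.smooth_u μ) fun α hα => ⟨1, fun S p hp => ?_⟩,
    .of_spatialD (fun S => S.linear.smooth_r) fun α hα => ⟨1, fun S p hp => ?_⟩⟩
  all_goals
    have key := S.term_le_density p (by omega : a ≤ j + 1) hα
    rw [← S.exponent_eq a b h]
    refine abs_le_flowWeight S hp (le_trans ?_ key)
  · refine (le_add_of_nonneg_right ?_).trans (le_add_of_nonneg_right ?_) <;> positivity
  · refine le_trans ?_ (le_add_of_nonneg_left (by positivity))
    exact Finset.single_le_sum (f := fun μ => (S.r p ^ ((2 - γ) / (2 * (γ - 1)) + 1 / 2 + (a : ℝ))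
      * spatialD α (S.u' μ) p) ^ 2) (fun _ _ => sq_nonneg _) (Finset.mem_univ μ)
  · rw [show (2 - γ) / (2 * (γ - 1)) + 1 / 2 + (a : ℝ) - 1 / 2
      = (2 - γ) / (2 * (γ - 1)) + (a : ℝ) by ring]
    refine le_trans (le_add_of_nonneg_left ?_) (le_add_of_nonneg_right ?_) <;> positivity

theorem twoTier_s' : TwoTier (vortExp γ j - 1 / 2) (LinFlow.s' : LinFlow γ j M → _) := by
  have := (wBound_s'_u'_r' (γ := γ) (j := j) (M := M) (a := j) (b := 1) rfl).1
  refine .of_wBound ?_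
  simpa using this.mono (by omega : 2 * j + 1 ≤ j + 1 + j)

theorem twoTier_u' (μ : Fin 4) :
    TwoTier (vortExp γ j - 1 / 2) (fun (S : LinFlow γ j M) p => S.u' μ p) := by
  have := (wBound_s'_u'_r' (γ := γ) (j := j) (M := M) (a := j) (b := 1) rfl).2.1 μ
  refine .of_wBound ?_
  simpa using this.mono (by omega : 2 * j + 1 ≤ j + 1 + j)

theorem twoTier_r' : TwoTier (vortExp γ j - 1 / 2) (LinFlow.r' : LinFlow γ j M → _) := by
  have := (wBound_s'_u'_r' (γ := γ) (j := j) (M := M) (a := j) (b := 1) rfl).2.2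
  refine .of_wBound (WBound.mono_exp (this.mono (by omega : 2 * j + 1 ≤ j + 1 + j)) ?_)
  push_cast
  linarith

theorem twoTier_spatial_s' (i : Fin 3) :
    TwoTier (vortExp γ j) (fun (S : LinFlow γ j M) p => pd i.succ S.s' p) := by
  have h0 := (wBound_s'_u'_r' (γ := γ) (j := j) (M := M) (a := j + 1) (b := 0) rfl).1
  have h1 := (wBound_s'_u'_r' (γ := γ) (j := j) (M := M) (a := j) (b := 1) rfl).1
  refine ⟨?_, ?_⟩
  · simpa using (h0.mono (by omega : 2 * j + 1 + 1 ≤ j + 1 + (j + 1))).pd i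
  · simpa using (h1.mono (by omega : 2 * j + 1 ≤ j + 1 + j)).pd i

theorem twoTier_spatial_u' (i : Fin 3) (μ : Fin 4) :
    TwoTier (vortExp γ j) (fun (S : LinFlow γ j M) p => pd i.succ (S.u' μ) p) := by
  have h0 := (wBound_s'_u'_r' (γ := γ) (j := j) (M := M) (a := j + 1) (b := 0) rfl).2.1 μ
  have h1 := (wBound_s'_u'_r' (γ := γ) (j := j) (M := M) (a := j) (b := 1) rfl).2.1 μ
  refine ⟨?_, ?_⟩
  · simpa using (h0.mono (by omega : 2 * j + 1 + 1 ≤ j + 1 + (j + 1))).pd i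
  · simpa using (h1.mono (by omega : 2 * j + 1 ≤ j + 1 + j)).pd i

theorem twoTier_spatial_r' (i : Fin 3) :
    TwoTier (vortExp γ j - 1 / 2) (fun (S : LinFlow γ j M) p => pd i.succ S.r' p) := by
  have h0 := (wBound_s'_u'_r' (γ := γ) (j := j) (M := M) (a := j + 1) (b := 0) rfl).2.2
  have h1 := (wBound_s'_u'_r' (γ := γ) (j := j) (M := M) (a := j) (b := 1) rfl).2.2
  refine ⟨?_, ?_⟩
  · simpa using (h0.mono (by omega : 2 * j + 1 + 1 ≤ j + 1 + (j + 1))).pd i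
  · refine WBound.mono_exp ((h1.mono (by omega : 2 * j + 1 ≤ j + 1 + j)).pd i) ?_
    push_cast
    linarith

/-! ### Time derivatives of the linearized solution -/

theorem background_pd {m n : ℕ} {f : LinFlow γ j M → Spacetime → ℝ} (hf : Background n f) (h : m + 1 ≤ n)
    (μ : Fin 4) : Background m (fun S p => pd μ (f S) p) := (hf.mono h).pd μ

theorem smoothFamily_of_contDiff {f : LinFlow γ j M → Spacetime → ℝ}
    (hf : ∀ S, ContDiff ℝ (⊤ : ℕ∞) (f S)) : SmoothFamily (flowDomain γ j M) f :=
  fun S _ _ => (hf S).contDiffAt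

theorem twoTier_along_u' {f : LinFlow γ j M → Spacetime → ℝ} (hf : Background (2 * j + 3) f) :
    TwoTier (vortExp γ j - 1 / 2) (fun S p => along S.u' (f S) p) := by
  unfold along
  refine .sum _ fun μ _ => ?_
  simp only [mul_comm (LinFlow.u' _ μ _)]
  exact .coef_mul (m := 1) (background_pd hf (by omega) μ) (twoTier_u' μ)

theorem background_sum_proj_pd_r (α : Fin 4) :
    Background (2 * j + 2) (fun (S : LinFlow γ j M) p => ∑ μ, proj S.u α μ p * pd μ S.r p) :=
  .sum _ fun μ _ => BddJet.mul ((background_proj α μ).mono (by omega))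
    (background_pd background_r (by omega) μ)

theorem twoTier_srcG :
    TwoTier (vortExp γ j - 1 / 2) (fun (S : LinFlow γ j M) p => srcG γ S.u S.r' p) := by
  have h : Background (2 * j + 1 + 1) (fun (S : LinFlow γ j M) p => divg S.u p) :=
    .sum _ fun μ _ => background_pd (background_u μ) (by omega) μ
  refine (((TwoTier.coef_mul h twoTier_r').const_mul (γ - 1)).neg.congr
    (smoothFamily_of_contDiff fun S => ?_) fun S p _ => ?_)
  · unfold srcG divg
    exact ((contDiff_const.mul S.linear.smooth_r).mul
      (ContDiff.sum fun μ _ => contDiff_pd (S.euler.smooth_u μ) μ)).neg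
  · unfold srcG
    ring

theorem LinFlow.srcH_eq (S : LinFlow γ j M) {p : Spacetime}
    (hp : p ∈ (flowDomain γ j M).carrier S) (α : Fin 4) :
    srcH γ S.s S.r S.u S.s' S.r' S.u' α p =
      - along S.u' (S.u α) p
      - S.g p * (S.h p)⁻¹ * (along S.u S.r p * S.u' α p + S.u α p * along S.u' S.r p)
      + (∑ μ, proj S.u α μ p * pd μ S.r p) * (- ((γ - 1) / γ) * (S.g p * (S.h p)⁻¹ * (S.h p)⁻¹)
        * S.s' p + (S.g p * (S.h p)⁻¹) * (S.g p * (S.h p)⁻¹) * S.r' p) := by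
  have e1 : ∑ μ, (S.u' α p * S.u μ p + S.u α p * S.u' μ p) * pd μ S.r p
      = along S.u S.r p * S.u' α p + S.u α p * along S.u' S.r p := by
    simp only [along, Finset.sum_mul, Finset.mul_sum, ← Finset.sum_add_distrib]
    exact Finset.sum_congr rfl fun μ _ => by ring
  have e2 : 1 / (Gam γ (S.s p) + S.r p) ^ 2
      = (S.g p * (S.h p)⁻¹) * (S.g p * (S.h p)⁻¹) := by
    rw [← S.one_div_Gam_add hp, div_mul_div_comm, one_mul, ← sq]
  have e3 : deriv (Gam γ) (S.s p) / (Gam γ (S.s p) + S.r p) ^ 2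
      = - ((γ - 1) / γ) * (S.g p * (S.h p)⁻¹ * (S.h p)⁻¹) := by
    rw [div_eq_mul_one_div, e2, deriv_Gam S.one_lt]
    have : Gam γ (S.s p) * S.g p = 1 := mul_inv_cancel₀ (Gam_pos S.one_lt _).ne'
    linear_combination (- ((γ - 1) / γ) * (S.g p * (S.h p)⁻¹ * (S.h p)⁻¹)) * this
  rw [srcH, e1, e2, e3, S.one_div_Gam_add hp]
  ring

theorem twoTier_srcH (α : Fin 4) : TwoTier (vortExp γ j - 1 / 2)
    (fun (S : LinFlow γ j M) p => - along S.u' (S.u α) p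
      - S.g p * (S.h p)⁻¹ * (along S.u S.r p * S.u' α p + S.u α p * along S.u' S.r p)
      + (∑ μ, proj S.u α μ p * pd μ S.r p) * (- ((γ - 1) / γ) * (S.g p * (S.h p)⁻¹ * (S.h p)⁻¹)
        * S.s' p + (S.g p * (S.h p)⁻¹) * (S.g p * (S.h p)⁻¹) * S.r' p)) := by
  have hur : Background (2 * j + 1 + 1) (fun (S : LinFlow γ j M) p => along S.u S.r p) :=
    .sum _ fun μ _ => BddJet.mul ((background_u μ).mono (by omega))
      (background_pd background_r (by omega) μ)
  have hgh : Background (2 * j + 1 + 2) (fun (S : LinFlow γ j M) p => S.g p * (S.h p)⁻¹) :=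
    BddJet.mul background_g background_inv_h
  have hua : Background (2 * j + 1 + 2) (fun (S : LinFlow γ j M) p => S.u α p) := background_u α
  have hP : Background (2 * j + 1 + 1) _ := background_sum_proj_pd_r (γ := γ) (M := M) α
  refine .add (.sub (twoTier_along_u' (background_u α)).neg (.coef_mul hgh (.add
    (.coef_mul hur (twoTier_u' α)) (.coef_mul hua
      (twoTier_along_u' background_r))))) (.coef_mul hP (.add (.coef_mul (m := 2) ?_ twoTier_s')
        (.coef_mul (BddJet.mul hgh hgh) twoTier_r')))
  exact (BddJet.mul hgh background_inv_h).const_mul _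

theorem LinFlow.along_split (S : LinFlow γ j M) (f : Spacetime → ℝ) (p : Spacetime) :
    along S.u f p = S.u 0 p * pd 0 f p + ∑ i : Fin 3, S.u i.succ p * pd i.succ f p := by
  rw [along, Fin.sum_univ_succ]

theorem twoTier_spatial_along {e : ℝ} {f : LinFlow γ j M → Spacetime → ℝ}
    (hf : ∀ i : Fin 3, TwoTier e (fun S p => pd i.succ (f S) p)) :
    TwoTier e (fun S p => ∑ i : Fin 3, S.u i.succ p * pd i.succ (f S) p) :=
  .sum _ fun i _ => .coef_mul (m := 2) (background_u i.succ) (hf i)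

theorem twoTier_time_s' :
    TwoTier (vortExp γ j) (fun (S : LinFlow γ j M) p => pd 0 S.s' p) := by
  have h := TwoTier.coef_mul (m := 2) background_inv_u0 (((twoTier_spatial_along
    (f := LinFlow.s') twoTier_spatial_s').add ((twoTier_along_u' (γ := γ) (j := j) (M := M)
      background_s).mono (by linarith))).neg)
  refine h.congr (smoothFamily_of_contDiff fun S => contDiff_pd S.linear.smooth_s 0)
    fun S p hp => ?_
  have h1 := S.linear.eq_s p hp
  have h2 : S.u 0 p ≠ 0 := by linarith [S.euler.one_le_zero hp]
  rw [S.along_split, srcF] at h1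
  rw [inv_mul_eq_iff_eq_mul₀ h2]
  linarith

/-- The time derivative of `r̃` is half a power of `r` better than that of `ũ`: `∂_t ũ⁰` enters it
only with a factor `r`. -/
theorem twoTier_time_r' :
    TwoTier (vortExp γ j - 1 / 2) (fun (S : LinFlow γ j M) p => pd 0 S.r' p) := by
  have hgh : Background (2 * j + 1 + 2) (fun (S : LinFlow γ j M) p => S.g p * (S.h p)⁻¹) :=
    BddJet.mul background_g background_inv_h
  have hu0 : Background (2 * j + 1 + 2) (fun (S : LinFlow γ j M) p => S.u 0 p) := background_u 0
  -- The equation for `r̃` without its time derivatives.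
  have h1 := TwoTier.coef_mul hu0 (((twoTier_srcG (γ := γ) (j := j) (M := M)).sub
    (twoTier_spatial_along (f := LinFlow.r') twoTier_spatial_r')).sub
      (twoTier_along_u' background_r))
  -- The equation for `ũ⁰` without its time derivatives.
  have h2 : TwoTier (vortExp γ j) (fun (S : LinFlow γ j M) p =>
      S.u 0 p * (∑ i : Fin 3, pd i.succ (S.u' i.succ) p)
      - ∑ i : Fin 3, S.u i.succ p * pd i.succ (S.u' 0) p
      - S.g p * (S.h p)⁻¹ * (∑ i : Fin 3, proj S.u 0 i.succ p * pd i.succ S.r' p)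
      + (- along S.u' (S.u 0) p
      - S.g p * (S.h p)⁻¹ * (along S.u S.r p * S.u' 0 p + S.u 0 p * along S.u' S.r p)
      + (∑ μ, proj S.u 0 μ p * pd μ S.r p) * (- ((γ - 1) / γ) * (S.g p * (S.h p)⁻¹ * (S.h p)⁻¹)
        * S.s' p + (S.g p * (S.h p)⁻¹) * (S.g p * (S.h p)⁻¹) * S.r' p))) :=
    .add (.sub (.sub (.coef_mul hu0 (.sum _ fun i _ => twoTier_spatial_u' i i.succ))
      (twoTier_spatial_along (f := fun S => S.u' 0) fun i => twoTier_spatial_u' i 0))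
      (.coef_mul hgh (.sum _ fun i _ => .coef_mul (m := 2) (background_proj 0 i.succ)
        ((twoTier_spatial_r' i).mono (by linarith))))) ((twoTier_srcH 0).mono (by linarith))
  have h3 := TwoTier.coef_mul (m := 2) background_inv_det (h1.sub (h2.r_mul.const_mul (γ - 1)))
  refine h3.congr (smoothFamily_of_contDiff fun S => contDiff_pd S.linear.smooth_r 0)
    fun S p hp => ?_
  have h4 : S.det p ≠ 0 := by linarith [S.half_le_det hp]
  rw [inv_mul_eq_iff_eq_mul₀ h4]
  have e1 := S.linear.eq_r p hp
  have e2 := S.linear.eq_u p hp 0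
  rw [S.srcH_eq hp, S.one_div_Gam_add hp, S.along_split,
    Fin.sum_univ_succ (n := 3) fun μ => proj S.u 0 μ p * pd μ S.r' p] at e2
  rw [S.along_split, divg, Fin.sum_univ_succ (n := 3)] at e1
  simp only [LinFlow.det]
  linear_combination -(S.u 0 p) * e1 + (γ - 1) * S.r p * e2

theorem twoTier_pd_r' (μ : Fin 4) :
    TwoTier (vortExp γ j - 1 / 2) (fun (S : LinFlow γ j M) p => pd μ S.r' p) := by
  refine Fin.cases twoTier_time_r' (fun i => twoTier_spatial_r' i) μ

theorem twoTier_pd_s' (μ : Fin 4) :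
    TwoTier (vortExp γ j) (fun (S : LinFlow γ j M) p => pd μ S.s' p) := by
  refine Fin.cases twoTier_time_s' (fun i => twoTier_spatial_s' i) μ

theorem twoTier_pd_u' (μ α : Fin 4) :
    TwoTier (vortExp γ j) (fun (S : LinFlow γ j M) p => pd μ (S.u' α) p) := by
  refine Fin.cases ?_ (fun i => twoTier_spatial_u' i α) μ
  have hgh : Background (2 * j + 1 + 2) (fun (S : LinFlow γ j M) p => S.g p * (S.h p)⁻¹) :=
    BddJet.mul background_g background_inv_h
  have h := TwoTier.coef_mul (m := 2) background_inv_u0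
    ((((twoTier_srcH (γ := γ) (j := j) (M := M) α).mono
      (by linarith : vortExp γ j - 1 / 2 ≤ vortExp γ j)).sub
      (twoTier_spatial_along (f := fun S => S.u' α) fun i => twoTier_spatial_u' i α)).sub
      (.coef_mul hgh (.sum Finset.univ fun μ _ => .coef_mul (m := 2) (background_proj α μ)
        ((twoTier_pd_r' μ).mono (by linarith)))))
  refine h.congr (smoothFamily_of_contDiff fun S => contDiff_pd (S.linear.smooth_u α) 0)
    fun S p hp => ?_
  have h1 := S.linear.eq_u p hp α
  have h2 : S.u 0 p ≠ 0 := by linarith [S.euler.one_le_zero hp]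
  rw [S.srcH_eq hp, S.one_div_Gam_add hp, S.along_split] at h1
  rw [inv_mul_eq_iff_eq_mul₀ h2]
  linarith

/-! ### The transport equation of the linearized vorticity -/

/-- The exterior derivative of the one-form `a w_β`. -/
noncomputable def curl (a : Spacetime → ℝ) (w : Fin 4 → Spacetime → ℝ) (α β : Fin 4)
    (p : Spacetime) : ℝ :=
  pd α (fun q => a q * lower w β q) p - pd β (fun q => a q * lower w α q) p

/-- The background vorticity has bounded derivatives. -/
theorem background_vort (α β : Fin 4) :
    Background (2 * j + 1 + 1) (fun (S : LinFlow γ j M) p => curl S.h S.u α β p) :=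
  ((BddJet.mul background_h (background_lower β)).pd α).sub
    ((BddJet.mul background_h (background_lower α)).pd β)

theorem contDiff_lower {w : Fin 4 → Spacetime → ℝ} (hw : ∀ μ, ContDiff ℝ (⊤ : ℕ∞) (w μ))
    (β : Fin 4) : ContDiff ℝ (⊤ : ℕ∞) (lower w β) :=
  ContDiff.sum fun μ _ => contDiff_const.mul (hw μ)

theorem contDiff_curl {a : Spacetime → ℝ} {w : Fin 4 → Spacetime → ℝ}
    (ha : ContDiff ℝ (⊤ : ℕ∞) a) (hw : ∀ μ, ContDiff ℝ (⊤ : ℕ∞) (w μ)) (α β : Fin 4) :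
    ContDiff ℝ (⊤ : ℕ∞) (curl a w α β) :=
  (contDiff_pd (ha.mul (contDiff_lower hw β)) α).sub (contDiff_pd (ha.mul (contDiff_lower hw α)) β)

theorem contDiff_differentiableAt {f : Spacetime → ℝ} (hf : ContDiff ℝ (⊤ : ℕ∞) f)
    (p : Spacetime) : DifferentiableAt ℝ f p := hf.contDiffAt.differentiableAt (by simp)

theorem along_lower {w : Fin 4 → Spacetime → ℝ} (hw : ∀ μ, ContDiff ℝ (⊤ : ℕ∞) (w μ))
    (v : Fin 4 → Spacetime → ℝ) (β : Fin 4) (p : Spacetime) :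
    along v (lower w β) p = ∑ α, mink β α * along v (w α) p := by
  have h : ∀ μ, pd μ (lower w β) p = ∑ α, mink β α * pd μ (w α) p := by
    intro μ
    unfold lower
    rw [pd_sum _ fun α _ => (contDiff_differentiableAt (hw α) p).const_mul _]
    exact Finset.sum_congr rfl fun α _ => pd_const_mul (contDiff_differentiableAt (hw α) p) _ _
  unfold along
  simp only [h, Finset.mul_sum]
  rw [Finset.sum_comm]
  exact Finset.sum_congr rfl fun α _ => Finset.sum_congr rfl fun μ _ => by ring

theorem sum_mink_proj (u : Fin 4 → Spacetime → ℝ) (x : Fin 4 → ℝ) (β : Fin 4) (p : Spacetime) :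
    ∑ α, mink β α * ∑ μ, proj u α μ p * x μ = x β + lower u β p * ∑ μ, u μ p * x μ := by
  simp only [lower, proj, mink, Fin.sum_univ_four]
  fin_cases β <;> simp <;> ring

/-- The contraction of a curl with a vector field. -/
theorem sum_mul_curl {a : Spacetime → ℝ} {w : Fin 4 → Spacetime → ℝ}
    (ha : ContDiff ℝ (⊤ : ℕ∞) a) (hw : ∀ μ, ContDiff ℝ (⊤ : ℕ∞) (w μ))
    (v : Fin 4 → Spacetime → ℝ) (β : Fin 4) (p : Spacetime) :
    ∑ α, v α p * curl a w α β p
      = along v a p * lower w β p + a p * along v (lower w β) p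
        - pd β a p * (∑ α, v α p * lower w α p) - a p * ∑ α, v α p * pd β (lower w α) p := by
  have h : ∀ α β, pd α (fun q => a q * lower w β q) p
      = pd α a p * lower w β p + a p * pd α (lower w β) p := fun α β =>
    pd_mul (contDiff_differentiableAt ha p) (contDiff_differentiableAt (contDiff_lower hw β) p) α
  unfold curl along
  simp only [h, Finset.sum_mul, Finset.mul_sum, ← Finset.sum_add_distrib,
    ← Finset.sum_sub_distrib]
  exact Finset.sum_congr rfl fun α _ => by ring

theorem sum_mul_lower_comm (v w : Fin 4 → Spacetime → ℝ) (p : Spacetime) :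
    ∑ α, v α p * lower w α p = ∑ α, w α p * lower v α p := by
  simp only [lower, mink, Fin.sum_univ_four]
  simp
  ring

/-- The linearized enthalpy `h̃` in terms of `1 / Γ(s)`. -/
noncomputable def LinFlow.h' (S : LinFlow γ j M) (p : Spacetime) : ℝ :=
  S.g p * S.r' p + (γ - 1) / γ * (S.g p * (S.r p * S.s' p))

theorem LinFlow.enthalpy_eq (S : LinFlow γ j M) : enthalpy γ S.s S.r = S.h := by
  ext p
  have := (Gam_pos S.one_lt (S.s p)).ne'
  unfold enthalpy LinFlow.h LinFlow.g
  field_simp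

theorem LinFlow.linEnthalpy_eq (S : LinFlow γ j M) : linEnthalpy γ S.s S.r S.s' S.r' = S.h' := by
  ext p
  have := (Gam_pos S.one_lt (S.s p)).ne'
  unfold linEnthalpy LinFlow.h' LinFlow.g
  rw [deriv_Gam S.one_lt]
  field_simp
  ring

theorem LinFlow.contDiff_h' (S : LinFlow γ j M) : ContDiff ℝ (⊤ : ℕ∞) S.h' :=
  (S.contDiff_g.mul S.linear.smooth_r).add (contDiff_const.mul
    (S.contDiff_g.mul (S.euler.smooth_r.mul S.linear.smooth_s)))

theorem LinFlow.pd_h' (S : LinFlow γ j M) (μ : Fin 4) (p : Spacetime) :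
    pd μ S.h' p = (γ - 1) / γ * S.h' p * pd μ S.s p + S.g p * pd μ S.r' p
      + (γ - 1) / γ * S.g p * (pd μ S.r p * S.s' p + S.r p * pd μ S.s' p) := by
  have hg := contDiff_differentiableAt S.contDiff_g p
  have hr := contDiff_differentiableAt S.euler.smooth_r p
  have hr' := contDiff_differentiableAt S.linear.smooth_r p
  have hs' := contDiff_differentiableAt S.linear.smooth_s p
  have e : pd μ S.h' p = pd μ (fun q => S.g q * S.r' q
      + (γ - 1) / γ * (S.g q * (S.r q * S.s' q))) p := rfl
  rw [e, pd_add (hg.fun_mul hr') ((hg.fun_mul (hr.fun_mul hs')).const_mul _), pd_mul hg hr',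
    pd_const_mul (hg.fun_mul (hr.fun_mul hs')), pd_mul hg (hr.fun_mul hs'), pd_mul hr hs', S.pd_g]
  unfold LinFlow.h'
  ring

/-- The full linearized vorticity of a flow. -/
noncomputable def LinFlow.linVort (S : LinFlow γ j M) : Fin 4 → Fin 4 → Spacetime → ℝ :=
  linVorticity γ S.s S.r S.u S.s' S.r' S.u'

theorem LinFlow.redVorticity_eq (S : LinFlow γ j M) (α β : Fin 4) :
    redVorticity γ S.s S.r S.u' α β = curl S.h S.u' α β := by
  rw [← S.enthalpy_eq]
  rfl

theorem LinFlow.linVort_eq (S : LinFlow γ j M) (α β : Fin 4) :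
    S.linVort α β = fun p => curl S.h S.u' α β p + curl S.h' S.u α β p := by
  rw [← S.enthalpy_eq, ← S.linEnthalpy_eq]
  rfl

theorem LinFlow.contDiff_linVort (S : LinFlow γ j M) (α β : Fin 4) :
    ContDiff ℝ (⊤ : ℕ∞) (S.linVort α β) := by
  rw [S.linVort_eq]
  exact (contDiff_curl S.contDiff_h S.linear.smooth_u α β).add
    (contDiff_curl S.contDiff_h' S.euler.smooth_u α β)

theorem LinFlow.along_h (S : LinFlow γ j M) (v : Fin 4 → Spacetime → ℝ) (p : Spacetime) :
    along v S.h p = (γ - 1) / γ * S.g p * S.r p * along v S.s p + S.g p * along v S.r p := by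
  unfold along
  simp only [S.pd_h, Finset.mul_sum, ← Finset.sum_add_distrib]
  exact Finset.sum_congr rfl fun μ _ => by ring

theorem LinFlow.along_h' (S : LinFlow γ j M) (v : Fin 4 → Spacetime → ℝ) (p : Spacetime) :
    along v S.h' p = (γ - 1) / γ * S.h' p * along v S.s p + S.g p * along v S.r' p
      + (γ - 1) / γ * S.g p * (along v S.r p * S.s' p + S.r p * along v S.s' p) := by
  unfold along
  simp only [S.pd_h', Finset.mul_sum, Finset.sum_mul, ← Finset.sum_add_distrib]
  exact Finset.sum_congr rfl fun μ _ => by ring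

theorem LinFlow.along_lower_u (S : LinFlow γ j M) {p : Spacetime}
    (hp : p ∈ (flowDomain γ j M).carrier S) (β : Fin 4) :
    along S.u (lower S.u β) p
      = - (S.g p * (S.h p)⁻¹) * (pd β S.r p + lower S.u β p * along S.u S.r p) := by
  have h : ∀ α, along S.u (S.u α) p
      = - (S.g p * (S.h p)⁻¹) * ∑ μ, proj S.u α μ p * pd μ S.r p := by
    intro α
    have := S.euler.eq_u p hp α
    rw [S.one_div_Gam_add hp] at this
    linarith
  rw [along_lower S.euler.smooth_u]
  simp only [h, mul_left_comm _ (-(S.g p * (S.h p)⁻¹))]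
  rw [← Finset.mul_sum, sum_mink_proj S.u fun μ => pd μ S.r p]
  rfl

theorem LinFlow.along_lower_u' (S : LinFlow γ j M) {p : Spacetime}
    (hp : p ∈ (flowDomain γ j M).carrier S) (β : Fin 4) :
    along S.u (lower S.u' β) p = - along S.u' (lower S.u β) p
      - S.g p * (S.h p)⁻¹ * (pd β S.r' p + lower S.u β p * along S.u S.r' p)
      - S.g p * (S.h p)⁻¹ * (along S.u S.r p * lower S.u' β p
        + lower S.u β p * along S.u' S.r p)
      + (pd β S.r p + lower S.u β p * along S.u S.r p)
        * (- ((γ - 1) / γ) * (S.g p * (S.h p)⁻¹ * (S.h p)⁻¹) * S.s' p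
          + (S.g p * (S.h p)⁻¹) * (S.g p * (S.h p)⁻¹) * S.r' p) := by
  set κ := - ((γ - 1) / γ) * (S.g p * (S.h p)⁻¹ * (S.h p)⁻¹) * S.s' p
          + (S.g p * (S.h p)⁻¹) * (S.g p * (S.h p)⁻¹) * S.r' p with hκ
  have h : ∀ α, mink β α * along S.u (S.u' α) p
      = - (mink β α * along S.u' (S.u α) p)
        - S.g p * (S.h p)⁻¹ * (mink β α * ∑ μ, proj S.u α μ p * pd μ S.r' p)
        - S.g p * (S.h p)⁻¹ * (along S.u S.r p * (mink β α * S.u' α p)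
          + (mink β α * S.u α p) * along S.u' S.r p)
        + κ * (mink β α * ∑ μ, proj S.u α μ p * pd μ S.r p) := by
    intro α
    have := S.linear.eq_u p hp α
    rw [S.one_div_Gam_add hp, S.srcH_eq hp] at this
    rw [hκ]
    linear_combination mink β α * this
  have e1 := sum_mink_proj S.u (fun μ => pd μ S.r' p) β p
  have e2 := sum_mink_proj S.u (fun μ => pd μ S.r p) β p
  rw [along_lower S.linear.smooth_u, along_lower S.euler.smooth_u, Finset.sum_congr rfl
    fun α _ => h α, Finset.sum_add_distrib, Finset.sum_sub_distrib, Finset.sum_sub_distrib,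
    Finset.sum_neg_distrib, ← Finset.mul_sum, ← Finset.mul_sum, ← Finset.mul_sum,
    Finset.sum_add_distrib, ← Finset.mul_sum, ← Finset.sum_mul, e1, e2]
  simp only [along, lower]
  ring

/-- A constant contraction of two fields has vanishing derivatives on the domain. -/
theorem LinFlow.sum_pd_lower (S : LinFlow γ j M) {p : Spacetime}
    (hp : p ∈ (flowDomain γ j M).carrier S) {v w : Fin 4 → Spacetime → ℝ}
    (hv : ∀ μ, ContDiff ℝ (⊤ : ℕ∞) (v μ)) (hw : ∀ μ, ContDiff ℝ (⊤ : ℕ∞) (w μ)) {c : ℝ}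
    (h : ∀ q ∈ (flowDomain γ j M).carrier S, ∑ α, v α q * lower w α q = c) (β : Fin 4) :
    (∑ α, v α p * pd β (lower w α) p) + ∑ α, w α p * pd β (lower v α) p = 0 := by
  have hl : ∀ α, DifferentiableAt ℝ (lower w α) p := fun α =>
    contDiff_differentiableAt (contDiff_lower hw α) p
  have hv' : ∀ α, DifferentiableAt ℝ (v α) p := fun α => contDiff_differentiableAt (hv α) p
  have hd : DifferentiableAt ℝ (fun q => ∑ α, v α q * lower w α q) p :=
    DifferentiableAt.fun_sum fun α _ => (hv' α).fun_mul (hl α)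
  have h1 := pd_congr ((flowDomain γ j M).uniqueDiffOn S) hp hd (differentiableAt_const c) h β
  rw [pd_const, pd_sum _ fun α _ => (hv' α).fun_mul (hl α)] at h1
  rw [← h1, ← Finset.sum_add_distrib]
  simp only [pd_mul (hv' _) (hl _)]
  have hlow : ∀ {y : Fin 4 → Spacetime → ℝ}, (∀ μ, ContDiff ℝ (⊤ : ℕ∞) (y μ)) → ∀ α,
      pd β (lower y α) p = ∑ μ, mink α μ * pd β (y μ) p := by
    intro y hy α
    unfold lower
    rw [pd_sum _ fun μ _ => (contDiff_differentiableAt (hy μ) p).const_mul _]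
    exact Finset.sum_congr rfl fun μ _ => pd_const_mul (contDiff_differentiableAt (hy μ) p) _ _
  simp only [hlow hv, hlow hw, lower, mink, Fin.sum_univ_four]
  simp
  ring

theorem LinFlow.sum_u_lower_u (S : LinFlow γ j M) {p : Spacetime}
    (hp : p ∈ (flowDomain γ j M).carrier S) : ∑ α, S.u α p * lower S.u α p = -1 := by
  rw [← S.euler.normalized p hp]
  exact Finset.sum_congr rfl fun α _ => mul_comm _ _

theorem LinFlow.sum_u_lower_u' (S : LinFlow γ j M) {p : Spacetime}
    (hp : p ∈ (flowDomain γ j M).carrier S) : ∑ α, S.u α p * lower S.u' α p = 0 := by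
  rw [← S.linear.orthogonal p hp]
  exact Finset.sum_congr rfl fun α _ => mul_comm _ _

/-- The contraction of the linearized vorticity with the velocity. -/
noncomputable def LinFlow.contracted (S : LinFlow γ j M) (β : Fin 4) (p : Spacetime) : ℝ :=
  (γ - 1) / γ * (S.h' p * pd β S.s p + (S.h p - 1) * pd β S.s' p)
    - ∑ α, S.u' α p * curl S.h S.u α β p

/-- The linearization of the identity `u^α ω_{αβ} = θ ∂_β s`, `θ = ((γ - 1) / γ) r / Γ(s)`, which
expresses the momentum equation through the vorticity. Note that `h - 1 = r / Γ(s)`. -/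
theorem LinFlow.sum_u_linVort (S : LinFlow γ j M) {p : Spacetime}
    (hp : p ∈ (flowDomain γ j M).carrier S) (β : Fin 4) :
    ∑ α, S.u α p * S.linVort α β p = S.contracted β p := by
  have hh : S.h p * (S.h p)⁻¹ = 1 := mul_inv_cancel₀ (by linarith [S.one_le_h hp])
  have hu := S.euler.smooth_u
  have hu' := S.linear.smooth_u
  have c1 := sum_mul_curl S.contDiff_h hu' S.u β p
  have c2 := sum_mul_curl S.contDiff_h' hu S.u β p
  have c3 := sum_mul_curl S.contDiff_h hu S.u' β p
  have n1 := S.sum_u_lower_u hp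
  have n2 := S.sum_u_lower_u' hp
  have n3 := (sum_mul_lower_comm S.u' S.u p).trans n2
  have d1 := S.sum_pd_lower hp hu hu (fun q hq => S.sum_u_lower_u hq) β
  have d2 := S.sum_pd_lower hp hu hu' (fun q hq => S.sum_u_lower_u' hq) β
  have d1' : ∑ α, S.u α p * pd β (lower S.u α) p = 0 := by linarith
  rw [n2, S.along_lower_u' hp, S.along_h] at c1
  rw [n1, d1', S.along_lower_u hp, S.along_h', S.pd_h'] at c2
  rw [n3, S.along_h] at c3
  have es := S.euler.eq_s p hp
  have es' := S.linear.eq_s p hp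
  rw [srcF] at es'
  rw [es] at c1 c2
  rw [es'] at c2
  simp only [S.linVort_eq, mul_add, Finset.sum_add_distrib]
  rw [LinFlow.contracted, c1, c2, c3]
  have eh : S.h p = 1 + S.g p * S.r p := rfl
  have eh' : S.h' p = S.g p * S.r' p + (γ - 1) / γ * (S.g p * (S.r p * S.s' p)) := rfl
  rw [eh] at hh ⊢
  rw [eh']
  generalize (1 + S.g p * S.r p)⁻¹ = i at hh ⊢
  linear_combination (-S.g p * (pd β S.r' p + lower S.u β p * along S.u S.r' p)
    - S.g p * (along S.u S.r p * lower S.u' β p + lower S.u β p * along S.u' S.r p)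
    + (pd β S.r p + lower S.u β p * along S.u S.r p) * ((-((γ - 1) / γ) * S.g p * S.s' p
      + S.g p * S.g p * S.r' p) * i - (γ - 1) / γ * S.g p * S.s' p)) * hh
    - (1 + S.g p * S.r p) * d2

/-- A curl is closed. -/
theorem pd_curl_cyclic {a : Spacetime → ℝ} {w : Fin 4 → Spacetime → ℝ}
    (ha : ContDiff ℝ (⊤ : ℕ∞) a) (hw : ∀ μ, ContDiff ℝ (⊤ : ℕ∞) (w μ)) (μ α β : Fin 4)
    (p : Spacetime) :
    pd μ (curl a w α β) p = pd α (curl a w μ β) p - pd β (curl a w μ α) p := by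
  have h : ∀ β, ContDiff ℝ (⊤ : ℕ∞) (fun q => a q * lower w β q) := fun β =>
    ha.mul (contDiff_lower hw β)
  have hd : ∀ α β, DifferentiableAt ℝ (pd α fun q => a q * lower w β q) p := fun α β =>
    contDiff_differentiableAt (contDiff_pd (h β) α) p
  have e : ∀ μ α β, pd μ (curl a w α β) p = pd μ (pd α fun q => a q * lower w β q) p
      - pd μ (pd β fun q => a q * lower w α q) p := fun μ α β => pd_sub (hd α β) (hd β α) μ
  rw [e, e, e, pd_comm (h β).contDiffAt μ α, pd_comm (h α).contDiffAt μ β,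
    pd_comm (h μ).contDiffAt α β]
  ring

theorem LinFlow.pd_linVort_cyclic (S : LinFlow γ j M) (μ α β : Fin 4) (p : Spacetime) :
    pd μ (S.linVort α β) p = pd α (S.linVort μ β) p - pd β (S.linVort μ α) p := by
  have h1 : ∀ α β, DifferentiableAt ℝ (curl S.h S.u' α β) p := fun α β =>
    contDiff_differentiableAt (contDiff_curl S.contDiff_h S.linear.smooth_u α β) p
  have h2 : ∀ α β, DifferentiableAt ℝ (curl S.h' S.u α β) p := fun α β =>
    contDiff_differentiableAt (contDiff_curl S.contDiff_h' S.euler.smooth_u α β) p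
  simp only [S.linVort_eq, pd_add (h1 _ _) (h2 _ _)]
  rw [pd_curl_cyclic S.contDiff_h S.linear.smooth_u, pd_curl_cyclic S.contDiff_h' S.euler.smooth_u]
  ring

theorem LinFlow.contDiff_contracted (S : LinFlow γ j M) (β : Fin 4) :
    ContDiff ℝ (⊤ : ℕ∞) (S.contracted β) := by
  unfold LinFlow.contracted
  exact (contDiff_const.mul ((S.contDiff_h'.mul (contDiff_pd S.euler.smooth_s β)).add
    ((S.contDiff_h.sub contDiff_const).mul (contDiff_pd S.linear.smooth_s β)))).sub
    (ContDiff.sum fun α _ => (S.linear.smooth_u α).mul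
      (contDiff_curl S.contDiff_h S.euler.smooth_u α β))

theorem LinFlow.pd_contracted (S : LinFlow γ j M) (α β : Fin 4) (p : Spacetime) :
    pd α (S.contracted β) p = (γ - 1) / γ * (pd α S.h' p * pd β S.s p
      + S.h' p * pd α (pd β S.s) p + pd α S.h p * pd β S.s' p
      + (S.h p - 1) * pd α (pd β S.s') p)
      - ∑ μ, (pd α (S.u' μ) p * curl S.h S.u μ β p
        + S.u' μ p * pd α (curl S.h S.u μ β) p) := by
  have hh := contDiff_differentiableAt S.contDiff_h p
  have hh' := contDiff_differentiableAt S.contDiff_h' p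
  have hs := contDiff_differentiableAt (contDiff_pd S.euler.smooth_s β) p
  have hs' := contDiff_differentiableAt (contDiff_pd S.linear.smooth_s β) p
  have hu' := fun μ => contDiff_differentiableAt (S.linear.smooth_u μ) p
  have hc := fun μ => contDiff_differentiableAt
    (contDiff_curl S.contDiff_h S.euler.smooth_u μ β) p
  have h1 := hh'.fun_mul hs
  have h2 := (hh.sub_const 1).fun_mul hs'
  have h3 := fun μ => (hu' μ).fun_mul (hc μ)
  change pd α (fun q => (γ - 1) / γ * (S.h' q * pd β S.s q + (S.h q - 1) * pd β S.s' q)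
    - ∑ μ, S.u' μ q * curl S.h S.u μ β q) p = _
  rw [pd_sub ((h1.fun_add h2).const_mul _) (DifferentiableAt.fun_sum fun μ _ => h3 μ),
    pd_const_mul (h1.fun_add h2), pd_add h1 h2, pd_mul hh' hs, pd_mul (hh.sub_const 1) hs',
    pd_sub hh (differentiableAt_const _), pd_const, pd_sum _ fun μ _ => h3 μ]
  simp only [pd_mul (hu' _) (hc _)]
  ring

/-- The right-hand side of the transport equation of the linearized vorticity; the second
derivatives of `s̃` have cancelled. -/
noncomputable def LinFlow.vortSource (S : LinFlow γ j M) (α β : Fin 4) (p : Spacetime) : ℝ :=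
  (γ - 1) / γ * ((pd β S.s p * pd α S.h' p - pd α S.s p * pd β S.h' p)
      + (pd α S.h p * pd β S.s' p - pd β S.h p * pd α S.s' p))
    - (∑ μ, (curl S.h S.u μ β p * pd α (S.u' μ) p + pd α (curl S.h S.u μ β) p * S.u' μ p)
      - ∑ μ, (curl S.h S.u μ α p * pd β (S.u' μ) p + pd β (curl S.h S.u μ α) p * S.u' μ p))
    - (∑ μ, pd α (S.u μ) p * S.linVort μ β p - ∑ μ, pd β (S.u μ) p * S.linVort μ α p)

theorem LinFlow.along_linVort (S : LinFlow γ j M) {p : Spacetime}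
    (hp : p ∈ (flowDomain γ j M).carrier S) (α β : Fin 4) :
    along S.u (S.linVort α β) p = S.vortSource α β p := by
  have hu := fun μ => contDiff_differentiableAt (S.euler.smooth_u μ) p
  have hv := fun α β => contDiff_differentiableAt (S.contDiff_linVort α β) p
  have key : ∀ α β, (∑ μ, pd α (S.u μ) p * S.linVort μ β p)
      + ∑ μ, S.u μ p * pd α (S.linVort μ β) p = pd α (S.contracted β) p := by
    intro α β
    rw [← pd_congr ((flowDomain γ j M).uniqueDiffOn S) hp
      (DifferentiableAt.fun_sum fun μ _ => (hu μ).fun_mul (hv μ β))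
      (contDiff_differentiableAt (S.contDiff_contracted β) p)
      (fun q hq => S.sum_u_linVort hq β) α, pd_sum _ fun μ _ => (hu μ).fun_mul (hv μ β),
      ← Finset.sum_add_distrib]
    simp only [pd_mul (hu _) (hv _ _)]
  have k1 := key α β
  have k2 := key β α
  have e : along S.u (S.linVort α β) p = (∑ μ, S.u μ p * pd α (S.linVort μ β) p)
      - ∑ μ, S.u μ p * pd β (S.linVort μ α) p := by
    rw [along, ← Finset.sum_sub_distrib]
    refine Finset.sum_congr rfl fun μ _ => ?_
    rw [S.pd_linVort_cyclic μ α β]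
    ring
  have c1 := pd_comm (S.euler.smooth_s.contDiffAt (x := p)) α β
  have c2 := pd_comm (S.linear.smooth_s.contDiffAt (x := p)) α β
  rw [S.pd_contracted, c1, c2] at k1
  rw [S.pd_contracted] at k2
  rw [e, LinFlow.vortSource]
  simp only [mul_comm (curl _ _ _ _ p), mul_comm (pd _ (curl _ _ _ _) p)]
  linear_combination k1 - k2

/-! ### Weighted bounds for the vorticities -/

theorem TwoTier.pd_mul {e : ℝ} {c f : LinFlow γ j M → Spacetime → ℝ}
    (hc : Background (2 * j + 3) c) (hf : TwoTier e f) (μ : Fin 4)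
    (hf' : TwoTier e (fun S p => pd μ (f S) p)) :
    TwoTier e (fun S p => pd μ (fun q => c S q * f S q) p) := by
  have h1 : Background (2 * j + 1 + 1) (fun S p => pd μ (c S) p) := background_pd hc (by omega) μ
  refine ((TwoTier.coef_mul h1 hf).add (.coef_mul (m := 2) hc hf')).congr
    ((hc.smooth.mul hf.smooth).pd μ) fun S p hp => ?_
  rw [RelEuler.pd_mul (hc.smooth.differentiableAt hp) (hf.smooth.differentiableAt hp)]

theorem twoTier_lower_u' (β : Fin 4) :
    TwoTier (vortExp γ j - 1 / 2) (fun (S : LinFlow γ j M) p => lower S.u' β p) :=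
  .sum _ fun μ _ => (twoTier_u' μ).const_mul _

theorem twoTier_pd_lower_u' (μ β : Fin 4) :
    TwoTier (vortExp γ j) (fun (S : LinFlow γ j M) p => pd μ (lower S.u' β) p) := by
  refine (TwoTier.sum Finset.univ fun α _ => (twoTier_pd_u' μ α).const_mul (mink β α)).congr
    (smoothFamily_of_contDiff fun S => contDiff_pd (contDiff_lower S.linear.smooth_u β) μ)
    fun S p _ => ?_
  unfold lower
  rw [pd_sum _ fun α _ => (contDiff_differentiableAt (S.linear.smooth_u α) p).const_mul _]
  exact Finset.sum_congr rfl fun α _ =>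
    (pd_const_mul (contDiff_differentiableAt (S.linear.smooth_u α) p) _ _).symm

theorem twoTier_redVorticity (α β : Fin 4) :
    TwoTier (vortExp γ j) (fun (S : LinFlow γ j M) p => curl S.h S.u' α β p) :=
  (TwoTier.pd_mul background_h ((twoTier_lower_u' β).mono (by linarith)) α
    (twoTier_pd_lower_u' α β)).sub
  (TwoTier.pd_mul background_h ((twoTier_lower_u' α).mono (by linarith)) β
    (twoTier_pd_lower_u' β α))

theorem twoTier_h' : TwoTier (vortExp γ j - 1 / 2) (fun (S : LinFlow γ j M) p => S.h' p) :=
  (TwoTier.coef_mul (m := 2) background_g twoTier_r').add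
    ((TwoTier.coef_mul (m := 2) background_g
      (.coef_mul (m := 2) background_r twoTier_s')).const_mul _)

theorem twoTier_pd_h' (μ : Fin 4) :
    TwoTier (vortExp γ j - 1 / 2) (fun (S : LinFlow γ j M) p => pd μ S.h' p) := by
  have hs : Background (2 * j + 1 + 1) (fun (S : LinFlow γ j M) p => (γ - 1) / γ * pd μ S.s p) :=
    (background_pd background_s (by omega) μ).const_mul _
  have hr : Background (2 * j + 1 + 1) (fun (S : LinFlow γ j M) p => pd μ S.r p) :=
    background_pd background_r (by omega) μ
  refine (((TwoTier.coef_mul hs twoTier_h').add (.coef_mul (m := 2) background_g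
    (twoTier_pd_r' μ))).add (.const_mul ((γ - 1) / γ) (.coef_mul (m := 2) background_g
      (.add (.coef_mul hr twoTier_s') (twoTier_pd_s' μ).r_mul)))).congr
    (smoothFamily_of_contDiff fun S => contDiff_pd S.contDiff_h' μ) fun S p _ => ?_
  rw [S.pd_h']
  ring

/-- The difference of the full and the reduced linearized vorticity is half a power of `r` better
than the vorticities. -/
theorem twoTier_vorticity_correction (α β : Fin 4) :
    TwoTier (vortExp γ j - 1 / 2) (fun (S : LinFlow γ j M) p => curl S.h' S.u α β p) := by
  have h := fun (α β : Fin 4) => TwoTier.pd_mul (background_lower (γ := γ) (j := j) (M := M) β)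
    twoTier_h' α (twoTier_pd_h' α)
  simp only [mul_comm (lower _ _ _)] at h
  exact (h α β).sub (h β α)

theorem twoTier_linVort (α β : Fin 4) :
    TwoTier (vortExp γ j) (fun (S : LinFlow γ j M) p => S.linVort α β p) := by
  simp only [LinFlow.linVort_eq]
  exact (twoTier_redVorticity α β).add ((twoTier_vorticity_correction α β).mono (by linarith))

theorem twoTier_vortSource (α β : Fin 4) :
    TwoTier (vortExp γ j) (fun (S : LinFlow γ j M) p => S.vortSource α β p) := by
  have hσ : vortExp γ j - 1 / 2 ≤ vortExp γ j := by linarith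
  have hs := fun μ => (background_pd background_s (by omega) μ :
    Background (2 * j + 1 + 1) (fun (S : LinFlow γ j M) p => pd μ S.s p))
  have hh := fun μ => (background_pd background_h (by omega) μ :
    Background (2 * j + 1 + 1) (fun (S : LinFlow γ j M) p => pd μ S.h p))
  have hu := fun μ ν => (background_pd (background_u ν) (by omega) μ :
    Background (2 * j + 1 + 1) (fun (S : LinFlow γ j M) p => pd μ (S.u ν) p))
  have hdw := fun κ μ ν => (background_pd (background_vort μ ν) (by omega) κ :
    Background (2 * j + 1 + 0) (fun (S : LinFlow γ j M) p => pd κ (curl S.h S.u μ ν) p))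
  have h1 := fun α β => TwoTier.coef_mul (hs β)
    ((twoTier_pd_h' (γ := γ) (j := j) (M := M) α).mono hσ)
  have h2 := fun α β => TwoTier.coef_mul (hh α) (twoTier_pd_s' (γ := γ) (j := j) (M := M) β)
  have h3 := fun α β => TwoTier.sum Finset.univ fun μ _ =>
    (TwoTier.coef_mul (background_vort μ β) (twoTier_pd_u' (γ := γ) (j := j) (M := M) α μ)).add
      (.coef_mul (hdw α μ β) ((twoTier_u' μ).mono hσ))
  have h4 := fun α β => TwoTier.sum Finset.univ fun μ _ =>
    TwoTier.coef_mul (hu α μ) (twoTier_linVort (γ := γ) (j := j) (M := M) μ β)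
  exact (((((h1 α β).sub (h1 β α)).add ((h2 α β).sub (h2 β α))).const_mul _).sub
    ((h3 α β).sub (h3 β α))).sub ((h4 α β).sub (h4 β α))

/-! ### Transport of the derivatives of the vorticity -/

/-- The coordinate velocity `u^i / u⁰`. -/
noncomputable def LinFlow.vel (i : Fin 3) (S : LinFlow γ j M) (p : Spacetime) : ℝ :=
  S.u i.succ p * (S.u 0 p)⁻¹

theorem background_vel (i : Fin 3) :
    Background (2 * j + 3) (LinFlow.vel i : LinFlow γ j M → Spacetime → ℝ) :=
  BddJet.mul (background_u i.succ) background_inv_u0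

/-- The convective derivative normalized to `∂_t + (u^i / u⁰) ∂_i`. Its commutators with spatial
derivatives contain no time derivatives. -/
noncomputable def LinFlow.mat (S : LinFlow γ j M) (f : Spacetime → ℝ) (p : Spacetime) : ℝ :=
  pd 0 f p + ∑ i : Fin 3, S.vel i p * pd i.succ f p

theorem LinFlow.along_eq_mat (S : LinFlow γ j M) {p : Spacetime}
    (hp : p ∈ (flowDomain γ j M).carrier S) (f : Spacetime → ℝ) :
    along S.u f p = S.u 0 p * S.mat f p := by
  have h0 : S.u 0 p ≠ 0 := by linarith [S.euler.one_le_zero hp]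
  rw [S.along_split, LinFlow.mat, mul_add, Finset.mul_sum]
  congr 1
  refine Finset.sum_congr rfl fun i _ => ?_
  unfold LinFlow.vel
  field_simp

theorem smoothFamily_mat {f : LinFlow γ j M → Spacetime → ℝ}
    (hf : ∀ S, ContDiff ℝ (⊤ : ℕ∞) (f S)) :
    SmoothFamily (flowDomain γ j M) (fun S p => S.mat (f S) p) := fun S p hp =>
  (contDiff_pd (hf S) 0).contDiffAt.add (ContDiffAt.sum fun i _ =>
    ((background_vel i).smooth S p hp).mul (contDiff_pd (hf S) i.succ).contDiffAt)

/-- The family `f` and its convective derivative are bounded together with their spatial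
derivatives of order at most `m`. -/
def TransportBound (m : ℕ) (f : LinFlow γ j M → Spacetime → ℝ) : Prop :=
  m ≤ 2 * j + 1 ∧ (∀ S, ContDiff ℝ (⊤ : ℕ∞) (f S)) ∧ WBound (vortExp γ j) m f ∧
    WBound (vortExp γ j) m (fun S p => S.mat (f S) p)

theorem TransportBound.pd {m : ℕ} {f : LinFlow γ j M → Spacetime → ℝ} (i : Fin 3)
    (hf : TransportBound (m + 1) f) : TransportBound m (fun S => pd i.succ (f S)) := by
  obtain ⟨hm, hs, h1, h2⟩ := hf
  refine ⟨by omega, fun S => contDiff_pd (hs S) _, h1.pd i, ?_⟩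
  have h3 : WBound (vortExp γ j) m (fun S p => ∑ l : Fin 3,
      RelEuler.pd i.succ (S.vel l) p * RelEuler.pd l.succ (f S) p) :=
    .sum _ fun l _ => Background.mul (background_pd (background_vel l) (by omega) i.succ) (h1.pd l)
  refine ((h2.pd i).sub h3).congr (smoothFamily_mat fun S => contDiff_pd (hs S) _) fun S p hp => ?_
  have hd := fun μ => contDiff_differentiableAt (contDiff_pd (hs S) μ) p
  have hv := fun l => (background_vel (γ := γ) (j := j) (M := M) l).smooth.differentiableAt hp
  have e : RelEuler.pd i.succ (fun q => S.mat (f S) q) p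
      = RelEuler.pd i.succ (RelEuler.pd 0 (f S)) p + ∑ l : Fin 3,
        (RelEuler.pd i.succ (S.vel l) p * RelEuler.pd l.succ (f S) p
          + S.vel l p * RelEuler.pd i.succ (RelEuler.pd l.succ (f S)) p) := by
    unfold LinFlow.mat
    rw [pd_add (hd 0) (DifferentiableAt.fun_sum fun l _ => (hv l).fun_mul (hd l.succ)),
      pd_sum _ fun l _ => (hv l).fun_mul (hd l.succ)]
    simp only [RelEuler.pd_mul (hv _) (hd _)]
  rw [e, LinFlow.mat, Finset.sum_add_distrib, pd_comm (hs S).contDiffAt i.succ 0]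
  simp only [pd_comm (hs S).contDiffAt i.succ]
  ring

theorem transportBound_linVort (α β : Fin 4) :
    TransportBound (2 * j + 1) (fun (S : LinFlow γ j M) => S.linVort α β) := by
  refine ⟨le_rfl, fun S => S.contDiff_linVort α β, (twoTier_linVort α β).1, ?_⟩
  refine (Background.mul (background_inv_u0.mono (by omega)) (twoTier_vortSource α β).1).congr
    (smoothFamily_mat fun S => S.contDiff_linVort α β) fun S p hp => ?_
  have h0 : S.u 0 p ≠ 0 := by linarith [S.euler.one_le_zero hp]
  rw [inv_mul_eq_iff_eq_mul₀ h0, ← S.along_linVort hp, S.along_eq_mat hp]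

theorem transportBound_spatialD_linVort (α β : Fin 4) {δ : Fin 3 → ℕ}
    (hδ : ∑ i, δ i ≤ 2 * j + 1) :
    TransportBound 0 (fun (S : LinFlow γ j M) => spatialD δ (S.linVort α β)) := by
  obtain ⟨_, hs, h1, h2⟩ := transportBound_linVort (γ := γ) (j := j) (M := M) α β
  refine spatialD_induction (P := fun m f => TransportBound m f) (m := 0)
    (fun _ _ i h => h.pd i) δ ⟨by omega, hs, h1.mono (by omega), h2.mono (by omega)⟩

theorem LinFlow.half_lt_vortExp (S : LinFlow γ j M) : 1 / 2 < vortExp γ j := by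
  have h1 : 0 < γ - 1 := by linarith [S.one_lt]
  have h2 : 0 < 1 / (2 * (γ - 1)) := by positivity
  have h3 : (0 : ℝ) ≤ j := Nat.cast_nonneg j
  unfold vortExp
  push_cast
  linarith

theorem LinFlow.abs_u_le (S : LinFlow γ j M) {p : Spacetime}
    (hp : p ∈ (flowDomain γ j M).carrier S) (μ : Fin 4) : |S.u μ p| ≤ M := by
  simpa [multiD_zero] using S.abs_multiD_u_le hp (a := 0) (by simp) μ

/-- The square of a quantity of weight `r^{-e}`, multiplied by `r^{2e}`, is bounded by the density of
the energy norm. -/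
theorem LinFlow.rpow_mul_flowWeight_sq (S : LinFlow γ j M) {p : Spacetime}
    (hp : p ∈ (flowDomain γ j M).carrier S) (e : ℝ) :
    S.r p ^ (2 * e) * flowWeight e S p ^ 2 = S.density p := by
  have hr := S.vacuum.pos p hp
  rw [flowWeight, mul_pow, S.ampl_sq, ← Real.rpow_mul_natCast hr.le, mul_left_comm,
    ← Real.rpow_add hr]
  simp
  rw [show 2 * e + -(e * 2) = 0 by ring]
  simp

/-- The transport energy estimate for one derivative of one component of the linearized
vorticity. No Grönwall argument is needed, since the vorticity is itself bounded by the energy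
norm. -/
theorem exists_wL2Sq_linVort_le (α β : Fin 4) {δ : Fin 3 → ℕ} (hδ : ∑ i, δ i ≤ 2 * j + 1) :
    ∃ C : ℝ≥0, ∀ (S : LinFlow γ j M), ∀ t ∈ Icc 0 S.T,
      wL2Sq S.Ω S.r (vortExp γ j) t (spatialD δ (S.linVort α β))
        ≤ M * wL2Sq S.Ω S.r (vortExp γ j) 0 (spatialD δ (S.linVort α β))
          + C * ∫⁻ τ in Icc 0 t, calHSq γ S.Ω S.r (j + 1) S.s' S.r' S.u' τ := by
  obtain ⟨_, hs, ⟨_, C₁, h1⟩, _, C₂, h2⟩ :=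
    transportBound_spatialD_linVort (γ := γ) (j := j) (M := M) α β hδ
  have hdiv : Background (2 * j + 2) (fun (S : LinFlow γ j M) p => divg S.u p) :=
    .sum _ fun μ _ => background_pd (background_u μ) (by omega) μ
  obtain ⟨_, C₃, h3⟩ := hdiv.dominated
  set C : ℝ := C₁ ^ 2 * (|1 - 2 * vortExp γ j * (γ - 1)| * |C₃|) + 2 * (|C₁| * (M * |C₂|)) with hC
  have hC0 : 0 ≤ C := by positivity
  refine ⟨C.toNNReal, fun S t ht => ?_⟩
  have hden : ∀ τ, ∫⁻ x in S.Ω τ, ENNReal.ofReal (C * S.density (τ, x))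
      = C.toNNReal * calHSq γ S.Ω S.r (j + 1) S.s' S.r' S.u' τ := by
    intro τ
    rw [← lintegral_density, ← lintegral_const_mul' _ _ (by simp)]
    refine lintegral_congr fun x => ?_
    rw [ENNReal.ofReal_mul hC0]
    rfl
  rw [← lintegral_const_mul' _ _ (by simp)]
  simp only [← hden]
  refine wL2Sq_transport_le (w := spatialD δ (S.linVort α β)) (Q := fun p => C * S.density p)
    S.euler S.vacuum S.half_lt_vortExp (hs S)
    (fun p hp => (le_abs_self _).trans (S.abs_u_le hp 0)) (fun p hp => ?_) ht
  set w := spatialD δ (S.linVort α β) with hw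
  set ρ := flowWeight (vortExp γ j) S p with hρ
  have hr := S.vacuum.pos p hp
  have hρ0 : 0 ≤ ρ := mul_nonneg (Real.sqrt_nonneg _) (Real.rpow_nonneg hr.le _)
  have b1 : |w p| ≤ |C₁| * ρ := (h1 S p hp).trans (by gcongr; exact le_abs_self _)
  have b2 : |along S.u w p| ≤ M * (|C₂| * ρ) := by
    rw [S.along_eq_mat hp, abs_mul]
    have := (h2 S p hp).trans (mul_le_mul_of_nonneg_right (le_abs_self C₂) hρ0)
    exact mul_le_mul (S.abs_u_le hp 0) this (abs_nonneg _) M.coe_nonneg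
  have b3 : |divg S.u p| ≤ |C₃| := ((h3 S p hp).trans_eq (mul_one _)).trans (le_abs_self _)
  have b4 : w p ^ 2 ≤ C₁ ^ 2 * ρ ^ 2 := by
    rw [← sq_abs, ← sq_abs C₁, ← mul_pow]
    gcongr
  have b5 : w p * along S.u w p ≤ (|C₁| * ρ) * (M * (|C₂| * ρ)) :=
    (le_abs_self _).trans (by rw [abs_mul]; gcongr)
  have b6 : (1 - 2 * vortExp γ j * (γ - 1)) * divg S.u p
      ≤ |1 - 2 * vortExp γ j * (γ - 1)| * |C₃| :=
    (le_abs_self _).trans (by rw [abs_mul]; gcongr)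
  have b7 : w p ^ 2 * ((1 - 2 * vortExp γ j * (γ - 1)) * divg S.u p)
      ≤ (C₁ ^ 2 * ρ ^ 2) * (|1 - 2 * vortExp γ j * (γ - 1)| * |C₃|) :=
    (mul_le_mul_of_nonneg_left b6 (sq_nonneg _)).trans
      (mul_le_mul_of_nonneg_right b4 (by positivity))
  calc S.r p ^ (2 * vortExp γ j) * (w p ^ 2 * ((1 - 2 * vortExp γ j * (γ - 1)) * divg S.u p)
        + 2 * (w p * along S.u w p))
      ≤ S.r p ^ (2 * vortExp γ j) * (C * ρ ^ 2) := by
        refine mul_le_mul_of_nonneg_left ?_ (Real.rpow_nonneg hr.le _)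
        rw [hC]
        linarith
    _ = C * S.density p := by rw [← S.rpow_mul_flowWeight_sq hp (vortExp γ j)]; ring

/-- The correction between the two vorticities is small because it carries an extra half power
of `r`. -/
theorem exists_wL2Sq_correction_le (α β : Fin 4) {δ : Fin 3 → ℕ} (hδ : ∑ i, δ i ≤ 2 * j + 1) :
    ∃ C : ℝ≥0, ∀ (S : LinFlow γ j M) (t ε : ℝ), t ∈ Icc 0 S.T →
      (∀ p ∈ (flowDomain γ j M).carrier S, S.r p ≤ ε) →
      wL2Sq S.Ω S.r (vortExp γ j) t (spatialD δ (curl S.h' S.u α β))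
        ≤ C * (ENNReal.ofReal ε * calHSq γ S.Ω S.r (j + 1) S.s' S.r' S.u' t) := by
  obtain ⟨_, C, h⟩ := (twoTier_vorticity_correction (γ := γ) (j := j) (M := M) α β).1.spatialD δ hδ
  refine ⟨(C ^ 2).toNNReal, fun S t ε ht hε => ?_⟩
  rw [← mul_assoc, ← lintegral_density, ← lintegral_const_mul' _ _ (by finiteness)]
  refine setLIntegral_mono' (S.vacuum.isOpen_slice ht).measurableSet fun x hx => ?_
  have hp : (t, x) ∈ (flowDomain γ j M).carrier S := ⟨ht, hx⟩
  have hr := S.vacuum.pos _ hp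
  have h1 := h S _ hp
  have hε0 : 0 ≤ ε := hr.le.trans (hε _ hp)
  rw [← enorm_pow, Real.enorm_eq_ofReal (sq_nonneg _)]
  change _ ≤ ENNReal.ofReal (C ^ 2) * _ * _
  rw [← ENNReal.ofReal_mul (sq_nonneg _), ← ENNReal.ofReal_mul (by positivity)]
  refine ENNReal.ofReal_le_ofReal ?_
  set p : Spacetime := (t, x)
  set e := vortExp γ j
  have h2 : spatialD δ (curl S.h' S.u α β) p ^ 2 ≤ C ^ 2 * flowWeight (e - 1 / 2) S p ^ 2 := by
    rw [← sq_abs, ← mul_pow]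
    exact pow_le_pow_left₀ (abs_nonneg _) h1 2
  have h3 : S.r p ^ (2 * e) = S.r p ^ (2 * (e - 1 / 2)) * S.r p := by
    rw [← Real.rpow_add_one hr.ne']
    ring_nf
  calc (S.r p ^ e * spatialD δ (curl S.h' S.u α β) p) ^ 2
      = S.r p ^ (2 * e) * spatialD δ (curl S.h' S.u α β) p ^ 2 := by
        rw [mul_pow, ← Real.rpow_mul_natCast hr.le, Nat.cast_ofNat, mul_comm e]
    _ ≤ S.r p ^ (2 * e) * (C ^ 2 * flowWeight (e - 1 / 2) S p ^ 2) :=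
        mul_le_mul_of_nonneg_left h2 (Real.rpow_nonneg hr.le _)
    _ = C ^ 2 * S.r p * S.density p := by
        rw [h3, ← S.rpow_mul_flowWeight_sq hp (e - 1 / 2)]
        ring
    _ ≤ C ^ 2 * ε * S.density p := by
        have := hε p hp
        have := S.density_nonneg p
        gcongr

/-! ### Summation over derivatives and components -/

theorem iterate_pd_add {f g : Spacetime → ℝ} (hf : ContDiff ℝ (⊤ : ℕ∞) f)
    (hg : ContDiff ℝ (⊤ : ℕ∞) g) (μ : Fin 4) (n : ℕ) :
    (pd μ)^[n] (fun q => f q + g q) = fun q => (pd μ)^[n] f q + (pd μ)^[n] g q := by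
  induction n generalizing f g with
  | zero => rfl
  | succ n ih =>
    have : pd μ (fun q => f q + g q) = fun q => pd μ f q + pd μ g q := funext fun p =>
      pd_add (contDiff_differentiableAt hf p) (contDiff_differentiableAt hg p) μ
    simp only [Function.iterate_succ_apply, this]
    exact ih (contDiff_pd hf μ) (contDiff_pd hg μ)

theorem spatialD_add {f g : Spacetime → ℝ} (hf : ContDiff ℝ (⊤ : ℕ∞) f)
    (hg : ContDiff ℝ (⊤ : ℕ∞) g) (δ : Fin 3 → ℕ) :
    spatialD δ (fun q => f q + g q) = fun q => spatialD δ f q + spatialD δ g q := by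
  have s := fun {f : Spacetime → ℝ} (hf : ContDiff ℝ (⊤ : ℕ∞) f) μ n => iterate_pd_smooth hf μ n
  unfold spatialD multiD
  rw [iterate_pd_add hf hg, iterate_pd_add (s hf _ _) (s hg _ _),
    iterate_pd_add (s (s hf _ _) _ _) (s (s hg _ _) _ _),
    iterate_pd_add (s (s (s hf _ _) _ _) _ _) (s (s (s hg _ _) _ _) _ _)]

theorem wL2Sq_le_add {Ω : ℝ → Set Space} {r f g : Spacetime → ℝ} (hr : Continuous r)
    (hg : Continuous g) (σ t : ℝ) :
    wL2Sq Ω r σ t f ≤ 2 * wL2Sq Ω r σ t (fun q => f q + g q) + 2 * wL2Sq Ω r σ t g := by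
  have hm : Measurable fun x : Space => 2 * ‖r (t, x) ^ σ * g (t, x)‖ₑ ^ 2 := by
    have h1 : Measurable fun x : Space => r (t, x) := (hr.comp (by fun_prop)).measurable
    have h2 : Measurable fun x : Space => g (t, x) := (hg.comp (by fun_prop)).measurable
    exact (((h1.pow_const σ).mul h2).enorm.pow_const 2).const_mul 2
  unfold wL2Sq
  rw [← lintegral_const_mul' _ _ (by simp), ← lintegral_const_mul' _ _ (by simp),
    ← lintegral_add_right _ hm]
  refine lintegral_mono fun x => ?_
  simp only [← enorm_pow, Real.enorm_eq_ofReal (sq_nonneg _)]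
  rw [← ENNReal.ofReal_ofNat 2, ← ENNReal.ofReal_mul (by norm_num),
    ← ENNReal.ofReal_mul (by norm_num), ← ENNReal.ofReal_add (by positivity) (by positivity)]
  refine ENNReal.ofReal_le_ofReal ?_
  nlinarith [sq_nonneg (r (t, x) ^ σ * f (t, x) + 2 * (r (t, x) ^ σ * g (t, x)))]

/-- Finitely many bounds with the same data can be added; the constant of the sum is the sum of the
constants. -/
theorem exists_sum_bound {κ Z : Type*} (I : Finset κ) {l a : κ → Z → ℝ≥0∞} {X : Z → ℝ≥0∞}
    {K : ℝ≥0∞} (h : ∀ i ∈ I, ∃ C : ℝ≥0, ∀ z, l i z ≤ K * a i z + C * X z) :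
    ∃ C : ℝ≥0, ∀ z, ∑ i ∈ I, l i z ≤ K * ∑ i ∈ I, a i z + C * X z := by
  classical
  induction I using Finset.induction_on with
  | empty => exact ⟨0, by simp⟩
  | insert b I hb ih =>
    obtain ⟨C₁, h₁⟩ := h b (by simp)
    obtain ⟨C₂, h₂⟩ := ih fun i hi => h i (by simp [hi])
    refine ⟨C₁ + C₂, fun z => ?_⟩
    rw [Finset.sum_insert hb, Finset.sum_insert hb]
    refine (add_le_add (h₁ z) (h₂ z)).trans_eq ?_
    push_cast
    ring

/-- The estimate for all flows with the same parameters. -/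
theorem exists_sobSqForm_redVorticity_le (γ : ℝ) (j : ℕ) (M : ℝ≥0) :
    ∃ C : ℝ≥0, ∀ (S : LinFlow γ j M) (t ε : ℝ), t ∈ Icc 0 S.T →
      (∀ p ∈ (flowDomain γ j M).carrier S, S.r p ≤ ε) →
      sobSqForm S.Ω S.r (2 * (j + 1) - 1) (vortExp γ j) t (redVorticity γ S.s S.r S.u')
        ≤ C * (sobSqForm S.Ω S.r (2 * (j + 1) - 1) (vortExp γ j) 0 S.linVort
          + ENNReal.ofReal ε * calHSq γ S.Ω S.r (j + 1) S.s' S.r' S.u' t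
          + ∫⁻ τ in Icc 0 t, calHSq γ S.Ω S.r (j + 1) S.s' S.r' S.u' τ) := by
  let Z := {z : LinFlow γ j M × ℝ × ℝ // z.2.1 ∈ Icc 0 z.1.T ∧
    ∀ p ∈ (flowDomain γ j M).carrier z.1, z.1.r p ≤ z.2.2}
  let X : Z → ℝ≥0∞ := fun z =>
    ENNReal.ofReal z.1.2.2 * calHSq γ z.1.1.Ω z.1.1.r (j + 1) z.1.1.s' z.1.1.r' z.1.1.u' z.1.2.1
      + ∫⁻ τ in Icc 0 z.1.2.1, calHSq γ z.1.1.Ω z.1.1.r (j + 1) z.1.1.s' z.1.1.r' z.1.1.u' τ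
  have key : ∃ C : ℝ≥0, ∀ z : Z,
      sobSqForm z.1.1.Ω z.1.1.r (2 * (j + 1) - 1) (vortExp γ j) z.1.2.1
          (redVorticity γ z.1.1.s z.1.1.r z.1.1.u')
        ≤ (2 * M) * sobSqForm z.1.1.Ω z.1.1.r (2 * (j + 1) - 1) (vortExp γ j) 0 z.1.1.linVort
          + C * X z := by
    unfold sobSqForm sobSq
    refine exists_sum_bound _ fun α _ => exists_sum_bound _ fun β _ =>
      exists_sum_bound _ fun n hn => exists_sum_bound _ fun δ hδ => ?_
    have hδ' : ∑ i, δ i ≤ 2 * j + 1 := by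
      have h1 : ∑ i, δ i = n := by simpa [multiIdx] using hδ
      have h2 := Finset.mem_range.1 hn
      omega
    obtain ⟨C₁, h1⟩ := exists_wL2Sq_linVort_le (γ := γ) (j := j) (M := M) α β hδ'
    obtain ⟨C₂, h2⟩ := exists_wL2Sq_correction_le (γ := γ) (j := j) (M := M) α β hδ'
    refine ⟨2 * C₁ + 2 * C₂, fun ⟨⟨S, t, ε⟩, ht, hε⟩ => ?_⟩
    have e : spatialD δ (S.linVort α β) = fun q => spatialD δ (redVorticity γ S.s S.r S.u' α β) q
        + spatialD δ (curl S.h' S.u α β) q := by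
      rw [S.linVort_eq, S.redVorticity_eq]
      exact spatialD_add (contDiff_curl S.contDiff_h S.linear.smooth_u α β)
        (contDiff_curl S.contDiff_h' S.euler.smooth_u α β) δ
    have h3 := wL2Sq_le_add (Ω := S.Ω) (f := spatialD δ (redVorticity γ S.s S.r S.u' α β))
      S.euler.smooth_r.continuous (contDiff_spatialD
        (contDiff_curl S.contDiff_h' S.euler.smooth_u α β) δ).continuous (vortExp γ j) t
    rw [← e] at h3
    refine h3.trans ((add_le_add (mul_le_mul_right (h1 S t ht) 2)
      (mul_le_mul_right (h2 S t ε ht hε) 2)).trans ?_)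
    simp only [X]
    push_cast
    have : ∀ a b c d A B : ℝ≥0∞, 2 * (a * b + A * c) + 2 * (B * d)
        ≤ 2 * a * b + (2 * A + 2 * B) * (d + c) := by
      intro a b c d A B
      calc 2 * (a * b + A * c) + 2 * (B * d)
          ≤ 2 * (a * b + A * c) + 2 * (B * d) + (2 * A * d + 2 * B * c) := le_self_add
        _ = _ := by ring
    exact this _ _ _ _ _ _
  obtain ⟨C, hC⟩ := key
  refine ⟨2 * M + C, fun S t ε ht hε => (hC ⟨⟨S, t, ε⟩, ht, hε⟩).trans ?_⟩
  simp only [X]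
  rw [ENNReal.coe_add, ENNReal.coe_mul, ENNReal.coe_ofNat, add_assoc]
  have : ∀ K c a b : ℝ≥0∞, K * a + c * b ≤ (K + c) * (a + b) := fun K c a b =>
    add_mul K c (a + b) ▸ add_le_add (mul_le_mul_right le_self_add K)
      (mul_le_mul_right le_add_self c)
  exact this _ _ _ _

end RelEuler

theorem mainTheorem4 (γ : ℝ) (hγ : 1 < γ) (k : ℕ) (hk : 1 ≤ k) :
    ∃ 𝒞 : ℝ≥0 → ℝ≥0, Monotone 𝒞 ∧
      ∀ M : ℝ≥0, ∃ C D : ℝ≥0,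
        ∀ (T : ℝ) (_ : 0 < T) (Ω : ℝ → Set RelEuler.Space)
          (s r : RelEuler.Spacetime → ℝ) (u : Fin 4 → RelEuler.Spacetime → ℝ),
          RelEuler.IsEulerSolution γ T Ω s r u →
          RelEuler.IsPhysicalVacuum T Ω r →
          (∀ t ∈ Set.Icc 0 T, RelEuler.supNorm (2 * k + 1) Ω s r u t ≤ M) →
          ∀ ε' ε : ℝ, 0 < ε' → C * ε' < 1 / 2 → ε' ≤ ε → ε < 1 / 2 →
          (∀ p ∈ RelEuler.movingDomain T Ω, r p ≤ ε') →
          ∀ (s' r' : RelEuler.Spacetime → ℝ) (u' : Fin 4 → RelEuler.Spacetime → ℝ),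
            RelEuler.IsLinearizedSolution γ T Ω s r u s' r' u' →
            ∀ t ∈ Set.Icc 0 T,
              RelEuler.sobSqForm Ω r (2 * k - 1) (k + 1 / (2 * (γ - 1))) t
                  (RelEuler.redVorticity γ s r u')
                ≤ D * (RelEuler.sobSqForm Ω r (2 * k - 1) (k + 1 / (2 * (γ - 1))) 0
                        (RelEuler.linVorticity γ s r u s' r' u')
                      + ENNReal.ofReal ε * RelEuler.calHSq γ Ω r k s' r' u' t
                      + ∫⁻ τ in Set.Icc 0 t,
                          (𝒞 (RelEuler.supNorm (2 * k + 1) Ω s r u τ).toNNReal : ℝ≥0∞)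
                            * RelEuler.calHSq γ Ω r k s' r' u' τ) := by
  obtain ⟨j, rfl⟩ : ∃ j, k = j + 1 := ⟨k - 1, by omega⟩
  -- `D` may depend on the bound `M` of `N(τ)`, so it can absorb the dependence of the integrand on
  -- `N(τ)`; the constant weight gives the strongest form of the estimate.
  refine ⟨fun _ => 1, monotone_const, fun M => ?_⟩
  obtain ⟨D, hD⟩ := RelEuler.exists_sobSqForm_redVorticity_le γ j M
  have hγ0 : 0 < γ - 1 := by linarith
  -- An upper bound for `(γ - 1) / Γ(s)` when `|s| ≤ M`, so that `C r < 1/2` makes the flow thin.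
  set C : ℝ := (γ - 1) * (γ / (γ - 1) ^ ((γ - 1) / γ) * Real.exp ((γ - 1) / γ * M)) with hC
  have hC0 : 0 ≤ C := by positivity
  refine ⟨C.toNNReal, D, fun T hT Ω s r u hE hV hM ε' ε hε' hCε hεε hε hr s' r' u' hL t ht => ?_⟩
  rw [Real.coe_toNNReal C hC0] at hCε
  have hs : ∀ p ∈ RelEuler.movingDomain T Ω, |s p| ≤ M := by
    intro p hp
    refine RelEuler.abs_le_of_enorm_le (le_trans ?_ (hM p.1 hp.1))
    unfold RelEuler.supNorm
    refine le_iSup₂_of_le (0 : Fin 4 → ℕ) (by simp) (le_iSup₂_of_le p.2 hp.2 ?_)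
    exact (le_add_right le_self_add)
  let S : RelEuler.LinFlow γ j M :=
    { T := T, Ω := Ω, s := s, r := r, u := u, s' := s', r' := r', u' := u'
      one_lt := hγ, T_pos := hT, euler := hE, vacuum := hV, linear := hL, supNorm_le := hM
      r_le_one := fun p hp => by linarith [hr p hp]
      thin := fun p hp => by
        have h1 : (γ - 1) * (RelEuler.Gam γ (s p))⁻¹ ≤ C := by
          rw [RelEuler.inv_Gam hγ, hC]
          have := (abs_le.1 (hs p hp)).2
          gcongr
        have h2 := hV.pos p hp
        have h3 : (γ - 1) * (RelEuler.Gam γ (s p))⁻¹ * r p ≤ C * ε' :=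
          mul_le_mul h1 (hr p hp) h2.le hC0
        linarith }
  simp only [ENNReal.coe_one, one_mul]
  exact hD S t ε ht fun p hp => (hr p hp).trans hεε
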